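/- **Conventions.** A relational signature is a nonempty collection of relation symbols, each with an arity at least $1$. A structure $\mathbb A$ in a signature has a finite universe $A$ with at least two elements and interprets each symbol $R$ of arity $n$ by a nonempty proper relation $\emptyset\subsetneq R^{\mathbb A}\subsetneq A^{n}$. For $\mathcal L\subseteq\{\exists,\forall,\wedge,\vee,=,\neq,\neg\}$, an $\mathcal L$-sentence is a first-order sentence in the given signature whose connectives, quantifiers and (dis)equality symbols all lie in $\mathcal L$. A pair $(\mathbb A,\mathbb B)$ of structures in the same signature is an $\mathcal L$-PMC template if every $\mathcal L$-sentence true in $\mathbb A$ is true in $\mathbb B$. For such a template, $\mathcal L\text{-}\mathrm{PMC}(\mathbb A,\mathbb B)$ is the promise problem whose instances are $\mathcal L$-sentences $\phi$ (written as words over a finite alphabet, each relation symbol being written by means of a fixed binary name, with distinct names for distinct symbols), $\phi$ being a Yes-instance if $\mathbb A\models\phi$ and a No-instance if $\mathbb B\not\models\phi$. The template is closed under complementation if for every symbol $R$ there is a symbol $\overline R$ of the same arity $n$ with $\overline R^{\mathbb A}=A^{n}\setminus R^{\mathbb A}$ and $\overline R^{\mathbb B}=B^{n}\setminus R^{\mathbb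 B}$. A promise problem is PSPACE-hard if for every language $X$ in PSPACE over a finite alphabet there is a function computable in logarithmic space that maps the words in $X$ to Yes-instances and the words not in $X$ to No-instances. **Proposition.** Let $\mathbb A,\mathbb B$ be structures in the same signature. 1. If $(\mathbb A,\mathbb B)$ is an $\{\exists,\forall,\wedge,\vee\}$-PMC template which is closed under complementation, then $\{\exists,\forall,\wedge,\vee\}\text{-}\mathrm{PMC}(\mathbb A,\mathbb B)$ is PSPACE-hard. 2. Consequently, if $\{\exists,\forall,\wedge,\vee\}\subsetneq\mathcal L\subseteq\{\exists,\forall,\wedge,\vee,=,\neq,\neg\}$ and $(\mathbb A,\mathbb B)$ is an $\mathcal L$-PMC template, then $\mathcal L\text{-}\mathrm{PMC}(\mathbb A,\mathbb B)$ is PSPACE-hard. In particular this holds for the extensions of $\{\exists,\forall,\wedge,\vee\}$ by $=$, by $\neq$ and by $\neg$. -/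

import Mathlib

namespace PMC

/-! ### Signatures and finite relational models -/

/-- A relational signature: a nonempty collection of symbols, each of arity at least one. -/
structure Signature where
  Symbol : Type*
  arity : Symbol → ℕ
  arity_pos : ∀ R, 1 ≤ arity R
  nonempty : Nonempty Symbol

/-- A relational structure: a finite universe with at least two elements, in which every symbol is
interpreted by a nonempty proper relation. -/
structure Model (S : Signature) where
  Carrier : Type*
  finite : Finite Carrier
  nontrivial : Nontrivial Carrier
  interp : (R : S.Symbol) → Set (Fin (S.arity R) → Carrier)
  interp_nonempty : ∀ R, (interp R).Nonempty
  interp_proper : ∀ R, interp R ≠ Set.univ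

/-! ### First-order formulas and their fragments -/

/-- First-order formulas over `S`; the variables are `x₀, x₁, x₂, …`. -/
inductive Formula (S : Signature) where
  | rel (R : S.Symbol) (v : Fin (S.arity R) → ℕ)
  | equal (i j : ℕ)
  | unequal (i j : ℕ)
  | neg (φ : Formula S)
  | conj (φ ψ : Formula S)
  | disj (φ ψ : Formula S)
  | ex (i : ℕ) (φ : Formula S)
  | all (i : ℕ) (φ : Formula S)

/-- The logical symbols `∃, ∀, ∧, ∨, =, ≠, ¬`. -/
inductive Op where
  | ex | all | conj | disj | equal | unequal | neg

/-- The fragment `{∃, ∀, ∧, ∨}`. -/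
def positiveOps : Set Op := {Op.ex, Op.all, Op.conj, Op.disj}

namespace Formula

variable {S : Signature}

/-- The logical symbols that occur in a formula. -/
def ops : Formula S → Set Op
  | rel _ _ => ∅
  | equal _ _ => {Op.equal}
  | unequal _ _ => {Op.unequal}
  | neg φ => insert Op.neg φ.ops
  | conj φ ψ => insert Op.conj (φ.ops ∪ ψ.ops)
  | disj φ ψ => insert Op.disj (φ.ops ∪ ψ.ops)
  | ex _ φ => insert Op.ex φ.ops
  | all _ φ => insert Op.all φ.ops

/-- The free variables of a formula. -/
def freeVars : Formula S → Set ℕ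
  | rel _ v => Set.range v
  | equal i j => {i, j}
  | unequal i j => {i, j}
  | neg φ => φ.freeVars
  | conj φ ψ => φ.freeVars ∪ ψ.freeVars
  | disj φ ψ => φ.freeVars ∪ ψ.freeVars
  | ex i φ => φ.freeVars \ {i}
  | all i φ => φ.freeVars \ {i}

/-- Tarski semantics under the evaluation `e` of the variables. -/
def Sat (A : Model S) : Formula S → (ℕ → A.Carrier) → Prop
  | rel R v, e => (fun k => e (v k)) ∈ A.interp R
  | equal i j, e => e i = e j
  | unequal i j, e => e i ≠ e j
  | neg φ, e => ¬ Sat A φ e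
  | conj φ ψ, e => Sat A φ e ∧ Sat A ψ e
  | disj φ ψ, e => Sat A φ e ∨ Sat A ψ e
  | ex i φ, e => ∃ a, Sat A φ (Function.update e i a)
  | all i φ, e => ∀ a, Sat A φ (Function.update e i a)

/-- An `L`-sentence: no free variables, and no logical symbols other than those in `L`. -/
def IsSentence (L : Set Op) (φ : Formula S) : Prop :=
  φ.freeVars = ∅ ∧ φ.ops ⊆ L

end Formula

/-- `A ⊨ φ`; only used for sentences, whose truth does not depend on the evaluation. -/
def Models {S : Signature} (A : Model S) (φ : Formula S) : Prop :=
  ∀ e : ℕ → A.Carrier, φ.Sat A e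

/-- `(A, B)` is an `L`-PMC template: every `L`-sentence true in `A` is true in `B`. -/
def IsTemplate {S : Signature} (L : Set Op) (A B : Model S) : Prop :=
  ∀ φ : Formula S, φ.IsSentence L → Models A φ → Models B φ

/-- Every symbol `R` has a symbol `R'` of the same arity that is interpreted, both in `A` and
in `B`, by the complement of the interpretation of `R`. -/
def ClosedUnderComplementation {S : Signature} (A B : Model S) : Prop :=
  ∀ R : S.Symbol, ∃ (R' : S.Symbol) (h : S.arity R' = S.arity R),
    (∀ t : Fin (S.arity R) → A.Carrier,
      (fun k => t (Fin.cast h k)) ∈ A.interp R' ↔ t ∉ A.interp R) ∧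
    (∀ t : Fin (S.arity R) → B.Carrier,
      (fun k => t (Fin.cast h k)) ∈ B.interp R' ↔ t ∉ B.interp R)

/-! ### Sentences as words -/

/-- The finite alphabet in which formulas are written. -/
inductive Token where
  | ex | all | conj | disj | equal | unequal | neg
  | rel | bit (b : Bool)
  | var | tick

/-- The variable `xᵢ` is written as `var` followed by `i` ticks. -/
def encodeVar (i : ℕ) : List Token := Token.var :: List.replicate i Token.tick

/-- A formula in prefix (Polish) notation. A relation symbol `R` is written as `rel` followed by
its name `code R`. -/
def encode {S : Signature} (code : S.Symbol → List Bool) : Formula S → List Token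
  | .rel R v => Token.rel :: ((code R).map Token.bit ++ (List.ofFn fun k => encodeVar (v k)).flatten)
  | .equal i j => Token.equal :: (encodeVar i ++ encodeVar j)
  | .unequal i j => Token.unequal :: (encodeVar i ++ encodeVar j)
  | .neg φ => Token.neg :: encode code φ
  | .conj φ ψ => Token.conj :: (encode code φ ++ encode code ψ)
  | .disj φ ψ => Token.disj :: (encode code φ ++ encode code ψ)
  | .ex i φ => Token.ex :: (encodeVar i ++ encode code φ)
  | .all i φ => Token.all :: (encodeVar i ++ encode code φ)

/-- A promise problem over the alphabet `β`: a set of Yes-instances and a set of No-instances. -/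
structure PromiseProblem (β : Type*) where
  yes : Set (List β)
  no : Set (List β)

/-- The `L`-Promise Model Checking Problem over `(A, B)`, with relation symbols named by `code`. -/
def promiseMC {S : Signature} (code : S.Symbol → List Bool) (L : Set Op) (A B : Model S) :
    PromiseProblem Token where
  yes := {w | ∃ φ : Formula S, φ.IsSentence L ∧ Models A φ ∧ w = encode code φ}
  no := {w | ∃ φ : Formula S, φ.IsSentence L ∧ ¬ Models B φ ∧ w = encode code φ}

/-! ### Polynomial space -/

/-- Head movements. -/
inductive Move where
  | left | stay | right

/-- The displacement of a head. -/
def Move.toInt : Move → ℤ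
  | .left => -1
  | .stay => 0
  | .right => 1

/-- A deterministic single-tape Turing machine with input alphabet `α`. Tape symbols are the
blank `none`, the input symbols and the additional symbols in `Γ`. The machine halts when
`δ` gives no instruction, and then accepts iff its state is accepting. -/
structure TM (α : Type) where
  Q : Type
  finite_Q : Finite Q
  Γ : Type
  finite_Γ : Finite Γ
  start : Q
  accepting : Set Q
  δ : Q → Option (α ⊕ Γ) → Option (Q × Option (α ⊕ Γ) × Move)

namespace TM

variable {α : Type} (M : TM α)

/-- A configuration; the tape is infinite in both directions. -/
structure Cfg where
  state : M.Q
  head : ℤ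
  tape : ℤ → Option (α ⊕ M.Γ)

/-- The input `w` stands on the cells `0, …, |w| - 1`, the other cells are blank. -/
def init (w : List α) : M.Cfg where
  state := M.start
  head := 0
  tape := fun z => if 0 ≤ z then (w[z.toNat]?).map Sum.inl else none

/-- One step of the computation; `none` if the machine has halted. -/
def step (c : M.Cfg) : Option M.Cfg :=
  (M.δ c.state (c.tape c.head)).map fun a =>
    { state := a.1
      head := c.head + a.2.2.toInt
      tape := Function.update c.tape c.head a.2.1 }

/-- Reachability in finitely many steps. -/
def Reaches : M.Cfg → M.Cfg → Prop :=
  Relation.ReflTransGen fun c d => M.step c = some d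

/-- `M` decides `X` in space `O(s)`: on every input `w` it halts, its head stays within the cells
`-s(|w|), …, s(|w|)`, and it accepts iff `w ∈ X`. -/
def DecidesInSpace (X : Set (List α)) (s : ℕ → ℕ) : Prop :=
  ∀ w : List α,
    (∀ c, M.Reaches (M.init w) c → c.head.natAbs ≤ s w.length) ∧
    ∃ c, M.Reaches (M.init w) c ∧ M.step c = none ∧ (c.state ∈ M.accepting ↔ w ∈ X)

end TM

/-- The class PSPACE. -/
def InPSPACE {α : Type} (X : Set (List α)) : Prop :=
  ∃ (M : TM α) (p : Polynomial ℕ), M.DecidesInSpace X fun n => p.eval n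

/-! ### Logarithmic space reductions -/

/-- Content of a cell of the read-only input tape: an input symbol or an end marker. -/
inductive InputCell (α : Type*) where
  | leftEnd
  | sym (a : α)
  | rightEnd

/-- A deterministic Turing machine with a two-way read-only input tape, `k` work tapes with
alphabet `Option Γ` (blank `none`) and a write-only output tape. An instruction consists
of the new state, the movement of the input head, what is written by each work head and how it
moves, and the word that is appended to the output. The machine halts when `δ` gives no
instruction. -/
structure Transducer (α β : Type) where
  Q : Type
  finite_Q : Finite Q
  Γ : Type
  finite_Γ : Finite Γ
  k : ℕ
  start : Q
  δ : Q → InputCell α → (Fin k → Option Γ) →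
    Option (Q × Move × (Fin k → Option Γ × Move) × List β)

namespace Transducer

variable {α β : Type} (T : Transducer α β)

structure Cfg where
  state : T.Q
  inputHead : ℕ
  head : Fin T.k → ℤ
  tape : Fin T.k → ℤ → Option T.Γ
  output : List β

/-- The input tape: left end marker on cell `0`, the word `w` on the cells `1, …, |w|`, right end
marker on cell `|w| + 1`. -/
def inputTape (w : List α) : ℕ → InputCell α
  | 0 => .leftEnd
  | i + 1 => (w[i]?).elim .rightEnd .sym

/-- Movement of the input head, which cannot leave the cells `0, …, n + 1`. -/
def moveInput (n h : ℕ) : Move → ℕ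
  | .left => h - 1
  | .stay => h
  | .right => min (h + 1) (n + 1)

def init : T.Cfg where
  state := T.start
  inputHead := 0
  head := fun _ => 0
  tape := fun _ _ => none
  output := []

/-- One step of the computation on input `w`; `none` if the machine has halted. -/
def step (w : List α) (c : T.Cfg) : Option T.Cfg :=
  (T.δ c.state (inputTape w c.inputHead) (fun i => c.tape i (c.head i))).map fun a =>
    { state := a.1
      inputHead := moveInput w.length c.inputHead a.2.1
      head := fun i => c.head i + (a.2.2.1 i).2.toInt
      tape := fun i => Function.update (c.tape i) (c.head i) (a.2.2.1 i).1
      output := c.output ++ a.2.2.2 }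

/-- Reachability in finitely many steps on input `w`. -/
def Reaches (w : List α) : T.Cfg → T.Cfg → Prop :=
  Relation.ReflTransGen fun c d => T.step w c = some d

/-- `T` computes `f` in space `O(s)`: on every input `w` it halts with output `f w`, and its work
heads stay within the cells `-s(|w|), …, s(|w|)`. -/
def ComputesInSpace (f : List α → List β) (s : ℕ → ℕ) : Prop :=
  ∀ w : List α,
    (∀ c, T.Reaches w T.init c → ∀ i, (c.head i).natAbs ≤ s w.length) ∧
    ∃ c, T.Reaches w T.init c ∧ T.step w c = none ∧ c.output = f w

end Transducer

/-- `f` is computable in logarithmic space. -/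
def LogSpaceComputable {α β : Type} (f : List α → List β) : Prop :=
  ∃ (T : Transducer α β) (C : ℕ), T.ComputesInSpace f fun n => C * (Nat.log 2 n + 1)

/-- A promise problem is PSPACE-hard if every language in PSPACE, over any finite alphabet, has a
logarithmic space many-one reduction to it: members are mapped to Yes-instances and
non-members to No-instances. -/
def PSPACEHard {β : Type} (P : PromiseProblem β) : Prop :=
  ∀ (α : Type) [Finite α] (X : Set (List α)), InPSPACE X →
    ∃ f : List α → List β, LogSpaceComputable f ∧
      (∀ w ∈ X, f w ∈ P.yes) ∧ (∀ w ∉ X, f w ∈ P.no)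

end PMC

/-! Both items follow from one criterion, `pspaceHard_of_definesEquivalence`: if some formula of the
fragment defines, in `A` and in `B`, an equivalence relation with at least two classes (or the
complement of one), then the problem is PSPACE-hard. With complements or `¬` the relation is
indiscernibility in the positions of a symbol `R`; it is nontrivial because `R` is nonempty and
proper (`exists_not_indiscernible`), and it is positive in `R` and its complement. With `=` or `≠`
it is equality; for `≠` the construction is dualized, with conjunction and disjunction, the two
quantifiers, and truth and falsity exchanged.

The criterion has three ingredients.

Machines as Boolean formulas: a polynomial space machine is viewed as a cellular automaton on a
cycle of `B` cells, `B` polynomial in the input length. A halted configuration is a fixed point, so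
it is reached after exactly as many steps as there are configurations, a power of two
(`iterate_eq_of_fixed`, `TM.accepts_iff`). Reachability in `2^k` steps is a quantified Boolean
formula of polynomial size: guess the middle configuration and let one universal variable select the
half, so that the formula for half the time is used only once (`QBF.sat_level`).

Boolean values inside a structure: take two inequivalent elements as false and true. A quantified
variable may also denote an element equivalent to neither. So elements are given names, and the
formula is required for every assignment `I` of truth values to the names. If the names exhaust the
universe, every element can stand for some value, and a true Boolean formula stays true. Conversely,
the `I` that sorts the names by equivalence to the element for true makes the two values exclude
each other, and the Boolean formula can be read off (`Frame.holds_matrix`). The sentence thus has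
the intended truth value in each of `A` and `B`.

Logarithmic space: the sentence is written by nested loops over a constant number of counters below
`B`. The counters are the tracks of one work tape with logarithmically many cells, in a base large
enough for the polynomial. The predicate `Emits` is closed under the operations that generate the
text (`emits_sentence`). -/

namespace PMC

/-! ### Machines that sweep over a list of columns -/

/-- A finite control that repeatedly sweeps from left to right over a list of columns, rewriting
them, possibly appending a column at the right end, and that after each sweep reads the input cell,
moves the input head, emits output, and either starts the next sweep or exits. -/
structure Flow (α β Col : Type) where
  Q : Type
  finite_Q : Finite Q
  start : Q
  scan : Q → Col → Q × Col
  append : Q → Option Col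
  next : Q → InputCell α → Option Q × Move × List β

namespace Flow

open Transducer (inputTape moveInput)

variable {α β Col : Type} (F : Flow α β Col)

/-- One sweep over the columns. -/
def pass : F.Q → List Col → F.Q × List Col
  | q, [] => (q, (F.append q).toList)
  | q, c :: cs => ((pass (F.scan q c).1 cs).1, (F.scan q c).2 :: (pass (F.scan q c).1 cs).2)

/-- `F.Runs w q h cs h' cs' o`: started in `q` with input head `h` and columns `cs`, the machine
exits with input head `h'` and columns `cs'`, having emitted `o`. -/
inductive Runs (w : List α) : F.Q → ℕ → List Col → ℕ → List Col → List β → Prop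
  | exit {q h cs m o} (e : F.next (F.pass q cs).1 (inputTape w h) = (none, m, o)) :
      Runs w q h cs (moveInput w.length h m) (F.pass q cs).2 o
  | step {q h cs q' m o h' cs' o'}
      (e : F.next (F.pass q cs).1 (inputTape w h) = (some q', m, o))
      (r : Runs w q' (moveInput w.length h m) (F.pass q cs).2 h' cs' o') :
      Runs w q h cs h' cs' (o ++ o')

theorem length_le_pass (q : F.Q) (cs : List Col) : cs.length ≤ (F.pass q cs).2.length := by
  induction cs generalizing q with
  | nil => simp [pass]
  | cons c cs ih => simpa [pass] using ih _

-- Sweeps may append columns but never delete them, so the final list bounds the space used during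
-- the whole run.
variable {F} in
theorem Runs.length_le {w : List α} {q h cs h' cs' o} (r : F.Runs w q h cs h' cs' o) :
    cs.length ≤ cs'.length := by
  induction r with
  | exit e => exact F.length_le_pass _ _
  | step e r ih => exact (F.length_le_pass _ _).trans ih

/-- The instructions of the transducer that simulates a sweeping machine: it alternates between
sweeping to the right and rewinding to the left, and has one halting state. -/
def instr : F.Q ⊕ F.Q ⊕ Unit → InputCell α → (Fin 1 → Option Col) →
    Option ((F.Q ⊕ F.Q ⊕ Unit) × Move × (Fin 1 → Option Col × Move) × List β)
  | .inl q, _, t => match t 0 with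
    | some c => some (.inl (F.scan q c).1, .stay, fun _ => (some (F.scan q c).2, .right), [])
    | none => some (.inr (.inl q), .stay, fun _ => (F.append q, .left), [])
  | .inr (.inl q), x, t => match t 0 with
    | some c => some (.inr (.inl q), .stay, fun _ => (some c, .left), [])
    -- The blank to the left of cell `0` ends the rewinding; only here is input consumed and output
    -- produced.
    | none => some ((F.next q x).1.elim (.inr (.inr ())) .inl, (F.next q x).2.1,
        fun _ => (none, .right), (F.next q x).2.2)
  | .inr (.inr _), _, _ => none

/-- The transducer with one work tape that holds the columns. -/
def toTransducer [Finite Col] : Transducer α β where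
  Q := F.Q ⊕ F.Q ⊕ Unit
  finite_Q := by have := F.finite_Q; infer_instance
  Γ := Col
  finite_Γ := inferInstance
  k := 1
  start := .inl F.start
  δ := F.instr

end Flow

/-! ### Lists written on a two-way infinite tape -/

/-- The tape on which a list is written from cell `0` on. -/
def tapeOf {Col : Type} (cs : List Col) : ℤ → Option Col :=
  fun z => if 0 ≤ z then cs[z.toNat]? else none

section tapeOf

variable {Col : Type}

theorem tapeOf_natCast (cs : List Col) (n : ℕ) : tapeOf cs n = cs[n]? := by simp [tapeOf]

theorem tapeOf_of_neg (cs : List Col) {z : ℤ} (hz : z < 0) : tapeOf cs z = none := by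
  simp [tapeOf, not_le.2 hz]

theorem update_tapeOf_middle (pre suf : List Col) (c c' : Col) :
    Function.update (tapeOf (pre ++ c :: suf)) (pre.length : ℤ) (some c') =
      tapeOf (pre ++ c' :: suf) := by
  funext z
  rcases lt_or_ge z 0 with hz | hz
  · rw [Function.update_of_ne (by omega), tapeOf_of_neg _ hz, tapeOf_of_neg _ hz]
  · lift z to ℕ using hz
    by_cases h : z = pre.length
    · subst h; simp [tapeOf_natCast]
    · rw [Function.update_of_ne (by exact_mod_cast h), tapeOf_natCast, tapeOf_natCast]
      rcases lt_or_gt_of_ne h with h | h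
      · simp [List.getElem?_append_left h]
      · obtain ⟨d, rfl⟩ := Nat.exists_eq_add_of_lt h
        rw [List.getElem?_append_right (by omega), List.getElem?_append_right (by omega)]
        have : pre.length + d + 1 - pre.length = d + 1 := by omega
        simp [this]

theorem update_tapeOf_end (cs : List Col) (o : Option Col) :
    Function.update (tapeOf cs) (cs.length : ℤ) o = tapeOf (cs ++ o.toList) := by
  funext z
  rcases lt_or_ge z 0 with hz | hz
  · rw [Function.update_of_ne (by omega), tapeOf_of_neg _ hz, tapeOf_of_neg _ hz]
  · lift z to ℕ using hz
    by_cases h : z = cs.length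
    · subst h; cases o <;> simp [tapeOf_natCast]
    · rw [Function.update_of_ne (by exact_mod_cast h), tapeOf_natCast, tapeOf_natCast]
      rcases lt_or_gt_of_ne h with h | h
      · simp [List.getElem?_append_left h]
      · rw [List.getElem?_eq_none h.le, List.getElem?_eq_none]
        cases o <;> simp <;> omega

theorem tapeOf_prefix_length (pre suf : List Col) (c : Col) :
    tapeOf (pre ++ c :: suf) (pre.length : ℤ) = some c := by
  simp [tapeOf_natCast]

theorem tapeOf_length (cs : List Col) : tapeOf cs (cs.length : ℤ) = none := by
  simp [tapeOf_natCast]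

end tapeOf

/-! ### Space-bounded computations of transducers -/

namespace Transducer

variable {α β : Type} (T : Transducer α β)

/-- A computation step from a configuration with all work heads within distance `s`. -/
def BoundedStep (w : List α) (s : ℕ) (c d : T.Cfg) : Prop :=
  T.step w c = some d ∧ ∀ i, (c.head i).natAbs ≤ s

variable {T} in
theorem BoundedStep.reaches {w : List α} {s : ℕ} {c d : T.Cfg}
    (h : Relation.ReflTransGen (T.BoundedStep w s) c d) : T.Reaches w c d :=
  Relation.ReflTransGen.mono (p := fun c d => T.step w c = some d) (fun _ _ h => h.1) _ _ h

/-- A computation that halts visits no configurations but those on the way. -/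
theorem head_le_of_halting {w : List α} {s : ℕ} {c d x : T.Cfg}
    (h : Relation.ReflTransGen (T.BoundedStep w s) c d) (hd : T.step w d = none)
    (hs : ∀ i, (d.head i).natAbs ≤ s) (hx : T.Reaches w c x) : ∀ i, (x.head i).natAbs ≤ s := by
  induction h using Relation.ReflTransGen.head_induction_on with
  | refl =>
    rcases Relation.ReflTransGen.cases_head hx with rfl | ⟨y, hy, -⟩
    · exact hs
    · simp [hd] at hy
  | head h _ ih =>
    rcases Relation.ReflTransGen.cases_head hx with rfl | ⟨y, hy, hyx⟩
    · exact h.2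
    · have := h.1.symm.trans hy
      simp only [Option.some.injEq] at this
      subst this
      exact ih hyx

end Transducer

/-! ### Simulation of sweeping machines by transducers -/

namespace Flow

open Transducer (inputTape moveInput)

variable {α β Col : Type} [Finite Col] (F : Flow α β Col)

/-- The configurations of the simulating transducer. -/
def cfg (q : F.Q ⊕ F.Q ⊕ Unit) (h : ℕ) (z : ℤ) (cs : List Col) (o : List β) :
    F.toTransducer.Cfg where
  state := q
  inputHead := h
  head := fun _ => z
  tape := fun _ => tapeOf cs
  output := o

/-- Turning back happens on the first cell after the old columns, whether or not a column is
appended there; hence the final position is the old length minus one. -/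
theorem sweep (w : List α) (s h : ℕ) (o : List β) (q : F.Q) (suf pre : List Col)
    (hs : pre.length + suf.length ≤ s) :
    Relation.ReflTransGen (F.toTransducer.BoundedStep w s)
      (F.cfg (.inl q) h pre.length (pre ++ suf) o)
      (F.cfg (.inr (.inl (F.pass q suf).1)) h ((pre.length + suf.length : ℕ) - 1)
        (pre ++ (F.pass q suf).2) o) := by
  induction suf generalizing pre q with
  | nil =>
    refine Relation.ReflTransGen.single ⟨?_, fun _ => ?_⟩
    · simp [Transducer.step, cfg, toTransducer, instr, tapeOf_length, update_tapeOf_end, pass,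
        moveInput, Move.toInt, sub_eq_add_neg]
    · simpa [cfg] using hs
  | cons c suf ih =>
    refine Relation.ReflTransGen.head (b := F.cfg (.inl (F.scan q c).1) h
      ((pre ++ [(F.scan q c).2]).length : ℕ) (pre ++ [(F.scan q c).2] ++ suf) o) ⟨?_, fun _ => ?_⟩ ?_
    · simp [Transducer.step, cfg, toTransducer, instr, tapeOf_prefix_length, update_tapeOf_middle,
        moveInput, Move.toInt]
    · simp only [cfg, List.length_cons] at hs ⊢; omega
    · have := ih (F.scan q c).1 (pre ++ [(F.scan q c).2])
        (by simp only [List.length_append, List.length_cons, List.length_nil] at hs ⊢; omega)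
      convert this using 2
      all_goals simp [pass]
      ring

/-- The starting cell is written `k - 1` so that `k = 0` is the blank cell `-1` where the rewinding
stops. -/
theorem rewind (w : List α) (s h : ℕ) (o : List β) (q : F.Q) (cs : List Col) (k : ℕ)
    (hk : k ≤ cs.length) (hs : cs.length ≤ s) :
    Relation.ReflTransGen (F.toTransducer.BoundedStep w s)
      (F.cfg (.inr (.inl q)) h (k - 1) cs o) (F.cfg (.inr (.inl q)) h (-1) cs o) := by
  induction k with
  | zero => simpa using Relation.ReflTransGen.refl
  | succ k ih =>
    refine Relation.ReflTransGen.head ⟨?_, fun _ => ?_⟩ (ih (by omega))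
    · have : tapeOf cs (k : ℤ) = some cs[k] := by simp [tapeOf_natCast]
      simp [Transducer.step, cfg, toTransducer, instr, this, moveInput, Move.toInt, sub_eq_add_neg]
      rw [← this, Function.update_eq_self]
    · simp only [cfg]; omega

/-- The head is on cell `-1` here, which is why space at least `1` is needed even without columns.
-/
theorem turn (w : List α) (s h : ℕ) (o : List β) (q : F.Q) (cs : List Col) (hs : 1 ≤ s) :
    F.toTransducer.BoundedStep w s (F.cfg (.inr (.inl q)) h (-1) cs o)
      (F.cfg ((F.next q (inputTape w h)).1.elim (.inr (.inr ())) .inl)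
        (moveInput w.length h (F.next q (inputTape w h)).2.1) 0 cs
        (o ++ (F.next q (inputTape w h)).2.2)) := by
  have : tapeOf cs (-1) = none := tapeOf_of_neg _ (by norm_num)
  refine ⟨?_, fun _ => by simpa [cfg] using hs⟩
  simp [Transducer.step, cfg, toTransducer, instr, this, Move.toInt]
  rw [← this, Function.update_eq_self]

theorem round (w : List α) (s h : ℕ) (o : List β) (q : F.Q) (cs : List Col)
    (hs : 1 ≤ s) (hl : (F.pass q cs).2.length ≤ s) :
    Relation.ReflTransGen (F.toTransducer.BoundedStep w s) (F.cfg (.inl q) h 0 cs o)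
      (F.cfg ((F.next (F.pass q cs).1 (inputTape w h)).1.elim (.inr (.inr ())) .inl)
        (moveInput w.length h (F.next (F.pass q cs).1 (inputTape w h)).2.1) 0 (F.pass q cs).2
        (o ++ (F.next (F.pass q cs).1 (inputTape w h)).2.2)) := by
  have hle := F.length_le_pass q cs
  have h1 := F.sweep w s h o q cs [] (by simpa using hle.trans hl)
  have h2 := F.rewind w s h o (F.pass q cs).1 (F.pass q cs).2 cs.length hle hl
  simp only [List.nil_append, List.length_nil, zero_add, Nat.cast_zero] at h1
  exact (h1.trans h2).tail (F.turn w s h o _ _ hs)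

variable {F} in
theorem Runs.transducer {w : List α} {q h cs h' cs' o} (r : F.Runs w q h cs h' cs' o) (o₀ : List β)
    {s : ℕ} (hs : 1 ≤ s) (hl : cs'.length ≤ s) :
    Relation.ReflTransGen (F.toTransducer.BoundedStep w s) (F.cfg (.inl q) h 0 cs o₀)
      (F.cfg (.inr (.inr ())) h' 0 cs' (o₀ ++ o)) := by
  induction r generalizing o₀ with
  | @exit q h cs m o e =>
    have := F.round w s h o₀ q cs hs hl
    rwa [e] at this
  | @step q h cs q' m o h' cs' o' e r ih =>
    have := F.round w s h o₀ q cs hs (r.length_le.trans hl)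
    rw [e] at this
    simpa using this.trans (ih (o₀ ++ o) hl)

theorem logSpaceComputable {f : List α → List β} (C : ℕ)
    (hf : ∀ w, ∃ h' cs', cs'.length ≤ C * (Nat.log 2 w.length + 1) ∧
      F.Runs w F.start 0 [] h' cs' (f w)) : LogSpaceComputable f := by
  refine ⟨F.toTransducer, C + 1, fun w => ?_⟩
  obtain ⟨h', cs', hl, r⟩ := hf w
  have hs : 1 ≤ (C + 1) * (Nat.log 2 w.length + 1) := Nat.mul_pos (by omega) (by omega)
  have hp := r.transducer [] hs (hl.trans (Nat.mul_le_mul_right _ (by omega)))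
  have hi : F.cfg (.inl F.start) 0 0 [] [] = F.toTransducer.init := by
    have : tapeOf ([] : List Col) = fun _ => none := by funext z; simp [tapeOf]
    simp [cfg, Transducer.init, toTransducer, this]
  rw [hi] at hp
  have hd : F.toTransducer.step w (F.cfg (.inr (.inr ())) h' 0 cs' ([] ++ f w)) = none := by
    simp [Transducer.step, cfg, toTransducer, instr]
  exact ⟨fun c hc => Transducer.head_le_of_halting _ hp hd (by simp [cfg]) hc,
    _, Transducer.BoundedStep.reaches hp, hd, by simp [cfg]⟩

end Flow

open Transducer (inputTape moveInput)

instance {α : Type} [Finite α] : Finite (InputCell α) :=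
  Finite.of_injective
    (fun x : InputCell α => match x with
      | .leftEnd => (none : Option (Option α))
      | .sym a => some (some a)
      | .rightEnd => some none)
    (by rintro (_ | _ | _) (_ | _ | _) h <;> simp_all)

/-! ### Combining sweeping machines -/

namespace Flow

variable {α β Col : Type}

/-- Components sit inside composed machines through such embeddings of control states, so their
sweeps need not be analysed again. -/
theorem pass_comm {F G : Flow α β Col} (i : F.Q → G.Q)
    (hs : ∀ q c, G.scan (i q) c = (i (F.scan q c).1, (F.scan q c).2))
    (ha : ∀ q, G.append (i q) = F.append q) (q : F.Q) (cs : List Col) :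
    G.pass (i q) cs = (i (F.pass q cs).1, (F.pass q cs).2) := by
  induction cs generalizing q with
  | nil => simp [pass, ha]
  | cons c cs ih => simp [pass, hs, ih]

theorem pass_eq_self {F : Flow α β Col} (q : F.Q) (hs : ∀ c, F.scan q c = (q, c))
    (ha : F.append q = none) (cs : List Col) : F.pass q cs = (q, cs) := by
  induction cs with
  | nil => simp [pass, ha]
  | cons c cs ih => simp [pass, hs, ih]

/-- This is the shape of every test below: a finite automaton that reads the columns and leaves them
unchanged. -/
theorem pass_foldl {F : Flow α β Col} {S : Type} (i : S → F.Q) (δ : S → Col → S)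
    (hs : ∀ s c, F.scan (i s) c = (i (δ s c), c)) (ha : ∀ s, F.append (i s) = none) (s : S)
    (cs : List Col) : F.pass (i s) cs = (i (cs.foldl δ s), cs) := by
  induction cs generalizing s with
  | nil => simp [pass, ha]
  | cons c cs ih => simp [pass, hs, ih]

/-- A run of `F` inside `G`, where exits of `F` lead to the state `q₀`. -/
theorem Runs.then {F G : Flow α β Col} {w : List α} (i : F.Q → G.Q) (q₀ : G.Q)
    (hs : ∀ q c, G.scan (i q) c = (i (F.scan q c).1, (F.scan q c).2))
    (ha : ∀ q, G.append (i q) = F.append q)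
    (hn : ∀ q x, G.next (i q) x = (some ((F.next q x).1.elim q₀ i), (F.next q x).2))
    {q h cs h' cs' o h'' cs'' o'} (r : F.Runs w q h cs h' cs' o)
    (r' : G.Runs w q₀ h' cs' h'' cs'' o') : G.Runs w (i q) h cs h'' cs'' (o ++ o') := by
  induction r with
  | @exit q h cs m o e =>
    refine .step (q' := q₀) (m := m) ?_ ?_
    · rw [pass_comm i hs ha]; simp only [hn, e]; rfl
    · rwa [pass_comm i hs ha]
  | @step q h cs q' m o h' cs' o' e r ih =>
    rw [List.append_assoc]
    refine .step (q' := i q') (m := m) ?_ ?_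
    · rw [pass_comm i hs ha]; simp only [hn, e]; rfl
    · rw [pass_comm i hs ha]; exact ih r'

/-- A run of `F` inside `G`, where exits of `F` are exits of `G`. -/
theorem Runs.inside {F G : Flow α β Col} {w : List α} (i : F.Q → G.Q)
    (hs : ∀ q c, G.scan (i q) c = (i (F.scan q c).1, (F.scan q c).2))
    (ha : ∀ q, G.append (i q) = F.append q)
    (hn : ∀ q x, G.next (i q) x = ((F.next q x).1.map i, (F.next q x).2))
    {q h cs h' cs' o} (r : F.Runs w q h cs h' cs' o) : G.Runs w (i q) h cs h' cs' o := by
  induction r with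
  | @exit q h cs m o e =>
    have := pass_comm i hs ha q cs
    rw [show (F.pass q cs).2 = (G.pass (i q) cs).2 by rw [this]]
    refine .exit ?_
    rw [this]; simp only [hn, e]; rfl
  | @step q h cs q' m o h' cs' o' e r ih =>
    refine .step (q' := i q') (m := m) ?_ ?_
    · rw [pass_comm i hs ha]; simp only [hn, e]; rfl
    · rw [pass_comm i hs ha]; exact ih

/-- First `F`, then `G`. -/
def seq (F G : Flow α β Col) : Flow α β Col where
  Q := F.Q ⊕ G.Q
  finite_Q := by have := F.finite_Q; have := G.finite_Q; infer_instance
  start := .inl F.start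
  scan
    | .inl q, c => (.inl (F.scan q c).1, (F.scan q c).2)
    | .inr q, c => (.inr (G.scan q c).1, (G.scan q c).2)
  append
    | .inl q => F.append q
    | .inr q => G.append q
  next
    | .inl q, x => (some ((F.next q x).1.elim (.inr G.start) .inl), (F.next q x).2)
    | .inr q, x => ((G.next q x).1.map .inr, (G.next q x).2)

theorem Runs.seq {F G : Flow α β Col} {w : List α} {h cs h' cs' o h'' cs'' o'}
    (r : F.Runs w F.start h cs h' cs' o) (r' : G.Runs w G.start h' cs' h'' cs'' o') :
    (F.seq G).Runs w (F.seq G).start h cs h'' cs'' (o ++ o') :=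
  Runs.then (G := F.seq G) Sum.inl (Sum.inr G.start) (fun _ _ => rfl) (fun _ => rfl)
    (fun _ _ => rfl) r
    (Runs.inside (G := F.seq G) Sum.inr (fun _ _ => rfl) (fun _ => rfl) (fun _ _ => rfl) r')

/-- Emits a word and moves the input head. -/
def emit (l : List β) (m : Move) : Flow α β Col where
  Q := Unit
  finite_Q := inferInstance
  start := ()
  scan _ c := ((), c)
  append _ := none
  next _ _ := (none, m, l)

theorem runs_emit (l : List β) (m : Move) (w : List α) (h : ℕ) (cs : List Col) :
    (emit l m : Flow α β Col).Runs w () h cs (moveInput w.length h m) cs l := by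
  have e : (emit l m : Flow α β Col).pass () cs = ((), cs) :=
    pass_eq_self _ (fun _ => rfl) rfl cs
  have := Runs.exit (F := (emit l m : Flow α β Col)) (w := w) (q := ()) (h := h) (cs := cs)
    (m := m) (o := l) rfl
  rwa [e] at this

/-- Moves the input head to the left end. -/
def rewindInput : Flow α β Col where
  Q := Unit
  finite_Q := inferInstance
  start := ()
  scan _ c := ((), c)
  append _ := none
  next
    | _, .leftEnd => (none, .stay, [])
    | _, _ => (some (), .left, [])

theorem runs_rewindInput (w : List α) (h : ℕ) (cs : List Col) :
    (rewindInput : Flow α β Col).Runs w () h cs 0 cs [] := by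
  have e : (rewindInput : Flow α β Col).pass () cs = ((), cs) :=
    pass_eq_self _ (fun _ => rfl) rfl cs
  induction h with
  | zero =>
    have := Runs.exit (F := (rewindInput : Flow α β Col)) (w := w) (q := ()) (h := 0) (cs := cs)
      (m := .stay) (o := []) rfl
    rwa [e] at this
  | succ h ih =>
    refine Runs.step (q' := ()) (m := .left) (o := []) (o' := []) ?_ (by rw [e]; exact ih)
    rw [e]
    cases hx : w[h]? <;> simp [rewindInput, inputTape, hx]

/-- Reads all columns with a finite automaton and continues according to the outcome. -/
def cases {S J : Type} [Finite S] [Finite J] (s₀ : S) (δ : S → Col → S)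
    (out : S → InputCell α → J) (F : J → Flow α β Col) : Flow α β Col where
  Q := S ⊕ Σ j, (F j).Q
  finite_Q := by have := fun j => (F j).finite_Q; infer_instance
  start := .inl s₀
  scan
    | .inl s, c => (.inl (δ s c), c)
    | .inr ⟨j, q⟩, c => (.inr ⟨j, ((F j).scan q c).1⟩, ((F j).scan q c).2)
  append
    | .inl _ => none
    | .inr ⟨j, q⟩ => (F j).append q
  next
    | .inl s, x => (some (.inr ⟨out s x, (F (out s x)).start⟩), .stay, [])
    | .inr ⟨j, q⟩, x => (((F j).next q x).1.map fun q => .inr ⟨j, q⟩, ((F j).next q x).2)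

theorem Runs.cases {S J : Type} [Finite S] [Finite J] {s₀ : S} {δ : S → Col → S}
    {out : S → InputCell α → J} {F : J → Flow α β Col} {w : List α} {h cs h' cs' o} {j : J}
    (hj : out (cs.foldl δ s₀) (inputTape w h) = j)
    (r : (F j).Runs w (F j).start h cs h' cs' o) :
    (Flow.cases s₀ δ out F).Runs w (Flow.cases s₀ δ out F).start h cs h' cs' o := by
  have e : (Flow.cases s₀ δ out F).pass (Sum.inl s₀) cs = (Sum.inl (cs.foldl δ s₀), cs) :=
    pass_foldl (F := Flow.cases s₀ δ out F) Sum.inl δ (fun _ _ => rfl) (fun _ => rfl) s₀ cs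
  refine Runs.step (F := Flow.cases s₀ δ out F) (q := Sum.inl s₀)
    (q' := Sum.inr ⟨j, (F j).start⟩) (m := .stay) (o := []) (o' := o) ?_ ?_
  · rw [e]; subst hj; rfl
  · rw [e]
    exact Runs.inside (G := Flow.cases s₀ δ out F) (fun q => Sum.inr ⟨j, q⟩) (fun _ _ => rfl)
      (fun _ => rfl) (fun _ _ => rfl) r

end Flow

/-! ### Tracks of columns as counters -/

/-- The columns of `L` digits in base `b` of the numbers in `σ`, least significant digit first. -/
def columns {K : ℕ} (b : ℕ) [NeZero b] : ℕ → (Fin K → ℕ) → List (Fin K → Fin b)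
  | 0, _ => []
  | L + 1, σ => (fun v => Fin.ofNat b (σ v)) :: columns b L (fun v => σ v / b)

section columns

variable {K b : ℕ} [NeZero b]

/-- The carry out of the last digit passes to the quotient. This is the inductive step both for
incrementing a counter and for recognizing a successor. -/
theorem div_add_carry (x : ℕ) (s : Bool) :
    (x + s.toNat) / b = x / b + (decide (b ≤ x % b + s.toNat)).toNat := by
  have hb : 0 < b := Nat.pos_of_ne_zero (NeZero.ne b)
  have hs : s.toNat ≤ 1 := Bool.toNat_le s
  have h1 := Nat.div_add_mod x b
  have h2 := Nat.mod_lt x hb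
  by_cases h : b ≤ x % b + s.toNat
  · simp only [h, decide_true, Bool.toNat_true]
    have : x + s.toNat = b * (x / b + 1) := by rw [mul_add]; omega
    rw [this, Nat.mul_div_cancel_left _ hb]
  · simp only [h, decide_false, Bool.toNat_false, add_zero]
    have : x + s.toNat = x % b + s.toNat + b * (x / b) := by omega
    rw [this, Nat.add_mul_div_left _ _ hb, Nat.div_eq_of_lt (by omega), zero_add]

theorem div_lt_pow {x L : ℕ} (h : x < b ^ (L + 1)) : x / b < b ^ L := by
  rw [Nat.div_lt_iff_lt_mul (Nat.pos_of_ne_zero (NeZero.ne b))]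
  rwa [pow_succ] at h

theorem length_columns (L : ℕ) (σ : Fin K → ℕ) : (columns b L σ).length = L := by
  induction L generalizing σ with
  | zero => rfl
  | succ L ih => simp [columns, ih]

/-- `L` digits show a number only modulo `b ^ L`; an overflowed counter therefore reads as zero. -/
theorem columns_congr {L : ℕ} {σ τ : Fin K → ℕ} (h : ∀ v, σ v % b ^ L = τ v % b ^ L) :
    columns b L σ = columns b L τ := by
  induction L generalizing σ τ with
  | zero => rfl
  | succ L ih =>
    simp only [columns, List.cons.injEq]
    constructor
    · funext v
      ext
      have := congrArg (· % b) (h v)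
      simpa [pow_succ, Nat.mod_mul_left_mod] using this
    · refine ih fun v => ?_
      have := congrArg (· / b) (h v)
      simpa [pow_succ', Nat.mod_mul_right_div_self] using this

end columns

namespace Flow

variable {α β : Type} {K b : ℕ} [NeZero b]

/-- Repeats `F` while counting on track `m`, until the counter overflows. -/
def loop (F : Flow α β (Fin K → Fin b)) (m : Fin K) (mv : Move) : Flow α β (Fin K → Fin b) where
  Q := F.Q ⊕ Bool
  finite_Q := by have := F.finite_Q; infer_instance
  start := .inl F.start
  scan
    | .inl q, c => (.inl (F.scan q c).1, (F.scan q c).2)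
    | .inr s, c => (.inr (decide (b ≤ c m + s.toNat)),
        Function.update c m (Fin.ofNat b (c m + s.toNat)))
  append
    | .inl q => F.append q
    | .inr _ => none
  next
    | .inl q, x => (some ((F.next q x).1.elim (.inr true) .inl), (F.next q x).2)
    | .inr s, _ => if s then (none, .stay, []) else (some (.inl F.start), mv, [])

/-- The Boolean state is the carry of ordinary digitwise addition, and the carry out of the top
digit signals overflow. -/
theorem pass_loop (F : Flow α β (Fin K → Fin b)) (m : Fin K) (mv : Move) (L : ℕ) (σ : Fin K → ℕ)
    (s : Bool) (hσ : σ m < b ^ L) :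
    (F.loop m mv).pass (Sum.inr s) (columns b L σ) =
      (Sum.inr (decide (b ^ L ≤ σ m + s.toNat)),
        columns b L (Function.update σ m (σ m + s.toNat))) := by
  induction L generalizing σ s with
  | zero =>
    have h0 : σ m = 0 := by simpa using hσ
    cases s <;> simp [columns, pass, loop, h0]
  | succ L ih =>
    have hb : 0 < b := Nat.pos_of_ne_zero (NeZero.ne b)
    have hcarry := div_add_carry (b := b) (σ m) s
    have := ih (fun v => σ v / b) (decide (b ≤ σ m % b + s.toNat)) (div_lt_pow hσ)
    simp only [columns, pass]
    have hscan : (F.loop m mv).scan (Sum.inr s) (fun v => Fin.ofNat b (σ v)) =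
        (Sum.inr (decide (b ≤ σ m % b + s.toNat)),
          fun v => Fin.ofNat b (Function.update σ m (σ m + s.toNat) v)) := by
      simp only [loop, Fin.val_ofNat, Prod.mk.injEq, true_and]
      funext v
      by_cases hv : v = m
      · subst hv; ext; simp [Nat.add_mod]
      · simp [Function.update_of_ne hv]
    rw [hscan]
    simp only [this]
    refine Prod.ext ?_ ?_
    · refine congrArg Sum.inr ?_
      simp only [← hcarry, decide_eq_decide]
      rw [Nat.le_div_iff_mul_le hb, pow_succ]
    · simp only [← hcarry, List.cons.injEq, true_and]
      congr 1
      funext v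
      by_cases hv : v = m
      · subst hv; simp
      · simp [Function.update_of_ne hv]

/-- Induction on the number `k` of iterations after the `i`-th. As `H i` is the input position
during iteration `i`, this covers loops with a resting and with an advancing input head. -/
theorem runs_loop {F : Flow α β (Fin K → Fin b)} {m : Fin K} {mv : Move} {w : List α} {L : ℕ}
    {σ : Fin K → ℕ} (hm : σ m = 0) {H : ℕ → ℕ} (hH : ∀ i, moveInput w.length (H i) mv = H (i + 1))
    {f : ℕ → List β}
    (hF : ∀ i, i < b ^ L → F.Runs w F.start (H i) (columns b L (Function.update σ m i)) (H i)
      (columns b L (Function.update σ m i)) (f i)) (k i : ℕ) (hk : i + k + 1 = b ^ L) :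
    (F.loop m mv).Runs w (F.loop m mv).start (H i) (columns b L (Function.update σ m i))
      (H (i + k)) (columns b L σ) ((List.range' i (k + 1)).flatMap f) := by
  have hpass := F.pass_loop m mv L (Function.update σ m i) true (by simp; omega)
  simp only [Function.update_self, Bool.toNat_true, Function.update_idem] at hpass
  induction k generalizing i with
  | zero =>
    simp only [zero_add, List.range'_one, List.flatMap_cons, List.flatMap_nil, add_zero]
    refine Runs.then (G := F.loop m mv) Sum.inl (Sum.inr true) (fun _ _ => rfl) (fun _ => rfl)
      (fun _ _ => rfl) (hF i (by omega)) ?_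
    rw [show b ^ L = i + 1 by omega] at hpass
    simp only [le_refl, decide_true] at hpass
    -- The counter has reached `b ^ L`, whose `L` digits are those of `0`.
    have hc : columns b L σ = columns b L (Function.update σ m (i + 1)) := by
      refine columns_congr fun v => ?_
      by_cases hv : v = m
      · subst hv; simp [hm, show i + 1 = b ^ L by omega]
      · simp [Function.update_of_ne hv]
    rw [hc]
    have := Runs.exit (F := F.loop m mv) (w := w) (q := Sum.inr true) (h := H i)
      (cs := columns b L (Function.update σ m i)) (m := .stay) (o := []) (by rw [hpass]; rfl)
    rwa [hpass] at this
  | succ k ih =>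
    rw [List.range'_succ, List.flatMap_cons]
    refine Runs.then (G := F.loop m mv) Sum.inl (Sum.inr true) (fun _ _ => rfl) (fun _ => rfl)
      (fun _ _ => rfl) (hF i (by omega)) ?_
    have hpass' := F.pass_loop m mv L (Function.update σ m (i + 1)) true (by simp; omega)
    simp only [Function.update_self, Bool.toNat_true, Function.update_idem] at hpass'
    have := ih (i + 1) (by omega) hpass'
    rw [show i + 1 + k = i + (k + 1) by omega] at this
    refine Runs.step (q' := Sum.inl F.start) (m := mv) (o := []) ?_ ?_
    · rw [hpass, decide_eq_false (by omega)]; rfl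
    · rw [hpass, hH]; exact this

end Flow

/-! ### Output produced by fragments with counters -/

/-- Output that depends on the input, the number of columns, the position of the input head and
the values of the counters. -/
abbrev Emission (α β : Type) (K : ℕ) : Type := List α → ℕ → ℕ → (Fin K → ℕ) → List β

/-- `f` is produced by a machine that leaves the counters and the input head as they were, provided
that the counters from `m` on are zero and the position of the input head satisfies `P`. -/
def Emits {α β : Type} {K : ℕ} (b : ℕ) [NeZero b] (m : ℕ) (P : ℕ → Prop) (f : Emission α β K) :
    Prop :=
  ∃ F : Flow α β (Fin K → Fin b), ∀ w L h σ, P h → (∀ v, σ v < b ^ L) →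
    (∀ v : Fin K, m ≤ v → σ v = 0) →
    F.Runs w F.start h (columns b L σ) h (columns b L σ) (f w L h σ)

namespace Emits

variable {α β : Type} {K b : ℕ} [NeZero b] {m : ℕ} {P : ℕ → Prop} {f g : Emission α β K}

theorem congr (hf : Emits b m P f)
    (h : ∀ w L h σ, P h → (∀ v, σ v < b ^ L) → (∀ v : Fin K, m ≤ v → σ v = 0) →
      g w L h σ = f w L h σ) : Emits b m P g := by
  obtain ⟨F, hF⟩ := hf
  refine ⟨F, fun w L k σ h1 h2 h3 => ?_⟩
  rw [h w L k σ h1 h2 h3]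
  exact hF w L k σ h1 h2 h3

theorem const (l : List β) : Emits b m P (fun _ _ _ _ => l : Emission α β K) :=
  ⟨Flow.emit l .stay, fun w _ h _ _ _ _ => Flow.runs_emit l .stay w h _⟩

theorem append (hf : Emits b m P f) (hg : Emits b m P g) :
    Emits b m P fun w L h σ => f w L h σ ++ g w L h σ := by
  obtain ⟨F, hF⟩ := hf
  obtain ⟨G, hG⟩ := hg
  exact ⟨F.seq G, fun w L h σ h1 h2 h3 => (hF w L h σ h1 h2 h3).seq (hG w L h σ h1 h2 h3)⟩

theorem flatMap {ι : Type*} (l : List ι) {f : ι → Emission α β K} (hf : ∀ i, Emits b m P (f i)) :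
    Emits b m P fun w L h σ => l.flatMap fun i => f i w L h σ := by
  induction l with
  | nil => exact const []
  | cons i l ih => exact (hf i).append ih

theorem cases {S J : Type} [Finite S] [Finite J] (s₀ : S) (δ : S → (Fin K → Fin b) → S)
    (out : S → InputCell α → J) {p : List α → ℕ → ℕ → (Fin K → ℕ) → J}
    (hp : ∀ w L h σ, (∀ v, σ v < b ^ L) →
      out ((columns b L σ).foldl δ s₀) (inputTape w h) = p w L h σ)
    {f : J → Emission α β K} (hf : ∀ j, Emits b m P (f j)) :
    Emits b m P fun w L h σ => f (p w L h σ) w L h σ := by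
  choose F hF using hf
  exact ⟨Flow.cases s₀ δ out F, fun w L h σ h1 h2 h3 =>
    Flow.Runs.cases (hp w L h σ h2) (hF _ w L h σ h1 h2 h3)⟩

theorem input [Finite α] {f : InputCell α → Emission α β K} (hf : ∀ x, Emits b m P (f x)) :
    Emits b m P fun w L h σ => f (inputTape w h) w L h σ :=
  cases () (fun _ _ => ()) (fun _ x => x) (fun _ _ _ _ _ => rfl) hf

/-- Counter `m` starts at zero, takes every value and overflows back to zero, so it is free again
afterwards. The body may use the counters from `m + 1` on for inner loops. -/
theorem range (hm : m < K) (hf : Emits b (m + 1) P f) :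
    Emits b m P fun w L h σ =>
      (List.range (b ^ L)).flatMap fun i => f w L h (Function.update σ ⟨m, hm⟩ i) := by
  obtain ⟨F, hF⟩ := hf
  refine ⟨F.loop ⟨m, hm⟩ .stay, fun w L h σ h1 h2 h3 => ?_⟩
  have hB : 0 < b ^ L := Nat.pow_pos (Nat.pos_of_ne_zero (NeZero.ne b))
  have h0 : Function.update σ ⟨m, hm⟩ 0 = σ := by
    rw [← h3 ⟨m, hm⟩ le_rfl, Function.update_eq_self]
  have := Flow.runs_loop (F := F) (m := ⟨m, hm⟩) (mv := .stay) (w := w) (L := L) (σ := σ)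
    (h3 ⟨m, hm⟩ le_rfl) (H := fun _ => h) (fun _ => rfl)
    (f := fun i => f w L h (Function.update σ ⟨m, hm⟩ i))
    (fun i hi => hF w L h _ h1 (fun v => ?_) fun v hv => ?_) (b ^ L - 1) 0 (by omega)
  · rwa [h0, Nat.sub_add_cancel hB,
      ← List.range_eq_range'] at this
  · by_cases hv : v = ⟨m, hm⟩
    · subst hv; simpa
    · rw [Function.update_of_ne hv]; exact h2 v
  · have : v ≠ ⟨m, hm⟩ := by rintro rfl; simp at hv
    rw [Function.update_of_ne this]
    exact h3 v (by omega)

/-- A loop during which the input head moves along. -/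
theorem rangeInput (hm : m < K) (hf : Emits b (m + 1) (fun _ => True) f) :
    Emits b m (fun h => h = 0) fun w L _ σ => (List.range (b ^ L)).flatMap fun i =>
      f w L (min (i + 1) (w.length + 1)) (Function.update σ ⟨m, hm⟩ i) := by
  obtain ⟨F, hF⟩ := hf
  -- The first move leaves the left end marker, so iteration `i` sees input cell `i + 1`; beyond the
  -- input the head rests on the right end marker.
  refine ⟨((Flow.emit [] .right).seq (F.loop ⟨m, hm⟩ .right)).seq Flow.rewindInput,
    fun w L h σ h1 h2 h3 => ?_⟩
  subst h1
  have hB : 0 < b ^ L := Nat.pow_pos (Nat.pos_of_ne_zero (NeZero.ne b))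
  have h0 : Function.update σ ⟨m, hm⟩ 0 = σ := by
    rw [← h3 ⟨m, hm⟩ le_rfl, Function.update_eq_self]
  have := Flow.runs_loop (F := F) (m := ⟨m, hm⟩) (mv := .right) (w := w) (L := L) (σ := σ)
    (h3 ⟨m, hm⟩ le_rfl) (H := fun i => min (i + 1) (w.length + 1))
    (fun i => by simp only [moveInput]; omega)
    (f := fun i => f w L (min (i + 1) (w.length + 1)) (Function.update σ ⟨m, hm⟩ i))
    (fun i hi => hF w L _ _ trivial (fun v => ?_) fun v hv => ?_) (b ^ L - 1) 0 (by omega)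
  · rw [h0, Nat.sub_add_cancel hB,
      ← List.range_eq_range'] at this
    have r := ((Flow.runs_emit [] .right w 0 (columns b L σ)).seq this).seq
      (Flow.runs_rewindInput w _ _)
    simpa only [List.nil_append, List.append_nil] using r
  · by_cases hv : v = ⟨m, hm⟩
    · subst hv; simpa
    · rw [Function.update_of_ne hv]; exact h2 v
  · have : v ≠ ⟨m, hm⟩ := by rintro rfl; simp at hv
    rw [Function.update_of_ne this]
    exact h3 v (by omega)

end Emits

/-! ### Laying out the columns -/

namespace Flow

variable {α β : Type} {K b : ℕ} [NeZero b]

/-- The column all of whose digits are `d`. -/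
def digit (K b : ℕ) [NeZero b] (d : ℕ) : Fin K → Fin b := fun _ => Fin.ofNat b d

/-- Counts the input symbols in binary and then clears the columns that were used. -/
def layout (α β : Type) (K b : ℕ) [NeZero b] : Flow α β (Fin K → Fin b) where
  Q := Bool ⊕ Fin 3
  finite_Q := inferInstance
  start := .inr 0
  scan
    | .inl true, c => if c = digit K b 0 then (.inl false, digit K b 1) else (.inl true, digit K b 0)
    | .inl false, c => (.inl false, c)
    | .inr 2, _ => (.inr 2, digit K b 0)
    | .inr q, c => (.inr q, c)
  append
    | .inl true => some (digit K b 1)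
    | .inr 0 => some (digit K b 0)
    | _ => none
  next
    | .inl _, _ => (some (.inr 1), .right, [])
    | .inr 0, _ => (some (.inr 1), .right, [])
    | .inr 1, .sym _ => (some (.inl true), .stay, [])
    | .inr 1, _ => (some (.inr 2), .stay, [])
    | .inr 2, .leftEnd => (none, .stay, [])
    | .inr 2, _ => (some (.inr 2), .left, [])

/-- The number written in binary in the columns. -/
def binary : List (Fin K → Fin b) → ℕ
  | [] => 0
  | c :: cs => (if c = digit K b 0 then 0 else 1) + 2 * binary cs

theorem binary_lt (cs : List (Fin K → Fin b)) : binary cs < 2 ^ cs.length := by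
  induction cs with
  | nil => simp [binary]
  | cons c cs ih => simp only [binary, List.length_cons, pow_succ]; split_ifs <;> omega

theorem layout_pass_false (cs : List (Fin K → Fin b)) :
    (layout α β K b).pass (Sum.inl false) cs = (Sum.inl false, cs) :=
  pass_eq_self (F := layout α β K b) _ (fun _ => rfl) rfl cs

/-- A carry ripples through the binary digits. A column is added only if all digits were one, which
keeps their number logarithmic. -/
theorem layout_pass_true (h1 : digit K b 1 ≠ digit K b 0) (cs : List (Fin K → Fin b)) :
    binary ((layout α β K b).pass (Sum.inl true) cs).2 = binary cs + 1 ∧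
      ((((layout α β K b).pass (Sum.inl true) cs).2.length = cs.length) ∨
        ((layout α β K b).pass (Sum.inl true) cs).2.length = cs.length + 1 ∧
          binary cs + 1 = 2 ^ cs.length) ∧
      ∃ s, ((layout α β K b).pass (Sum.inl true) cs).1 = Sum.inl s := by
  induction cs with
  | nil => simp [pass, layout, binary, h1]
  | cons c cs ih =>
    by_cases hc : c = digit K b 0
    · have : (layout α β K b).scan (Sum.inl true) c = (Sum.inl false, digit K b 1) := by
        simp [layout, hc]
      simp only [pass, this, layout_pass_false]
      refine ⟨?_, .inl rfl, false, rfl⟩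
      simp only [binary, hc, h1]
      simp; omega
    · have : (layout α β K b).scan (Sum.inl true) c = (Sum.inl true, digit K b 0) := by
        simp [layout, hc]
      simp only [pass, this, binary, hc, List.length_cons, pow_succ]
      obtain ⟨i1, i2, i3⟩ := ih
      refine ⟨?_, ?_, i3⟩
      · rw [i1]; simp; omega
      · simp only [if_false]; omega

theorem layout_pass_clear (cs : List (Fin K → Fin b)) :
    (layout α β K b).pass (Sum.inr 2) cs = (Sum.inr 2, columns b cs.length fun _ => 0) := by
  induction cs with
  | nil => simp [pass, layout, columns]
  | cons c cs ih =>
    have : (layout α β K b).scan (Sum.inr 2) c = (Sum.inr 2, digit K b 0) := rfl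
    simp only [pass, this, ih, List.length_cons, columns, Nat.zero_div]
    rfl

theorem layout_clear (w : List α) (h : ℕ) (cs : List (Fin K → Fin b)) :
    (layout α β K b).Runs w (Sum.inr 2) h cs 0 (columns b cs.length fun _ => 0) [] := by
  induction h generalizing cs with
  | zero =>
    have := Runs.exit (F := layout α β K b) (w := w) (q := Sum.inr 2) (h := 0) (cs := cs)
      (m := .stay) (o := []) (by rw [layout_pass_clear]; rfl)
    rwa [layout_pass_clear] at this
  | succ h ih =>
    refine Runs.step (F := layout α β K b) (q' := Sum.inr 2) (m := .left) (o := []) (o' := []) ?_ ?_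
    · rw [layout_pass_clear]
      cases hx : w[h]? <;> simp [layout, inputTape, hx]
    · rw [layout_pass_clear]
      have := ih (columns b cs.length fun _ => 0)
      rwa [length_columns] at this

/-- Invariant after `t` symbols: the columns hold `t` in binary, and `2 ^ cs.length ≤ 2 * t + 2`
keeps the list from being longer than necessary. -/
theorem layout_count (h1 : digit K b 1 ≠ digit K b 0) (w : List α) (k t : ℕ)
    (hk : t + k = w.length) (cs : List (Fin K → Fin b)) (hcs : 1 ≤ cs.length)
    (ht : binary cs = t) (hb : 2 ^ cs.length ≤ 2 * t + 2) :
    ∃ L, 1 ≤ L ∧ w.length < 2 ^ L ∧ 2 ^ L ≤ 2 * w.length + 2 ∧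
      (layout α β K b).Runs w (Sum.inr 1) (t + 1) cs 0 (columns b L fun _ => 0) [] := by
  have hlook : (layout α β K b).pass (Sum.inr 1) cs = (Sum.inr 1, cs) :=
    pass_eq_self (F := layout α β K b) _ (fun _ => rfl) rfl cs
  induction k generalizing t cs with
  | zero =>
    refine ⟨cs.length, hcs, ?_, ?_, ?_⟩
    · rw [← hk, ← ht]; exact binary_lt cs
    · rw [← hk]; exact hb
    · refine Runs.step (F := layout α β K b) (q' := Sum.inr 2) (m := .stay) (o := []) (o' := [])
        ?_ ?_
      · rw [hlook]
        have : w[t]? = none := by simp; omega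
        simp [layout, inputTape, this]
      · rw [hlook]; exact layout_clear w _ cs
  | succ k ih =>
    obtain ⟨i1, i2, s, i3⟩ := layout_pass_true (α := α) (β := β) h1 cs
    have hlt := binary_lt cs
    obtain ⟨L, l1, l2, l3, l4⟩ := ih (t + 1) (by omega)
      ((layout α β K b).pass (Sum.inl true) cs).2
      (by omega) (by omega)
      (by
        rcases i2 with i2 | ⟨i2, i4⟩
        · rw [i2]; omega
        · rw [i2, pow_succ]; omega)
      (pass_eq_self (F := layout α β K b) _ (fun _ => rfl) rfl _)
    refine ⟨L, l1, l2, l3, ?_⟩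
    refine Runs.step (F := layout α β K b) (q' := Sum.inl true) (m := .stay) (o := []) (o' := [])
      ?_ (Runs.step (F := layout α β K b) (q' := Sum.inr 1) (m := .right) (o := []) (o' := []) ?_ ?_)
    · rw [hlook]
      have : w[t]? = some w[t] := by simp
      simp [layout, inputTape, this]
    · rw [hlook, i3]; rfl
    · rw [hlook]
      have : moveInput w.length (moveInput w.length (t + 1) .stay) .right = t + 1 + 1 := by
        simp only [moveInput]; omega
      rw [this]; exact l4

theorem runs_layout (h1 : digit K b 1 ≠ digit K b 0) (w : List α) :
    ∃ L, 1 ≤ L ∧ w.length < 2 ^ L ∧ 2 ^ L ≤ 2 * w.length + 2 ∧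
      (layout α β K b).Runs w (Sum.inr 0) 0 [] 0 (columns b L fun _ => 0) [] := by
  obtain ⟨L, l1, l2, l3, l4⟩ := layout_count (α := α) (β := β) h1 w w.length 0 (by omega)
    [digit K b 0] (by simp) (by simp [binary]) (by simp)
  refine ⟨L, l1, l2, l3, ?_⟩
  refine Runs.step (F := layout α β K b) (q' := Sum.inr 1) (m := .right) (o := []) (o' := [])
    rfl ?_
  have : moveInput w.length 0 .right = 0 + 1 := by simp only [moveInput]; omega
  rw [this]; exact l4

end Flow

/-- Whatever is produced from the left end of the input with all counters zero is computable in
logarithmic space, for a suitable number of columns. -/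
theorem Emits.logSpaceComputable {α β : Type} {K b : ℕ} [NeZero b] (hK : 0 < K) (hb : 2 ≤ b)
    {f : Emission α β K} (hf : Emits b 0 (fun h => h = 0) f) :
    ∃ L : List α → ℕ, (∀ w, 1 ≤ L w ∧ w.length < 2 ^ L w) ∧
      LogSpaceComputable fun w => f w (L w) 0 fun _ => 0 := by
  obtain ⟨F, hF⟩ := hf
  -- Columns can serve as binary digits because there is at least one track and the base is at least
  -- two.
  have h1 : Flow.digit K b 1 ≠ Flow.digit K b 0 := fun h => by
    have := congrArg Fin.val (congrFun h ⟨0, hK⟩)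
    simp [Flow.digit, Nat.mod_eq_of_lt (show 1 < b by omega)] at this
  choose L l1 l2 l3 l4 using Flow.runs_layout (α := α) (β := β) h1
  refine ⟨L, fun w => ⟨l1 w, l2 w⟩, ((Flow.layout α β K b).seq F).logSpaceComputable 2 fun w =>
    ⟨0, columns b (L w) fun _ => 0, ?_, ?_⟩⟩
  · rw [length_columns]
    have hn : w.length < 2 ^ (Nat.log 2 w.length + 1) := Nat.lt_pow_succ_log_self (by norm_num) _
    have : 2 ^ L w ≤ 2 ^ (Nat.log 2 w.length + 2) := by
      have := l3 w
      rw [pow_succ] at hn ⊢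
      rw [pow_succ]
      omega
    have := (Nat.pow_le_pow_iff_right (by norm_num)).1 this
    omega
  · exact Flow.Runs.seq (l4 w) (hF w (L w) 0 _ rfl
      (fun _ => Nat.pow_pos (by omega)) fun _ _ => rfl)

/-! ### Branching on comparisons of counters -/

section compare

variable {K b : ℕ} [NeZero b]

theorem foldl_columns_zero (i : Fin K) (L : ℕ) (σ : Fin K → ℕ) (s : Bool) (hi : σ i < b ^ L) :
    (columns b L σ).foldl (fun s c => s && decide (c i = 0)) s = (s && decide (σ i = 0)) := by
  induction L generalizing σ s with
  | zero =>
    have : σ i = 0 := by simpa using hi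
    simp [columns, this]
  | succ L ih =>
    have h1 := Nat.div_add_mod (σ i) b
    simp only [columns, List.foldl_cons]
    rw [ih (fun v => σ v / b) _ (div_lt_pow hi), Bool.and_assoc]
    congr 1
    rw [Bool.eq_iff_iff]
    simp only [Bool.and_eq_true, decide_eq_true_eq, Fin.ext_iff, Fin.val_ofNat, Fin.val_zero]
    constructor
    · rintro ⟨h2, h3⟩; rw [h2, h3] at h1; simpa using h1.symm
    · intro h; simp [h]

/-- Digits come least significant first, so each later differing digit overrules the verdict so far.
-/
theorem foldl_columns_lt (i j : Fin K) (L : ℕ) (σ : Fin K → ℕ) (s : Bool) (hi : σ i < b ^ L)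
    (hj : σ j < b ^ L) :
    (columns b L σ).foldl (fun s c => if c i = c j then s else decide (c i < c j)) s =
      if σ i = σ j then s else decide (σ i < σ j) := by
  induction L generalizing σ s with
  | zero =>
    have h1 : σ i = 0 := by simpa using hi
    have h2 : σ j = 0 := by simpa using hj
    simp [columns, h1, h2]
  | succ L ih =>
    have hb : 0 < b := Nat.pos_of_ne_zero (NeZero.ne b)
    have h1 := Nat.div_add_mod (σ i) b
    have h2 := Nat.div_add_mod (σ j) b
    have h3 := Nat.mod_lt (σ i) hb
    have h4 := Nat.mod_lt (σ j) hb
    simp only [columns, List.foldl_cons]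
    rw [ih (fun v => σ v / b) _ (div_lt_pow hi) (div_lt_pow hj)]
    simp only [Fin.ext_iff, Fin.lt_def, Fin.val_ofNat]
    rcases lt_trichotomy (σ i / b) (σ j / b) with h | h | h
    · have : b * (σ i / b) + b ≤ b * (σ j / b) := by
        rw [← Nat.mul_succ]; exact Nat.mul_le_mul_left _ h
      have h5 : σ i < σ j := by omega
      simp [h, h.ne, h5, h5.ne]
    · rw [h] at h1
      by_cases h5 : σ i % b = σ j % b
      · have : σ i = σ j := by omega
        simp [this]
      · have h6 : σ i ≠ σ j := by omega
        have h7 : σ i % b < σ j % b ↔ σ i < σ j := by omega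
        simp [h, h5, h6, h7]
    · have : b * (σ j / b) + b ≤ b * (σ i / b) := by
        rw [← Nat.mul_succ]; exact Nat.mul_le_mul_left _ h
      have h5 : σ j < σ i := by omega
      simp only [h.ne', h5.ne', if_false, decide_eq_decide]
      omega

/-- The automaton carries along the carry of `σ i + s` and whether the digits of `σ j` have agreed
with the sum so far. The final carry is dropped, hence the modulus. -/
theorem foldl_columns_succ (i j : Fin K) (L : ℕ) (σ : Fin K → ℕ) (s t : Bool)
    (hi : σ i < b ^ L) (hj : σ j < b ^ L) :
    ((columns b L σ).foldl (fun s c => (decide (b ≤ (c i : ℕ) + s.1.toNat),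
        s.2 && decide (c j = Fin.ofNat b (c i + s.1.toNat)))) (s, t)).2 =
      (t && decide (σ j = (σ i + s.toNat) % b ^ L)) := by
  induction L generalizing σ s t with
  | zero =>
    have h1 : σ i = 0 := by simpa using hi
    have h2 : σ j = 0 := by simpa using hj
    simp [columns, h1, h2, Nat.mod_one]
  | succ L ih =>
    have hb : 0 < b := Nat.pos_of_ne_zero (NeZero.ne b)
    simp only [columns, List.foldl_cons]
    rw [ih (fun v => σ v / b) _ _ (div_lt_pow hi) (div_lt_pow hj), Bool.and_assoc]
    congr 1
    simp only [Fin.val_ofNat, ← div_add_carry]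
    rw [Bool.eq_iff_iff]
    simp only [Bool.and_eq_true, decide_eq_true_eq, Fin.ext_iff, Fin.val_ofNat, Nat.mod_add_mod,
      pow_succ']
    rw [Nat.mod_mul]
    have h1 := Nat.div_add_mod (σ j) b
    have h2 := Nat.mod_lt (σ i + s.toNat) hb
    constructor
    · rintro ⟨h3, h4⟩; rw [← h3, ← h4]; omega
    · intro h; rw [h]; constructor
      · simp
      · rw [Nat.add_mul_div_left _ _ hb, Nat.div_eq_of_lt h2, zero_add]

end compare

namespace Emits

variable {α β : Type} {K b : ℕ} [NeZero b] {m : ℕ} {P : ℕ → Prop} {f g : Emission α β K}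

theorem zero (i : Fin K) {f : Prop → Emission α β K} (hf : ∀ p, Emits b m P (f p)) :
    Emits b m P fun w L h σ => f (σ i = 0) w L h σ := by
  refine (cases true (fun s c => s && decide (c i = 0)) (fun s _ => s)
    (p := fun _ _ _ σ => decide (σ i = 0)) (fun w L h σ hσ => ?_)
    (f := fun j => f (j = true)) fun j => hf _).congr fun w L h σ _ _ _ => ?_
  · rw [foldl_columns_zero _ _ _ _ (hσ i), Bool.true_and]
  · simp

theorem lt (i j : Fin K) (hf : Emits b m P f) :
    Emits b m P fun w L h σ => if σ i < σ j then f w L h σ else [] := by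
  refine (cases false (fun s c => if c i = c j then s else decide (c i < c j)) (fun s _ => s)
    (p := fun _ _ _ σ => decide (σ i < σ j)) (fun w L h σ hσ => ?_)
    (f := fun c w L h σ => if c then f w L h σ else []) fun c => ?_).congr fun w L h σ _ _ _ => ?_
  · rw [foldl_columns_lt _ _ _ _ _ (hσ i) (hσ j)]
    split_ifs with h <;> simp [h]
  · cases c
    · exact const []
    · exact hf
  · simp

/-- A word emitted as often as a counter says. -/
theorem repeat_counter (hm : m < K) (i : Fin K) (hi : i < m) (l : List β) :
    Emits b m P (fun _ _ _ σ => (List.replicate (σ i) l).flatten : Emission α β K) := by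
  -- A fresh counter takes all values `t < b ^ L`, and those below `σ i` contribute one copy each.
  refine (range hm (lt ⟨m, hm⟩ i (const l))).congr fun w L h σ _ hσ _ => ?_
  have hne : i ≠ ⟨m, hm⟩ := by rintro rfl; simp at hi
  simp only [Function.update_self, Function.update_of_ne hne]
  have : ∀ B, σ i ≤ B → ((List.range B).flatMap fun t => if t < σ i then l else []) =
      (List.replicate (σ i) l).flatten := by
    intro B hB
    induction B, hB using Nat.le_induction with
    | base =>
      rw [List.flatMap_def]
      congr 1
      refine List.ext_getElem (by simp) fun n h1 h2 => ?_
      simp only [List.length_map, List.length_range] at h1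
      simp [h1]
    | succ B hB ih => simp [List.range_succ, ih, not_lt.2 hB]
  exact (this _ (hσ i).le).symm

/-- Emission with a further counter that is set to the cyclic successor of another counter. -/
theorem cyclicSucc (hm : m < K) (i : Fin K) (hi : i < m) (hf : Emits b (m + 1) P f) :
    Emits b m P fun w L h σ => f w L h (Function.update σ ⟨m, hm⟩ ((σ i + 1) % b ^ L)) := by
  -- Counters are never assigned: counter `m` runs through all values, and output is produced only
  -- at the wanted one.
  have hif : Emits b (m + 1) P fun w L h σ =>
      if σ ⟨m, hm⟩ = (σ i + 1) % b ^ L then f w L h σ else [] := by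
    refine (cases (true, true) (fun s c => (decide (b ≤ (c i : ℕ) + s.1.toNat),
        s.2 && decide (c ⟨m, hm⟩ = Fin.ofNat b (c i + s.1.toNat)))) (fun s _ => s.2)
      (p := fun _ L _ σ => decide (σ ⟨m, hm⟩ = (σ i + 1) % b ^ L)) (fun w L h σ hσ => ?_)
      (f := fun c w L h σ => if c then f w L h σ else []) fun c => ?_).congr
      fun w L h σ _ _ _ => ?_
    · rw [foldl_columns_succ _ _ _ _ _ _ (hσ _) (hσ _)]; simp
    · cases c
      · exact const []
      · exact hf
    · simp
  refine (range hm hif).congr fun w L h σ _ _ _ => ?_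
  have hne : i ≠ ⟨m, hm⟩ := by rintro rfl; simp at hi
  simp only [Function.update_self, Function.update_of_ne hne]
  have hB : 0 < b ^ L := Nat.pow_pos (Nat.pos_of_ne_zero (NeZero.ne b))
  have : ∀ (B x : ℕ) (g : ℕ → List β),
      ((List.range B).flatMap fun t => if t = x then g t else []) = if x < B then g x else [] := by
    intro B x g
    induction B with
    | zero => simp
    | succ B ih =>
      rw [List.range_succ, List.flatMap_append, ih]
      rcases lt_trichotomy x B with h | h | h
      · simp [h, h.ne', h.trans (Nat.lt_succ_self B)]
      · simp [h]
      · simp [h.ne, not_lt.2 h.le, not_lt.2 (Nat.succ_le_of_lt h)]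
  rw [this, if_pos (Nat.mod_lt _ hB)]

end Emits

/-! ### Quantified Boolean formulas in negation normal form -/

/-- Quantified Boolean formulas with negation on variables only. -/
inductive QBF (V : Type) where
  | tt | ff
  | lit (b : Bool) (v : V)
  | and (φ ψ : QBF V)
  | or (φ ψ : QBF V)
  | ex (v : V) (φ : QBF V)
  | all (v : V) (φ : QBF V)

namespace QBF

open Classical in
/-- The assignment that gives `v` the value `b` and otherwise agrees with `e`. -/
noncomputable def upd {V : Type} (e : V → Bool) (v : V) (b : Bool) : V → Bool :=
  Function.update e v b

theorem upd_self {V : Type} (e : V → Bool) (v : V) (b : Bool) : upd e v b v = b := by simp [upd]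

theorem upd_of_ne {V : Type} (e : V → Bool) {v w : V} (b : Bool) (h : w ≠ v) :
    upd e v b w = e w := by simp [upd, h]

/-- Truth under an assignment. -/
def Sat {V : Type} : QBF V → (V → Bool) → Prop
  | tt, _ => True
  | ff, _ => False
  | lit b v, e => e v = b
  | and φ ψ, e => φ.Sat e ∧ ψ.Sat e
  | or φ ψ, e => φ.Sat e ∨ ψ.Sat e
  | ex v φ, e => ∃ a, φ.Sat (upd e v a)
  | all v φ, e => ∀ a, φ.Sat (upd e v a)

variable {V X : Type}

theorem sat_foldr_and (l : List X) (F : X → QBF V) (φ : QBF V) (e : V → Bool) :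
    (l.foldr (fun x ψ => (F x).and ψ) φ).Sat e ↔ (∀ x ∈ l, (F x).Sat e) ∧ φ.Sat e := by
  induction l with
  | nil => simp
  | cons x l ih => simp [Sat, ih, and_assoc]

theorem sat_foldr_or (l : List X) (F : X → QBF V) (φ : QBF V) (e : V → Bool) :
    (l.foldr (fun x ψ => (F x).or ψ) φ).Sat e ↔ (∃ x ∈ l, (F x).Sat e) ∨ φ.Sat e := by
  induction l with
  | nil => simp
  | cons x l ih => simp [Sat, ih, or_assoc]

/-- A block of existential quantifiers chooses a new assignment that may differ only on the
quantified variables. -/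
theorem sat_foldr_ex (l : List X) (v : X → V) (φ : QBF V) (e : V → Bool) :
    (l.foldr (fun x ψ => ex (v x) ψ) φ).Sat e ↔
      ∃ e', (∀ y, (∀ x ∈ l, v x ≠ y) → e' y = e y) ∧ φ.Sat e' := by
  induction l generalizing e with
  | nil =>
    simp only [List.foldr_nil, List.not_mem_nil, false_imp_iff, implies_true, forall_const]
    constructor
    · exact fun h => ⟨e, fun _ => rfl, h⟩
    · rintro ⟨e', h, h'⟩; rwa [funext h] at h'
  | cons x l ih =>
    simp only [List.foldr_cons, Sat, ih]
    constructor
    · rintro ⟨a, e', h, h'⟩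
      refine ⟨e', fun y hy => ?_, h'⟩
      rw [h y fun x' hx' => hy x' (List.mem_cons_of_mem _ hx'),
        upd_of_ne _ _ (hy x List.mem_cons_self).symm]
    · rintro ⟨e', h, h'⟩
      refine ⟨e' (v x), e', fun y hy => ?_, h'⟩
      by_cases hxy : y = v x
      · subst hxy; rw [upd_self]
      · rw [upd_of_ne _ _ hxy]
        refine h y fun x' hx' => ?_
        rcases List.mem_cons.1 hx' with rfl | hx'
        · exact fun h => hxy h.symm
        · exact hy x' hx'

/-- Each `T x` behaves like an assignment statement. The outermost is executed first, so nesting by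
`foldr` becomes updating by `foldl`. -/
theorem sat_foldr_update (l : List X) (T : X → QBF V → QBF V) (u : X → (V → Bool) → V → Bool)
    (hT : ∀ x ψ e, (T x ψ).Sat e ↔ ψ.Sat (u x e)) (φ : QBF V) (e : V → Bool) :
    (l.foldr T φ).Sat e ↔ φ.Sat (l.foldl (fun e x => u x e) e) := by
  induction l generalizing e with
  | nil => simp
  | cons x l ih => simp [hT, ih]

/-- Gives `v` the value `b`. -/
def set (v : V) (b : Bool) (φ : QBF V) : QBF V := ex v ((lit b v).and φ)

theorem sat_set (v : V) (b : Bool) (φ : QBF V) (e : V → Bool) :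
    (set v b φ).Sat e ↔ φ.Sat (upd e v b) := by
  simp [set, Sat, upd_self]

/-- The two variables have the same value. -/
def same (v w : V) : QBF V := ((lit true v).and (lit true w)).or ((lit false v).and (lit false w))

theorem sat_same (v w : V) (e : V → Bool) : (same v w).Sat e ↔ e v = e w := by
  simp only [same, Sat]
  cases e v <;> cases e w <;> simp

/-- If `u` is true, `t` has the value of `x`, otherwise that of `y`. -/
def choice (t u x y : V) : QBF V :=
  ((lit true u).and (same t x)).or ((lit false u).and (same t y))

theorem sat_choice (t u x y : V) (e : V → Bool) :
    (choice t u x y).Sat e ↔ e t = if e u then e x else e y := by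
  simp only [choice, Sat, sat_same]
  cases e u <;> simp

/-- Gives `v` the value of `x` if `u` is true and that of `y` otherwise, using `t`. -/
def mux (t v u x y : V) (φ : QBF V) : QBF V :=
  ex t ((choice t u x y).and (ex v ((same v t).and φ)))

/-- The value passes through `t` because `v` may itself be `x` or `y`, and requantifying `v` loses
its old value. -/
theorem sat_mux {t v u x y : V} (hv : v ≠ t) (hu : u ≠ t) (hx : x ≠ t) (hy : y ≠ t) (φ : QBF V)
    (e : V → Bool) : (mux t v u x y φ).Sat e ↔
      φ.Sat (upd (upd e t (if e u then e x else e y)) v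
        (if e u then e x else e y)) := by
  simp [mux, Sat, sat_choice, sat_same, upd_self, upd_of_ne _ _ hu,
    upd_of_ne _ _ hx, upd_of_ne _ _ hy, upd_of_ne _ _ hv.symm]

end QBF

/-! ### Iterating a cellular automaton -/

/-- The kinds of variables: two auxiliary ones, and bits of three configurations. -/
abbrev Kind (ι : Type) : Type := Bool ⊕ Fin 3 × ι

/-- Variables: a kind and the number of a cell. -/
abbrev QVar (ι : Type) : Type := Kind ι × ℕ

section Automaton

variable {ι : Type}

/-- The bit `s` of cell `i` in configuration `a`. -/
def QVar.bit (a : Fin 3) (s : ι) (i : ℕ) : QVar ι := (.inr (a, s), i)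

/-- The universally quantified variable that selects one of two halves. -/
def QVar.half : QVar ι := (.inl true, 0)

/-- An auxiliary variable. -/
def QVar.temp : QVar ι := (.inl false, 0)

/-- The global map of the cellular automaton with local rule `g` on a cycle of length `B`. -/
def globalMap {W : Type} (B : ℕ) [NeZero B] (g : W → W → W → W) (x : Fin B → W) : Fin B → W :=
  fun j => g (x (j - 1)) (x j) (x (j + 1))

/-- The configuration `a` under an assignment. -/
def config (B : ℕ) (e : QVar ι → Bool) (a : Fin 3) : Fin B → ι → Bool :=
  fun i s => e (QVar.bit a s i)

namespace QBF

open QVar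

/-- Replaces one bit of the configurations `0` and `1` according to the selected half. -/
def halve (p : ℕ × ι) (φ : QBF (QVar ι)) : QBF (QVar ι) :=
  mux temp (bit 1 p.2 p.1) half (bit 2 p.2 p.1) (bit 1 p.2 p.1)
    (mux temp (bit 0 p.2 p.1) half (bit 0 p.2 p.1) (bit 2 p.2 p.1) φ)

/-- The effect of `mux` on an assignment. -/
noncomputable def muxUpd {V : Type} (t v u x y : V) (e : V → Bool) : V → Bool :=
  upd (upd e t (if e u then e x else e y)) v (if e u then e x else e y)

/-- The effect of `halve` on an assignment. -/
noncomputable def halveUpd (p : ℕ × ι) (e : QVar ι → Bool) : QVar ι → Bool :=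
  muxUpd temp (bit 0 p.2 p.1) half (bit 0 p.2 p.1) (bit 2 p.2 p.1)
    (muxUpd temp (bit 1 p.2 p.1) half (bit 2 p.2 p.1) (bit 1 p.2 p.1) e)

theorem sat_halve (p : ℕ × ι) (φ : QBF (QVar ι)) (e : QVar ι → Bool) :
    (halve p φ).Sat e ↔ φ.Sat (halveUpd p e) := by
  rw [halve, sat_mux (by simp [bit, temp]) (by simp [half, temp]) (by simp [bit, temp])
    (by simp [bit, temp]), sat_mux (by simp [bit, temp]) (by simp [half, temp])
    (by simp [bit, temp]) (by simp [bit, temp])]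
  rfl

open Classical in
-- The pair of configurations `(0, 1)` turns into `(0, 2)` if `half` is true and into `(2, 1)`
-- otherwise. Since `half` and configuration `2` stay as they are, all cells follow the same choice.
theorem halveUpd_spec (p : ℕ × ι) (e : QVar ι → Bool) :
    halveUpd p e half = e half ∧ ∀ s i, halveUpd p e (bit 2 s i) = e (bit 2 s i) ∧
      halveUpd p e (bit 1 s i) = (if (i, s) = p then
        if e half then e (bit 2 s i) else e (bit 1 s i) else e (bit 1 s i)) ∧
      halveUpd p e (bit 0 s i) = (if (i, s) = p then
        if e half then e (bit 0 s i) else e (bit 2 s i) else e (bit 0 s i)) := by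
  obtain ⟨j, t⟩ := p
  refine ⟨by simp [halveUpd, muxUpd, upd, half, temp, bit], fun s i => ⟨?_, ?_, ?_⟩⟩
  · simp [halveUpd, muxUpd, upd, half, temp, bit]
  · by_cases h : i = j ∧ s = t
    · obtain ⟨rfl, rfl⟩ := h
      simp [halveUpd, muxUpd, upd, half, temp, bit]
    · have h' : ¬ (s = t ∧ i = j) := fun h' => h ⟨h'.2, h'.1⟩
      simp [halveUpd, muxUpd, upd, half, temp, bit, h, h']
  · by_cases h : i = j ∧ s = t
    · obtain ⟨rfl, rfl⟩ := h
      simp [halveUpd, muxUpd, upd, half, temp, bit]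
      split_ifs with h
      exacts [(if_pos h).symm, (if_neg h).symm]
    · have h' : ¬ (s = t ∧ i = j) := fun h' => h ⟨h'.2, h'.1⟩
      simp [halveUpd, muxUpd, upd, half, temp, bit, h, h']

open Classical in
theorem foldl_halveUpd (l : List (ℕ × ι)) (e : QVar ι → Bool) (s : ι) (i : ℕ) :
    l.foldl (fun e p => halveUpd p e) e (bit 1 s i) = (if (i, s) ∈ l then
        if e half then e (bit 2 s i) else e (bit 1 s i) else e (bit 1 s i)) ∧
      l.foldl (fun e p => halveUpd p e) e (bit 0 s i) = (if (i, s) ∈ l then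
        if e half then e (bit 0 s i) else e (bit 2 s i) else e (bit 0 s i)) := by
  induction l generalizing e with
  | nil => simp
  | cons p l ih =>
    obtain ⟨h1, h2⟩ := halveUpd_spec p e
    obtain ⟨h3, h4, h5⟩ := h2 s i
    rw [List.foldl_cons, (ih _).1, (ih _).2, h1, h3, h4, h5]
    simp only [List.mem_cons]
    by_cases hp : (i, s) = p <;> by_cases hl : (i, s) ∈ l <;> cases e half <;> simp [hp, hl]

variable [Fintype ι]

/-- All pairs of a cell and a bit. -/
noncomputable def cells (ι : Type) [Fintype ι] (B : ℕ) : List (ℕ × ι) :=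
  (List.range B).flatMap fun i => (Finset.univ : Finset ι).toList.map fun s => (i, s)

theorem mem_cells {B : ℕ} {p : ℕ × ι} : p ∈ cells ι B ↔ p.1 < B := by
  obtain ⟨i, s⟩ := p
  simp [cells]

theorem length_cells (B : ℕ) : (cells ι B).length = B * Fintype.card ι := by
  simp [cells, List.length_flatMap]

/-- Cell `i` of configuration `a` contains `x`. -/
noncomputable def cellIs (a : Fin 3) (x : ι → Bool) (i : ℕ) : QBF (QVar ι) :=
  (Finset.univ : Finset ι).toList.foldr (fun s φ => (lit (x s) (bit a s i)).and φ) tt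

theorem sat_cellIs (B : ℕ) (a : Fin 3) (x : ι → Bool) (i : Fin B) (e : QVar ι → Bool) :
    (cellIs a x i).Sat e ↔ config B e a i = x := by
  simp [cellIs, sat_foldr_and, Sat, config, funext_iff]

open Classical in
/-- Cell `j` of configuration `1` is obtained by the local rule from the cells `i`, `j`, `k` of
configuration `0`. -/
noncomputable def localStep (g : (ι → Bool) → (ι → Bool) → (ι → Bool) → ι → Bool) (i j k : ℕ) :
    QBF (QVar ι) :=
  (Finset.univ : Finset ((ι → Bool) × (ι → Bool) × (ι → Bool))).toList.foldr (fun x φ =>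
    ((cellIs 0 x.1 i).and ((cellIs 0 x.2.1 j).and ((cellIs 0 x.2.2 k).and
      (cellIs 1 (g x.1 x.2.1 x.2.2) j)))).or φ) ff

theorem sat_localStep (B : ℕ) (g : (ι → Bool) → (ι → Bool) → (ι → Bool) → ι → Bool)
    (i j k : Fin B) (e : QVar ι → Bool) :
    (localStep g i j k).Sat e ↔
      config B e 1 j = g (config B e 0 i) (config B e 0 j) (config B e 0 k) := by
  simp only [localStep, sat_foldr_or, Sat, sat_cellIs, Finset.mem_toList, Finset.mem_univ,
    true_and, or_false, Prod.exists]
  constructor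
  · rintro ⟨_, _, _, rfl, rfl, rfl, h⟩; exact h
  · exact fun h => ⟨_, _, _, rfl, rfl, rfl, h⟩

/-- Configuration `1` is the successor of configuration `0`. -/
noncomputable def globalStep (B : ℕ) (g : (ι → Bool) → (ι → Bool) → (ι → Bool) → ι → Bool) :
    QBF (QVar ι) :=
  (List.range B).foldr
    (fun i φ => (localStep g i ((i + 1) % B) (((i + 1) % B + 1) % B)).and φ) tt

theorem sat_globalStep (B : ℕ) [NeZero B]
    (g : (ι → Bool) → (ι → Bool) → (ι → Bool) → ι → Bool) (e : QVar ι → Bool) :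
    (globalStep B g).Sat e ↔ config B e 1 = globalMap B g (config B e 0) := by
  have hs : ∀ i : Fin B, ((i : ℕ) + 1) % B = ((i + 1 : Fin B) : ℕ) := fun i => by
    simp [Fin.val_add]
  simp only [globalStep, sat_foldr_and, List.mem_range, Sat, and_true]
  constructor
  · intro h
    funext j
    -- The conjunct with index `i` is centred at cell `i + 1`, so that only cyclic successors ever
    -- have to be computed.
    have := h _ (j - 1).isLt
    rw [hs, hs, sat_localStep] at this
    simpa [globalMap] using this
  · intro h i hi
    have h1 := hs ⟨i, hi⟩
    have h2 := hs (⟨i, hi⟩ + 1)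
    rw [← h1] at h2
    simp only at h1 h2
    rw [h2, h1]
    have := sat_localStep B g ⟨i, hi⟩ (⟨i, hi⟩ + 1) (⟨i, hi⟩ + 1 + 1) e
    rw [this, h]
    simp [globalMap]

/-- One level of the recursion by halving: guess a middle configuration and continue with either
half. -/
noncomputable def level (B : ℕ) (φ : QBF (QVar ι)) : QBF (QVar ι) :=
  (cells ι B).foldr (fun p φ => ex (bit 2 p.2 p.1) φ) (all half ((cells ι B).foldr halve φ))

/-- The universal variable `half` demands both halves from a single copy of `φ`, so the text grows
additively while the number of steps doubles. Configuration `2` may be requantified inside `φ`,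
whose truth depends only on configurations `0` and `1`. -/
theorem sat_level (B : ℕ) (F : (Fin B → ι → Bool) → Fin B → ι → Bool) (n : ℕ)
    {φ : QBF (QVar ι)} (hφ : ∀ e, φ.Sat e ↔ config B e 1 = F^[n] (config B e 0))
    (e : QVar ι → Bool) :
    (level B φ).Sat e ↔ config B e 1 = F^[n + n] (config B e 0) := by
  have key : ∀ (e : QVar ι → Bool) (a : Bool),
      ((cells ι B).foldr halve φ).Sat (upd e half a) ↔
        (if a then config B e 2 else config B e 1) =
          F^[n] (if a then config B e 0 else config B e 2) := by
    intro e a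
    rw [sat_foldr_update _ _ halveUpd sat_halve, hφ]
    have hne : ∀ c s i, upd e half a (bit c s i) = e (bit c s i) :=
      fun c s i => upd_of_ne _ _ (by simp [bit, half])
    have h1 : config B ((cells ι B).foldl (fun e p => halveUpd p e) (upd e half a)) 1 =
        if a then config B e 2 else config B e 1 := by
      funext i s
      simp only [config]
      rw [(foldl_halveUpd _ _ _ _).1, upd_self, if_pos (mem_cells.2 i.isLt), hne, hne]
      cases a <;> rfl
    have h0 : config B ((cells ι B).foldl (fun e p => halveUpd p e) (upd e half a)) 0 =
        if a then config B e 0 else config B e 2 := by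
      funext i s
      simp only [config]
      rw [(foldl_halveUpd _ _ _ _).2, upd_self, if_pos (mem_cells.2 i.isLt), hne, hne]
      cases a <;> rfl
    rw [h1, h0]
  rw [level, sat_foldr_ex]
  simp only [Sat, key, Bool.forall_bool, if_true, Bool.false_eq_true, if_false]
  constructor
  · rintro ⟨e', he, h1, h2⟩
    have h (c : Fin 3) (hc : c ≠ 2) : config B e' c = config B e c := by
      funext i s
      exact he _ fun p _ h => hc (by simp [bit] at h; exact h.1.1.symm)
    rw [← h 0 (by decide), ← h 1 (by decide), Function.iterate_add_apply, h1, h2]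
  · intro h
    classical
    -- The middle configuration is the one after `n` steps.
    let e' : QVar ι → Bool := fun y => match y with
      | (.inr (2, s), i) => if hi : i < B then F^[n] (config B e 0) ⟨i, hi⟩ s else e y
      | y => e y
    have h2 : config B e' 2 = F^[n] (config B e 0) := by
      funext i s; simp [config, e', bit]
    have h0 : config B e' 0 = config B e 0 := rfl
    have h1 : config B e' 1 = config B e 1 := rfl
    refine ⟨e', ?_, ?_, ?_⟩
    · rintro ⟨k | ⟨c, s⟩, i⟩ hy
      · rfl
      · by_cases hc : c = 2
        · subst hc
          by_cases hi : i < B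
          · exact absurd rfl (hy (i, s) (mem_cells.2 hi))
          · simp [e', hi]
        · fin_cases c <;> first | rfl | exact absurd rfl hc
    · rw [h1, h2, h, Function.iterate_add_apply]
    · rw [h2, h0]

/-- Configuration `1` is reached from configuration `0` in a number of steps that is a power
of two. -/
noncomputable def reach (B : ℕ) (g : (ι → Bool) → (ι → Bool) → (ι → Bool) → ι → Bool) :
    QBF (QVar ι) :=
  (cells ι B).foldr (fun _ φ => level B φ) (globalStep B g)

/-- One doubling per bit of a configuration gives as many steps as there are configurations, which
is enough for every orbit that halts. -/
theorem sat_reach (B : ℕ) [NeZero B] (g : (ι → Bool) → (ι → Bool) → (ι → Bool) → ι → Bool)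
    (e : QVar ι → Bool) : (reach B g).Sat e ↔
      config B e 1 = (globalMap B g)^[2 ^ (B * Fintype.card ι)] (config B e 0) := by
  rw [← length_cells, reach]
  induction cells ι B generalizing e with
  | nil => simp [sat_globalStep]
  | cons p l ih =>
    rw [List.foldr_cons, sat_level B (globalMap B g) _ ih, List.length_cons, pow_succ, mul_two]

open Classical in
/-- The content of cell `i` of configuration `1` satisfies `acc`. -/
noncomputable def cellAccepts (acc : (ι → Bool) → Prop) (i : ℕ) : QBF (QVar ι) :=
  ((Finset.univ : Finset (ι → Bool)).filter acc).toList.foldr (fun x φ => (cellIs 1 x i).or φ) ff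

theorem sat_cellAccepts (B : ℕ) (acc : (ι → Bool) → Prop) (i : Fin B) (e : QVar ι → Bool) :
    (cellAccepts acc i).Sat e ↔ acc (config B e 1 i) := by
  simp [cellAccepts, sat_foldr_or, Sat, sat_cellIs B]

/-- Starting from the configuration `x₀`, all cells are accepting after sufficiently many steps. -/
noncomputable def accepts (B : ℕ) (g : (ι → Bool) → (ι → Bool) → (ι → Bool) → ι → Bool)
    (acc : (ι → Bool) → Prop) (x₀ : ℕ → ι → Bool) : QBF (QVar ι) :=
  (List.range B).foldr
    (fun i φ => (Finset.univ : Finset ι).toList.foldr (fun s φ => set (bit 0 s i) (x₀ i s) φ) φ)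
    ((cells ι B).foldr (fun p φ => ex (bit 1 p.2 p.1) φ)
      ((List.range B).foldr (fun i φ => (cellAccepts acc i).and φ) (reach B g)))

theorem sat_accepts (B : ℕ) [NeZero B] (g : (ι → Bool) → (ι → Bool) → (ι → Bool) → ι → Bool)
    (acc : (ι → Bool) → Prop) (x₀ : ℕ → ι → Bool) (e : QVar ι → Bool) :
    (accepts B g acc x₀).Sat e ↔
      ∀ i, acc ((globalMap B g)^[2 ^ (B * Fintype.card ι)] (fun i : Fin B => x₀ i) i) := by
  have hfold : ∀ φ : QBF (QVar ι), (List.range B).foldr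
      (fun i φ => (Finset.univ : Finset ι).toList.foldr (fun s φ => set (bit 0 s i) (x₀ i s) φ) φ)
      φ = (cells ι B).foldr (fun p φ => set (bit 0 p.2 p.1) (x₀ p.1 p.2) φ) φ := by
    intro φ
    simp [cells, List.foldr_flatMap, List.foldr_map]
  have hinit : config B ((cells ι B).foldl
      (fun e p => upd e (bit 0 p.2 p.1) (x₀ p.1 p.2)) e) 0 = fun i : Fin B => x₀ i := by
    -- Generalized for the induction: each bit is still to be set or already correct.
    have : ∀ (l : List (ℕ × ι)) (e : QVar ι → Bool) (i : ℕ) (s : ι),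
        (i, s) ∈ l ∨ e (bit 0 s i) = x₀ i s →
        l.foldl (fun e p => upd e (bit 0 p.2 p.1) (x₀ p.1 p.2)) e (bit 0 s i) = x₀ i s := by
      intro l
      induction l with
      | nil => simp
      | cons p l ih =>
        intro e i s h
        refine ih _ i s ?_
        by_cases hp : (i, s) = p
        · subst hp; exact .inr (upd_self _ _ _)
        · rcases h with h | h
          · exact .inl ((List.mem_cons.1 h).resolve_left hp)
          · refine .inr ?_
            refine (upd_of_ne _ _ fun h' => ?_).trans h
            simp only [bit, Prod.mk.injEq, Sum.inr.injEq, true_and] at h'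
            exact hp (Prod.ext h'.2 h'.1)
    funext i s
    exact this _ _ _ _ (.inl (mem_cells.2 i.isLt))
  rw [accepts, hfold, sat_foldr_update _ _ (fun p e => upd e (bit 0 p.2 p.1) (x₀ p.1 p.2))
    (fun p φ e => sat_set _ _ _ _), sat_foldr_ex]
  simp only [sat_foldr_and, List.mem_range, sat_reach]
  constructor
  · rintro ⟨e', he, h1, h2⟩ i
    have h0 : config B e' 0 = fun i : Fin B => x₀ i := by
      rw [← hinit]
      funext i s
      exact he _ fun p _ h => by simp [bit] at h
    rw [← h0, ← h2, ← sat_cellAccepts B acc i e']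
    exact h1 i i.isLt
  · intro h
    set y := (globalMap B g)^[2 ^ (B * Fintype.card ι)] (fun i : Fin B => x₀ i) with hy
    set e₀ := (cells ι B).foldl (fun e p => upd e (bit 0 p.2 p.1) (x₀ p.1 p.2)) e
    let e' : QVar ι → Bool := fun v => match v with
      | (.inr (1, s), i) => if hi : i < B then y ⟨i, hi⟩ s else e₀ v
      | v => e₀ v
    have h1 : config B e' 1 = y := by funext i s; simp [config, e', bit]
    have h0 : config B e' 0 = config B e₀ 0 := rfl
    refine ⟨e', ?_, fun i hi => ?_, ?_⟩
    · rintro ⟨k | ⟨c, s⟩, i⟩ hv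
      · rfl
      · by_cases hc : c = 1
        · subst hc
          by_cases hi : i < B
          · exact absurd rfl (hv (i, s) (mem_cells.2 hi))
          · simp [e', hi]
        · fin_cases c <;> first | rfl | exact absurd rfl hc
    · have := sat_cellAccepts B acc ⟨i, hi⟩ e'
      rw [h1] at this
      exact this.2 (h _)
    · rw [h1, h0, hinit]

end QBF

end Automaton

/-! ### Turing machines as cellular automata -/

/-- An orbit that ends in a fixed point does so within as many steps as there are points. -/
theorem iterate_eq_of_fixed {S : Type*} [Fintype S] (F : S → S) {x y : S} (hy : F y = y)
    (h : ∃ t, F^[t] x = y) {N : ℕ} (hN : Fintype.card S ≤ N) : F^[N] x = y := by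
  classical
  have hfix : ∀ k, F^[k] y = y := fun k => Function.iterate_fixed hy k
  have hle : Nat.find h ≤ Fintype.card S := by
    -- Otherwise two of the first `|S| + 1` iterates coincide, and cutting out the cycle between
    -- them reaches `y` before the minimal time.
    by_contra hlt
    push Not at hlt
    obtain ⟨i, j, hij, heq⟩ := Fintype.exists_ne_map_eq_of_card_lt
      (fun i : Fin (Fintype.card S + 1) => F^[i] x) (by simp)
    wlog hlt' : i < j generalizing i j
    · exact this j i hij.symm heq.symm (lt_of_le_of_ne (not_lt.1 hlt') hij.symm)
    have hlt'' : (i : ℕ) < j := hlt'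
    have hj := j.isLt
    refine Nat.find_min h (m := Nat.find h - j + i) (by omega) ?_
    rw [Function.iterate_add_apply]
    rw [heq, ← Function.iterate_add_apply, Nat.sub_add_cancel (by omega)]
    exact Nat.find_spec h
  rw [← Nat.sub_add_cancel (hle.trans hN), Function.iterate_add_apply, Nat.find_spec h, hfix]

noncomputable instance : DecidableEq Move := Classical.decEq _

namespace TM

open Transducer (inputTape)

variable {α : Type} (M : TM α)

/-- A tape cell: its symbol, and the state if the head is there. -/
abbrev Cell : Type := Option (α ⊕ M.Γ) × Option M.Q

variable {M}

/-- The instruction to be executed at a cell. -/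
def action (x : M.Cell) : Option (M.Q × Option (α ⊕ M.Γ) × Move) := x.2.bind fun q => M.δ q x.1

/-- The state of the head if it leaves the cell in the given direction. -/
noncomputable def departure (x : M.Cell) (m : Move) : Option M.Q :=
  (action x).bind fun a => if a.2.2 = m then some a.1 else none

/-- The content of a cell after one step, from the contents of the cell and its neighbours. -/
noncomputable def rule (l c r : M.Cell) : M.Cell :=
  ((action c).elim c.1 fun a => a.2.1,
    if c.2.isSome then (action c).elim c.2 fun _ => departure c .stay
    else (departure l .right).or (departure r .left))

theorem departure_of_headless {x : M.Cell} (h : x.2 = none) (m : Move) : departure x m = none := by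
  simp [departure, action, h]

/-- A neighbour matters only through a head that leaves it. Wrong neighbours at the seam of the
cycle are therefore harmless as long as they carry no head. -/
theorem rule_congr {l l' c r r' : M.Cell} (hl : l = l' ∨ l.2 = none ∧ l'.2 = none)
    (hr : r = r' ∨ r.2 = none ∧ r'.2 = none) : rule l c r = rule l' c r' := by
  have h1 : departure l .right = departure l' .right := by
    rcases hl with rfl | ⟨h, h'⟩
    · rfl
    · rw [departure_of_headless h, departure_of_headless h']
  have h2 : departure r .left = departure r' .left := by
    rcases hr with rfl | ⟨h, h'⟩
    · rfl
    · rw [departure_of_headless h, departure_of_headless h']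
  rw [rule, rule, h1, h2]

/-- The cells of a configuration. -/
def view (c : M.Cfg) (z : ℤ) : M.Cell := (c.tape z, if z = c.head then some c.state else none)

theorem view_headless {c : M.Cfg} {z : ℤ} (h : z ≠ c.head) : (view c z).2 = none := by
  simp [view, h]

/-- Without an instruction `rule` keeps the head in place, so halting configurations become fixed
points of the automaton. -/
theorem rule_view_halted {c : M.Cfg} (h : M.step c = none) (z : ℤ) :
    rule (view c (z - 1)) (view c z) (view c (z + 1)) = view c z := by
  have h0 : M.δ c.state (c.tape c.head) = none := by simpa [step] using h
  have hd : ∀ y m, departure (view c y) m = none := by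
    intro y m
    by_cases hy : y = c.head
    · subst hy; simp [departure, action, view, h0]
    · exact departure_of_headless (view_headless hy) m
  have ha : action (view c z) = none := by
    by_cases hz : z = c.head
    · subst hz; simp [action, view, h0]
    · simp [action, view_headless hz]
  rw [rule, hd, hd, hd, ha]
  by_cases hz : z = c.head <;> simp [view, hz]

theorem rule_view_step {c d : M.Cfg} (h : M.step c = some d) (z : ℤ) :
    rule (view c (z - 1)) (view c z) (view c (z + 1)) = view d z := by
  simp only [step, Option.map_eq_some_iff] at h
  obtain ⟨⟨q, s, m⟩, h0, rfl⟩ := h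
  have hd : ∀ y m', departure (view c y) m' = if y = c.head ∧ m = m' then some q else none := by
    intro y m'
    by_cases hy : y = c.head
    · subst hy; simp [departure, action, view, h0]
    · rw [departure_of_headless (view_headless hy), if_neg (by tauto)]
  rw [rule, hd, hd, hd]
  by_cases hz : z = c.head
  · subst hz
    cases m <;> simp [view, action, h0, Move.toInt]
  · have e1 : z - 1 = c.head ↔ z = c.head + 1 := by omega
    have e2 : z + 1 = c.head ↔ z = c.head + -1 := by omega
    have ha : action (view c z) = none := by simp [action, view_headless hz]
    rw [ha]
    cases m <;> simp [view, hz, Move.toInt, e1, e2] <;> congr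

/-- The integer in the window `-H, …, B - H - 1` that is represented by a cell of a cycle. -/
def rep (H : ℕ) {B : ℕ} (i : Fin B) : ℤ := if (i : ℕ) + H < B then i else (i : ℤ) - B

/-- The second case is the seam, the only place where neighbours on the cycle are not neighbours on
the tape. -/
theorem rep_succ {H B : ℕ} [NeZero B] (hH : 0 < H) (hB : H < B) (j : Fin B) : rep H (j + 1) = rep H j + 1 ∨
    rep H j = B - H - 1 ∧ rep H (j + 1) = -H := by
  have hj := j.isLt
  have h1 : ((j + 1 : Fin B) : ℕ) = (j + 1) % B := by simp [Fin.val_add]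
  simp only [rep, h1]
  rcases Nat.lt_or_ge ((j : ℕ) + 1) B with h | h
  · rw [Nat.mod_eq_of_lt h]; split_ifs <;> omega
  · have : (j : ℕ) + 1 = B := by omega
    rw [this, Nat.mod_self]; split_ifs <;> omega

/-- The head stays away from both ends of the window, so `rule_congr` applies at the seam. -/
theorem globalMap_view {H B : ℕ} [NeZero B] (hH : 0 < H) (hB : H < B) {c : M.Cfg} (h1 : -(H : ℤ) < c.head - 1)
    (h2 : c.head + 1 < (B : ℤ) - H) (i : Fin B) :
    globalMap B rule (fun i => view c (rep H i)) i =
      rule (view c (rep H i - 1)) (view c (rep H i)) (view c (rep H i + 1)) := by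
  rw [globalMap]
  refine rule_congr ?_ ?_
  · have := rep_succ (H := H) hH hB (i - 1)
    rw [sub_add_cancel] at this
    rcases this with h | ⟨h, h'⟩
    · left; rw [h, add_sub_cancel_right]
    · right; constructor <;> refine view_headless ?_ <;> omega
  · rcases rep_succ (H := H) hH hB i with h | ⟨h, h'⟩
    · left; rw [h]
    · right; constructor <;> refine view_headless ?_ <;> omega

theorem iterate_view {H B : ℕ} [NeZero B] (hH : 0 < H) (hB : H < B) {c d : M.Cfg} (hr : M.Reaches c d)
    (hb : ∀ x, M.Reaches c x → -(H : ℤ) < x.head - 1 ∧ x.head + 1 < (B : ℤ) - H) :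
    ∃ t, (globalMap B rule)^[t] (fun i => view c (rep H i)) = fun i => view d (rep H i) := by
  induction hr with
  | refl => exact ⟨0, rfl⟩
  | tail hr hs ih =>
    obtain ⟨t, ht⟩ := ih
    refine ⟨t + 1, ?_⟩
    rw [Function.iterate_succ_apply', ht]
    funext i
    rw [globalMap_view hH hB (hb _ hr).1 (hb _ hr).2, rule_view_step hs]

theorem exists_rep {H B : ℕ} (hB : H < B) {z : ℤ} (h1 : -(H : ℤ) ≤ z) (h2 : z < (B : ℤ) - H) :
    ∃ i : Fin B, rep H i = z := by
  rcases lt_or_ge z 0 with h | h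
  · refine ⟨⟨(z + B).toNat, by omega⟩, ?_⟩
    simp only [rep]; split_ifs <;> omega
  · refine ⟨⟨z.toNat, by omega⟩, ?_⟩
    simp only [rep]; split_ifs <;> omega

variable (M)

open Classical in
/-- A cell in bits. -/
noncomputable def bits (x : M.Cell) : M.Cell → Bool := fun y => decide (y = x)

theorem bits_injective : Function.Injective M.bits := by
  intro x y h
  have := congrFun h x
  simpa [bits] using this

/-- The cell with the given bits. -/
noncomputable def ofBits : (M.Cell → Bool) → M.Cell := Function.invFun M.bits

theorem ofBits_bits (x : M.Cell) : M.ofBits (M.bits x) = x :=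
  Function.leftInverse_invFun M.bits_injective x

/-- The local rule in bits. -/
noncomputable def bitRule (l c r : M.Cell → Bool) : M.Cell → Bool :=
  M.bits (rule (M.ofBits l) (M.ofBits c) (M.ofBits r))

/-- If the cell contains a state, then that state is accepting iff `p` is true. -/
def cellAccepting (p : Bool) (x : M.Cell → Bool) : Prop :=
  ∀ q, (M.ofBits x).2 = some q → (q ∈ M.accepting ↔ p = true)

open Classical in
/-- The initial content of a cell with the given input symbol, where the head is on the cell iff
`p` holds. -/
noncomputable def initCell (x : InputCell α) (p : Prop) : M.Cell :=
  (match x with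
    | .sym a => some (.inl a)
    | _ => none, if p then some M.start else none)

/-- Bit patterns that encode no cell never arise from encoded configurations, so the arbitrary value
of `ofBits` on them plays no role. -/
theorem iterate_bitRule (B : ℕ) [NeZero B] (x : Fin B → M.Cell) (t : ℕ) :
    (globalMap B M.bitRule)^[t] (fun i => M.bits (x i)) =
      fun i => M.bits ((globalMap B rule)^[t] x i) := by
  induction t with
  | zero => rfl
  | succ t ih =>
    rw [Function.iterate_succ_apply', ih, Function.iterate_succ_apply']
    funext i
    simp only [globalMap, bitRule, ofBits_bits]

/-- Cells beyond the input, among them those that represent negative positions, are given the right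
end marker, which `initCell` turns into a blank. -/
theorem view_init (w : List α) {H B : ℕ} (hw : w.length + H ≤ B) (i : Fin B) (hB : H < B) :
    view (M.init w) (rep H i) =
      M.initCell (inputTape w (min (i + 1) (w.length + 1))) ((i : ℕ) = 0) := by
  have hi := i.isLt
  have h0 : rep H i = 0 ↔ (i : ℕ) = 0 := by simp only [rep]; split_ifs <;> omega
  refine Prod.ext ?_ ?_
  · simp only [view, init, initCell]
    rcases Nat.lt_or_ge i w.length with h | h
    · have : rep H i = i := by simp only [rep]; rw [if_pos (by omega)]
      rw [this, show min ((i : ℕ) + 1) (w.length + 1) = i + 1 by omega]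
      simp [inputTape, h]
    · rw [show min ((i : ℕ) + 1) (w.length + 1) = w.length + 1 by omega]
      have : (if 0 ≤ rep H i then Option.map Sum.inl w[(rep H i).toNat]? else none) =
          (none : Option (α ⊕ M.Γ)) := by
        split_ifs with h'
        · rw [List.getElem?_eq_none]
          · rfl
          · simp only [rep] at h' ⊢
            split_ifs at h' ⊢ <;> omega
        · rfl
      rw [this]
      simp [inputTape]
  · simp only [view, initCell, init, h0]
    congr

theorem accepts_iff [Finite α] [Fintype M.Cell] {X : Set (List α)} {s : ℕ → ℕ}
    (hM : M.DecidesInSpace X s) (p : Bool)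
    (w : List α) {B : ℕ} [NeZero B] (hB : 2 * s w.length + w.length + 5 ≤ B) :
    (∀ i, M.cellAccepting p ((globalMap B M.bitRule)^[2 ^ (B * Fintype.card M.Cell)] (fun i : Fin B =>
      M.bits (M.initCell (inputTape w (min (i + 1) (w.length + 1))) ((i : ℕ) = 0))) i)) ↔
      (w ∈ X ↔ p = true) := by
  classical
  obtain ⟨hs, d, hd, hhalt, hacc⟩ := hM w
  -- The margin keeps the head and its neighbours off the seam; the bound on `B` leaves room for
  -- both sides and for the input.
  set H := s w.length + 2 with hH
  have hb : ∀ x, M.Reaches (M.init w) x → -(H : ℤ) < x.head - 1 ∧ x.head + 1 < (B : ℤ) - H := by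
    intro x hx
    have := hs x hx
    omega
  obtain ⟨t, ht⟩ := iterate_view (by omega) (by omega) hd hb
  have hinit : (fun i : Fin B =>
      M.bits (M.initCell (inputTape w (min (i + 1) (w.length + 1))) ((i : ℕ) = 0))) =
      fun i => M.bits (view (M.init w) (rep H i)) := by
    funext i; rw [view_init M w (by omega) i (by omega)]
  have hfix : globalMap B M.bitRule (fun i => M.bits (view d (rep H i))) =
      fun i => M.bits (view d (rep H i)) := by
    have := M.iterate_bitRule B (fun i => view d (rep H i)) 1
    simp only [Function.iterate_one] at this
    rw [this]
    funext i
    rw [globalMap_view (by omega) (by omega) (hb d hd).1 (hb d hd).2, rule_view_halted hhalt]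
  -- There are exactly `2 ^ (B * |Cell|)` arrays of bits, the number of iterations.
  rw [hinit, iterate_eq_of_fixed (globalMap B M.bitRule) hfix
    ⟨t, by rw [iterate_bitRule, ht]⟩ (by simp [Fintype.card_pi, ← pow_mul, mul_comm])]
  simp only [cellAccepting, ofBits_bits]
  rw [← hacc]
  -- Only the cell under the head contains a state; the condition on all other cells is void.
  constructor
  · intro h
    obtain ⟨i, hi⟩ := exists_rep (H := H) (B := B) (by omega) (z := d.head) (by have := hb d hd; omega)
      (by have := hb d hd; omega)
    exact h i d.state (by simp [view, hi])
  · intro h i q hq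
    simp only [view] at hq
    split_ifs at hq
    rwa [← Option.some.inj hq]

end TM

/-! ### First-order formulas read with a polarity -/

namespace Formula

variable {S : Signature}

/-- Conjunction or disjunction. -/
def conn (p : Bool) (φ ψ : Formula S) : Formula S := if p then conj φ ψ else disj φ ψ

/-- Existential or universal quantification. -/
def quant (p : Bool) (i : ℕ) (φ : Formula S) : Formula S := if p then ex i φ else all i φ

/-- Truth if `p` is true and falsity otherwise. -/
def Holds (A : Model S) (p : Bool) (φ : Formula S) (e : ℕ → A.Carrier) : Prop :=
  if p then φ.Sat A e else ¬ φ.Sat A e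

variable {A : Model S} {p : Bool} {φ ψ : Formula S} {e : ℕ → A.Carrier} {i : ℕ}

/-- De Morgan duality: for `p = false` connectives and truth values are exchanged together. One set
of clauses then serves atoms that express an equivalence and atoms that express its negation. -/
theorem holds_and : Holds A p (conn p φ ψ) e ↔ Holds A p φ e ∧ Holds A p ψ e := by
  cases p <;> simp [Holds, conn, Sat]

theorem holds_or : Holds A p (conn (!p) φ ψ) e ↔ Holds A p φ e ∨ Holds A p ψ e := by
  cases p <;> simp [Holds, conn, Sat]
  tauto

theorem holds_ex : Holds A p (quant p i φ) e ↔ ∃ a, Holds A p φ (Function.update e i a) := by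
  cases p <;> simp [Holds, quant, Sat]

theorem holds_all : Holds A p (quant (!p) i φ) e ↔ ∀ a, Holds A p φ (Function.update e i a) := by
  cases p <;> simp [Holds, quant, Sat]

theorem freeVars_conn : (conn p φ ψ).freeVars = φ.freeVars ∪ ψ.freeVars := by
  cases p <;> rfl

theorem freeVars_quant : (quant p i φ).freeVars = φ.freeVars \ {i} := by
  cases p <;> rfl

theorem ops_conn {L : Set Op} (hL : positiveOps ⊆ L) (hφ : φ.ops ⊆ L) (hψ : ψ.ops ⊆ L) :
    (conn p φ ψ).ops ⊆ L := by
  cases p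
  · exact Set.insert_subset (hL (by simp [positiveOps])) (Set.union_subset hφ hψ)
  · exact Set.insert_subset (hL (by simp [positiveOps])) (Set.union_subset hφ hψ)

theorem ops_quant {L : Set Op} (hL : positiveOps ⊆ L) (hφ : φ.ops ⊆ L) :
    (quant p i φ).ops ⊆ L := by
  cases p
  · exact Set.insert_subset (hL (by simp [positiveOps])) hφ
  · exact Set.insert_subset (hL (by simp [positiveOps])) hφ

variable {X : Type*}

theorem holds_foldr_and (l : List X) (F : X → Formula S) :
    Holds A p (l.foldr (fun x ψ => conn p (F x) ψ) φ) e ↔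
      (∀ x ∈ l, Holds A p (F x) e) ∧ Holds A p φ e := by
  induction l with
  | nil => simp
  | cons x l ih => simp [holds_and, ih, and_assoc]

theorem holds_foldr_or (l : List X) (F : X → Formula S) :
    Holds A p (l.foldr (fun x ψ => conn (!p) (F x) ψ) φ) e ↔
      (∃ x ∈ l, Holds A p (F x) e) ∨ Holds A p φ e := by
  induction l with
  | nil => simp
  | cons x l ih => simp [holds_or, ih, or_assoc]

theorem holds_foldr_ex (l : List X) (v : X → ℕ) :
    Holds A p (l.foldr (fun x ψ => quant p (v x) ψ) φ) e ↔
      ∃ e', (∀ y, (∀ x ∈ l, v x ≠ y) → e' y = e y) ∧ Holds A p φ e' := by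
  induction l generalizing e with
  | nil =>
    simp only [List.foldr_nil, List.not_mem_nil, false_imp_iff, implies_true, forall_const]
    constructor
    · exact fun h => ⟨e, fun _ => rfl, h⟩
    · rintro ⟨e', h, h'⟩; rwa [funext h] at h'
  | cons x l ih =>
    simp only [List.foldr_cons, holds_ex, ih]
    constructor
    · rintro ⟨a, e', h, h'⟩
      refine ⟨e', fun y hy => ?_, h'⟩
      rw [h y fun x' hx' => hy x' (List.mem_cons_of_mem _ hx'),
        Function.update_of_ne (hy x List.mem_cons_self).symm]
    · rintro ⟨e', h, h'⟩
      refine ⟨e' (v x), e', fun y hy => ?_, h'⟩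
      by_cases hxy : y = v x
      · subst hxy; simp
      · rw [Function.update_of_ne hxy]
        refine h y fun x' hx' => ?_
        rcases List.mem_cons.1 hx' with rfl | hx'
        · exact fun h => hxy h.symm
        · exact hy x' hx'

theorem ops_foldr {L : Set Op} (l : List X) {T : X → Formula S → Formula S}
    (hT : ∀ x ψ, ψ.ops ⊆ L → (T x ψ).ops ⊆ L) (hφ : φ.ops ⊆ L) : (l.foldr T φ).ops ⊆ L := by
  induction l with
  | nil => exact hφ
  | cons x l ih => exact hT x _ ih

theorem freeVars_foldr {s : Set ℕ} (l : List X) {T : X → Formula S → Formula S}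
    (hT : ∀ x ψ, ψ.freeVars ⊆ s → (T x ψ).freeVars ⊆ s) (hφ : φ.freeVars ⊆ s) :
    (l.foldr T φ).freeVars ⊆ s := by
  induction l with
  | nil => exact hφ
  | cons x l ih => exact hT x _ ih

/-- Universal quantification over a list of variables. -/
def closure (l : List ℕ) (φ : Formula S) : Formula S := l.foldr all φ

theorem freeVars_closure (l : List ℕ) : (closure l φ).freeVars = φ.freeVars \ {i | i ∈ l} := by
  induction l with
  | nil => simp [closure]
  | cons i l ih =>
    simp only [closure, List.foldr_cons, freeVars] at ih ⊢
    rw [ih]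
    ext j
    simp only [Set.mem_sdiff, Set.mem_ofPred_eq, Set.mem_singleton_iff, List.mem_cons, not_or]
    tauto

/-- Over a nonempty universe, universal closure does not affect a formula whose truth is independent
of the evaluation. -/
theorem sat_closure {q : Prop} (h : ∀ e, φ.Sat A e ↔ q) (l : List ℕ) (e : ℕ → A.Carrier) :
    (closure l φ).Sat A e ↔ q := by
  have : Nonempty A.Carrier := A.nontrivial.to_nonempty
  induction l generalizing e with
  | nil => exact h e
  | cons i l ih =>
    simp only [closure, List.foldr_cons, Sat] at ih ⊢
    simp [ih]

end Formula

/-! ### From quantified Boolean formulas to first-order formulas -/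

namespace QBF

open Formula

variable {S : Signature} {V : Type}

/-- Translation to first-order logic, or dually if `p` is false, where the variable `v` is
named by `idx v` and literals, truth and falsity are given. -/
def toFormula (p : Bool) (idx : V → ℕ) (lt : Bool → ℕ → Formula S) (t f : Formula S) :
    QBF V → Formula S
  | tt => t
  | ff => f
  | lit b v => lt b (idx v)
  | and φ ψ => conn p (φ.toFormula p idx lt t f) (ψ.toFormula p idx lt t f)
  | or φ ψ => conn (!p) (φ.toFormula p idx lt t f) (ψ.toFormula p idx lt t f)
  | ex v φ => quant p (idx v) (φ.toFormula p idx lt t f)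
  | all v φ => quant (!p) (idx v) (φ.toFormula p idx lt t f)

/-- All literals are about variables with the property `q`. -/
def Within (q : V → Prop) : QBF V → Prop
  | tt => True
  | ff => True
  | lit _ v => q v
  | and φ ψ => φ.Within q ∧ ψ.Within q
  | or φ ψ => φ.Within q ∧ ψ.Within q
  | ex _ φ => φ.Within q
  | all _ φ => φ.Within q

section semantics

variable {A : Model S} {p : Bool} {idx : V → ℕ} {lt : Bool → ℕ → Formula S} {t f : Formula S}
  {D : Bool → A.Carrier → Prop} {Fr : (ℕ → A.Carrier) → Prop}

/-- Read `D b a` as "`a` may stand for `b`". Every element stands for some value by `hcover`;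
elements standing for both do no harm, as they only make more literals true. -/
theorem holds_toFormula_of_sat (hidx : Function.Injective idx)
    (hFr : ∀ e v a, Fr e → Fr (Function.update e (idx v) a))
    (hl : ∀ e b v, Fr e → D b (e (idx v)) → Holds A p (lt b (idx v)) e)
    (ht : ∀ e, Fr e → Holds A p t e) (hD : ∀ b, ∃ a, D b a) (hcover : ∀ a, ∃ b, D b a)
    (φ : QBF V) (β : V → Bool) (e : ℕ → A.Carrier) (he : Fr e) (hβ : ∀ v, D (β v) (e (idx v)))
    (h : φ.Sat β) : Holds A p (φ.toFormula p idx lt t f) e := by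
  have hupd : ∀ (β : V → Bool) (e : ℕ → A.Carrier) (v : V) (b : Bool) (a : A.Carrier),
      (∀ v, D (β v) (e (idx v))) → D b a →
      ∀ w, D (upd β v b w) (Function.update e (idx v) a (idx w)) := by
    intro β e v b a hβ hb w
    by_cases hw : w = v
    · subst hw; rwa [upd_self, Function.update_self]
    · rw [upd_of_ne _ _ hw, Function.update_of_ne (hidx.ne hw)]; exact hβ w
  induction φ generalizing β e with
  | tt => exact ht e he
  | ff => exact h.elim
  | lit b v => exact hl e b v he (by have := hβ v; rwa [show β v = b from h] at this)
  | and φ ψ ih1 ih2 => exact holds_and.2 ⟨ih1 β e he hβ h.1, ih2 β e he hβ h.2⟩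
  | or φ ψ ih1 ih2 => exact holds_or.2 (h.imp (ih1 β e he hβ) (ih2 β e he hβ))
  | ex v φ ih =>
    obtain ⟨b, hb⟩ := h
    obtain ⟨a, ha⟩ := hD b
    exact holds_ex.2 ⟨a, ih _ _ (hFr e v a he) (hupd β e v b a hβ ha) hb⟩
  | all v φ ih =>
    refine holds_all.2 fun a => ?_
    obtain ⟨b, hb⟩ := hcover a
    exact ih _ _ (hFr e v a he) (hupd β e v b a hβ hb) (h b)

/-- Here no element stands for both values, while some may stand for neither. -/
theorem sat_of_holds_toFormula (hidx : Function.Injective idx)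
    (hFr : ∀ e v a, Fr e → Fr (Function.update e (idx v) a))
    (hl : ∀ e b v, Fr e → Holds A p (lt b (idx v)) e → D b (e (idx v)))
    (hf : ∀ e, Fr e → ¬ Holds A p f e) (hD : ∀ b, ∃ a, D b a)
    (hdisj : ∀ a, D true a → ¬ D false a)
    (φ : QBF V) (β : V → Bool) (e : ℕ → A.Carrier) (he : Fr e)
    (hβ : ∀ v b, D b (e (idx v)) → β v = b)
    (h : Holds A p (φ.toFormula p idx lt t f) e) : φ.Sat β := by
  have hupd : ∀ (β : V → Bool) (e : ℕ → A.Carrier) (v : V) (c : Bool) (a : A.Carrier),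
      (∀ v b, D b (e (idx v)) → β v = b) → (∀ b, D b a → c = b) →
      ∀ w b, D b (Function.update e (idx v) a (idx w)) → upd β v c w = b := by
    intro β e v c a hβ hb w b
    by_cases hw : w = v
    · subst hw; rw [upd_self, Function.update_self]; exact hb b
    · rw [upd_of_ne _ _ hw, Function.update_of_ne (hidx.ne hw)]; exact hβ w b
  have huniq : ∀ a c b, D c a → D b a → c = b := by
    intro a c b hc hb
    cases c <;> cases b
    · rfl
    · exact (hdisj a hb hc).elim
    · exact (hdisj a hc hb).elim
    · rfl
  induction φ generalizing β e with
  | tt => trivial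
  | ff => exact hf e he h
  | lit b v => exact hβ v b (hl e b v he h)
  | and φ ψ ih1 ih2 =>
    have := holds_and.1 h
    exact ⟨ih1 β e he hβ this.1, ih2 β e he hβ this.2⟩
  | or φ ψ ih1 ih2 => exact (holds_or.1 h).imp (ih1 β e he hβ) (ih2 β e he hβ)
  | ex v φ ih =>
    obtain ⟨a, ha⟩ := holds_ex.1 h
    by_cases hc : ∃ c, D c a
    · obtain ⟨c, hc⟩ := hc
      exact ⟨c, ih _ _ (hFr e v a he) (hupd β e v c a hβ fun b hb => huniq a c b hc hb) ha⟩
    -- An element that stands for no value makes no literal about `v` true, so any value can be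
    -- chosen.
    · exact ⟨true, ih _ _ (hFr e v a he)
        (hupd β e v true a hβ fun b hb => (hc ⟨b, hb⟩).elim) ha⟩
  | all v φ ih =>
    intro c
    obtain ⟨a, ha⟩ := hD c
    exact ih _ _ (hFr e v a he) (hupd β e v c a hβ fun b hb => huniq a c b ha hb)
      (holds_all.1 h a)

end semantics

theorem ops_toFormula {L : Set Op} (hL : positiveOps ⊆ L) {p : Bool} {idx : V → ℕ}
    {lt : Bool → ℕ → Formula S} {t f : Formula S} (hlt : ∀ b i, (lt b i).ops ⊆ L) (ht : t.ops ⊆ L)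
    (hf : f.ops ⊆ L) (φ : QBF V) : (φ.toFormula p idx lt t f).ops ⊆ L := by
  induction φ with
  | tt => exact ht
  | ff => exact hf
  | lit b v => exact hlt _ _
  | and φ ψ ih1 ih2 => exact ops_conn hL ih1 ih2
  | or φ ψ ih1 ih2 => exact ops_conn hL ih1 ih2
  | ex v φ ih => exact ops_quant hL ih
  | all v φ ih => exact ops_quant hL ih

theorem freeVars_toFormula {s : Set ℕ} {q : V → Prop} {p : Bool} {idx : V → ℕ}
    {lt : Bool → ℕ → Formula S} {t f : Formula S} (hlt : ∀ b v, q v → (lt b (idx v)).freeVars ⊆ s)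
    (ht : t.freeVars ⊆ s) (hf : f.freeVars ⊆ s) (φ : QBF V) (hφ : φ.Within q) :
    (φ.toFormula p idx lt t f).freeVars ⊆ s := by
  induction φ with
  | tt => exact ht
  | ff => exact hf
  | lit b v => exact hlt _ _ hφ
  | and φ ψ ih1 ih2 =>
    rw [toFormula, freeVars_conn]; exact Set.union_subset (ih1 hφ.1) (ih2 hφ.2)
  | or φ ψ ih1 ih2 =>
    rw [toFormula, freeVars_conn]; exact Set.union_subset (ih1 hφ.1) (ih2 hφ.2)
  | ex v φ ih => rw [toFormula, freeVars_quant]; exact Set.sdiff_subset.trans (ih hφ)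
  | all v φ ih => rw [toFormula, freeVars_quant]; exact Set.sdiff_subset.trans (ih hφ)

end QBF

/-! ### The sentences -/

/-- `atom i j`, or its negation if `p` is false, defines a nontrivial equivalence relation, for all
variables from `r` on. -/
def DefinesEquivalence {S : Signature} (A : Model S) (p : Bool) (r : ℕ)
    (atom : ℕ → ℕ → Formula S) : Prop :=
  ∃ E : Setoid A.Carrier, (∃ x y, ¬ E x y) ∧
    ∀ i j e, r ≤ i → r ≤ j → (Formula.Holds A p (atom i j) e ↔ E (e i) (e j))

/-- Parameters of the construction: polarity, first free variable, number of names for elements,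
number of names for each cell, and the formula that defines an equivalence relation. -/
structure Frame (S : Signature) where
  p : Bool
  r : ℕ
  N : ℕ
  atom : ℕ → ℕ → Formula S

namespace Frame

open Formula

variable {S : Signature} (T : Frame S) {V ι : Type}

/-- The variable that names the truth value `b`. -/
def truth (b : Bool) : ℕ := T.r + b.toNat

/-- The variable that names the `k`-th element. -/
def name (k : Fin T.N) : ℕ := T.r + 2 + k

/-- The element named by `i` is equivalent to one of those chosen by `I` for the value `b`. -/
def literal (I : Fin T.N → Bool) (b : Bool) (i : ℕ) : Formula S :=
  ((List.finRange T.N).filter fun k => I k = b).foldr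
    (fun k φ => conn (!T.p) (T.atom i (T.name k)) φ) (T.atom i (T.truth b))

/-- The translation of a quantified Boolean formula for one choice of truth values. -/
def translate (idx : V → ℕ) (I : Fin T.N → Bool) (φ : QBF V) : Formula S :=
  φ.toFormula T.p idx (T.literal I) (T.atom (T.truth false) (T.truth false))
    (T.atom (T.truth false) (T.truth true))

/-- For all choices of two inequivalent elements some elements can be named such that the formula
is true whatever truth values are given to the names. -/
noncomputable def matrix (idx : V → ℕ) (φ : QBF V) : Formula S :=
  quant (!T.p) (T.truth false) (quant (!T.p) (T.truth true)
    (conn (!T.p) (T.atom (T.truth false) (T.truth true))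
      ((List.finRange T.N).foldr (fun k ψ => quant T.p (T.name k) ψ)
        ((Finset.univ : Finset (Fin T.N → Bool)).toList.foldr
          (fun I ψ => conn T.p (T.translate idx I φ) ψ)
          (T.atom (T.truth false) (T.truth false))))))

theorem ops_matrix {L : Set Op} (hL : positiveOps ⊆ L) (ha : ∀ i j, (T.atom i j).ops ⊆ L)
    (idx : V → ℕ) (φ : QBF V) : (T.matrix idx φ).ops ⊆ L := by
  refine ops_quant hL (ops_quant hL (ops_conn hL (ha _ _)
    (ops_foldr _ (fun _ _ h => ops_quant hL h) (ops_foldr _ (fun I _ h => ops_conn hL ?_ h)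
      (ha _ _)))))
  exact QBF.ops_toFormula hL (fun _ _ => ops_foldr _ (fun _ _ h => ops_conn hL (ha _ _) h) (ha _ _))
    (ha _ _) (ha _ _) φ

theorem freeVars_matrix {s : Set ℕ} {q : V → Prop} {idx : V → ℕ}
    (ha : ∀ i ∈ s, ∀ j ∈ s, (T.atom i j).freeVars ⊆ s) (hs : ∀ i < T.r + 2 + T.N, i ∈ s)
    (hq : ∀ v, q v → idx v ∈ s) {φ : QBF V} (hφ : φ.Within q) :
    (T.matrix idx φ).freeVars ⊆ s := by
  have ht : ∀ b, T.truth b ∈ s := fun b => hs _ (by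
    have := Bool.toNat_le b; simp only [truth]; omega)
  have hn : ∀ k, T.name k ∈ s := fun k => hs _ (by simp only [name]; omega)
  have hquant : ∀ p i (ψ : Formula S), ψ.freeVars ⊆ s → (quant p i ψ).freeVars ⊆ s :=
    fun p i ψ h => by rw [freeVars_quant]; exact Set.sdiff_subset.trans h
  have hconn : ∀ p (ψ χ : Formula S), ψ.freeVars ⊆ s → χ.freeVars ⊆ s →
      (conn p ψ χ).freeVars ⊆ s :=
    fun p ψ χ h h' => by rw [freeVars_conn]; exact Set.union_subset h h'
  refine hquant _ _ _ (hquant _ _ _ (hconn _ _ _ (ha _ (ht _) _ (ht _))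
    (freeVars_foldr _ (fun _ _ h => hquant _ _ _ h)
      (freeVars_foldr _ (fun I _ h => hconn _ _ _ ?_ h) (ha _ (ht _) _ (ht _))))))
  exact QBF.freeVars_toFormula (fun b v hv => freeVars_foldr _
    (fun _ _ h => hconn _ _ _ (ha _ (hq v hv) _ (hn _)) h) (ha _ (hq v hv) _ (ht _)))
    (ha _ (ht _) _ (ht _)) (ha _ (ht _) _ (ht _)) φ hφ

/-- The `I` in the conjunction resolves a tension: names are needed to let every element stand for a
value, but the structure cannot be trusted to give them consistent values. Soundness needs only one
good `I`; completeness copes with all of them because overlaps are harmless. -/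
theorem holds_matrix {A : Model S} (hA : DefinesEquivalence A T.p T.r T.atom)
    (hN : Nat.card A.Carrier ≤ T.N) {idx : V → ℕ} (hidx : Function.Injective idx)
    (hlow : ∀ v, T.r + 2 + T.N ≤ idx v) {φ : QBF V} {P : Prop} (hφ : ∀ β, φ.Sat β ↔ P)
    (e : ℕ → A.Carrier) : Holds A T.p (T.matrix idx φ) e ↔ P := by
  classical
  have := A.finite
  have hne : Nonempty A.Carrier := A.nontrivial.to_nonempty
  obtain ⟨E, ⟨x, y, hxy⟩, hE⟩ := hA
  have ht : ∀ b, T.r ≤ T.truth b := fun b => Nat.le_add_right _ _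
  have hn : ∀ k, T.r ≤ T.name k := fun k => by simp only [name]; omega
  have hnt : ∀ k b, T.name k ≠ T.truth b := fun k b => by
    have := Bool.toNat_le b; simp only [name, truth]; omega
  have hinj : Function.Injective T.name := fun k l h => by
    simp only [name] at h; ext; omega
  have htt : T.truth false ≠ T.truth true := by simp [truth]
  -- the frame condition and the meaning of literals
  let Fr (e₀ : ℕ → A.Carrier) : (ℕ → A.Carrier) → Prop := fun e => ∀ i < T.r + 2 + T.N, e i = e₀ i
  have hFr : ∀ e₀ e v a, Fr e₀ e → Fr e₀ (Function.update e (idx v) a) := by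
    intro e₀ e v a h i hi
    rw [Function.update_of_ne (by have := hlow v; omega)]
    exact h i hi
  have hFt : ∀ {e₀ e} b, Fr e₀ e → e (T.truth b) = e₀ (T.truth b) := fun b h => h _ (by
    have := Bool.toNat_le b; simp only [truth]; omega)
  have hFn : ∀ {e₀ e} k, Fr e₀ e → e (T.name k) = e₀ (T.name k) := fun k h => h _ (by
    simp only [name]; omega)
  let D (e₀ : ℕ → A.Carrier) (I : Fin T.N → Bool) : Bool → A.Carrier → Prop := fun b a =>
    (∃ k, I k = b ∧ E a (e₀ (T.name k))) ∨ E a (e₀ (T.truth b))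
  have hl : ∀ e₀ I e b v, Fr e₀ e →
      (Holds A T.p (T.literal I b (idx v)) e ↔ D e₀ I b (e (idx v))) := by
    intro e₀ I e b v h
    have hv : T.r ≤ idx v := by have := hlow v; omega
    rw [literal, holds_foldr_or]
    simp only [List.mem_filter, List.mem_finRange, true_and, decide_eq_true_eq,
      hE _ _ e hv (hn _), hE _ _ e hv (ht _), hFn _ h, hFt _ h, D]
  have hDex : ∀ e₀ I b, ∃ a, D e₀ I b a := fun e₀ I b => ⟨e₀ (T.truth b), .inr (E.refl _)⟩
  have htrue : ∀ e, Holds A T.p (T.atom (T.truth false) (T.truth false)) e := fun e =>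
    (hE _ _ e (ht _) (ht _)).2 (E.refl _)
  simp only [matrix, holds_all, holds_or, holds_foldr_ex, holds_foldr_and, Finset.mem_toList,
    Finset.mem_univ, true_imp_iff, htrue, and_true]
  constructor
  · intro h
    rcases h x y with h | ⟨e₀, he₀, h⟩
    · rw [hE _ _ _ (ht _) (ht _)] at h
      rw [Function.update_self, Function.update_of_ne htt, Function.update_self] at h
      exact (hxy h).elim
    · have h0 : e₀ (T.truth false) = x := by
        rw [he₀ _ fun k _ => hnt k _, Function.update_of_ne htt, Function.update_self]
      have h1 : e₀ (T.truth true) = y := by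
        rw [he₀ _ fun k _ => hnt k _, Function.update_self]
      -- Sorting the names by equivalence to `y` separates the elements that stand for true from
      -- those that stand for false.
      let I : Fin T.N → Bool := fun k => decide (E (e₀ (T.name k)) y)
      have hT : ∀ a, D e₀ I true a → E a y := by
        rintro a (⟨k, hk, ha⟩ | ha)
        · exact E.trans ha (of_decide_eq_true hk)
        · rwa [h1] at ha
      have hF : ∀ a, D e₀ I false a → ¬ E a y := by
        rintro a (⟨k, hk, ha⟩ | ha) hay
        · exact of_decide_eq_false hk (E.trans (E.symm ha) hay)
        · rw [h0] at ha; exact hxy (E.trans (E.symm ha) hay)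
      -- The truth of `φ` does not depend on the assignment, so one compatible with `e₀` is chosen.
      rw [← hφ fun v => decide (E (e₀ (idx v)) y)]
      refine QBF.sat_of_holds_toFormula (D := D e₀ I) (Fr := Fr e₀) hidx (hFr e₀)
        (fun e b v he => (hl e₀ I e b v he).1) (fun e he hf => ?_) (hDex e₀ I)
        (fun a h h' => hF a h' (hT a h)) φ _ e₀ (fun _ _ => rfl) (fun v b hb => ?_) (h I)
      · rw [hE _ _ e (ht _) (ht _), hFt _ he, hFt _ he, h0, h1] at hf
        exact hxy hf
      · cases b
        · exact decide_eq_false (hF _ hb)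
        · exact decide_eq_true (hT _ hb)
  · intro hP a₀ a₁
    refine or_iff_not_imp_left.2 fun _ => ?_
    -- The names enumerate the whole universe, so every element stands for a value under any `I`.
    obtain ⟨f, hf⟩ : ∃ f : Fin T.N → A.Carrier, Function.Surjective f := by
      have hpos : 0 < Nat.card A.Carrier := Nat.card_pos
      refine ⟨fun k => (Finite.equivFin A.Carrier).symm
        (if h : (k : ℕ) < Nat.card A.Carrier then ⟨k, h⟩ else ⟨0, hpos⟩), fun a => ?_⟩
      refine ⟨⟨Finite.equivFin A.Carrier a, (Fin.isLt _).trans_le hN⟩, ?_⟩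
      simp
    set e₁ := Function.update (Function.update e (T.truth false) a₀) (T.truth true) a₁
    let e₀ : ℕ → A.Carrier := fun i => if h : ∃ k, T.name k = i then f h.choose else e₁ i
    have he₀ : ∀ k, e₀ (T.name k) = f k := fun k => by
      have h : ∃ l, T.name l = T.name k := ⟨k, rfl⟩
      simp only [e₀, h, dif_pos]
      rw [hinj h.choose_spec]
    refine ⟨e₀, fun i hi => ?_, fun I => ?_⟩
    · have : ¬ ∃ k, T.name k = i := fun ⟨k, hk⟩ => hi k (List.mem_finRange k) hk
      simp only [e₀, this, dif_neg, not_false_eq_true]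
    · have hcover : ∀ a, ∃ b, D e₀ I b a := fun a => by
        obtain ⟨k, rfl⟩ := hf a
        exact ⟨I k, .inl ⟨k, rfl, by rw [he₀]⟩⟩
      choose c hc using hcover
      exact QBF.holds_toFormula_of_sat (D := D e₀ I) (Fr := Fr e₀) hidx (hFr e₀)
        (fun e b v he => (hl e₀ I e b v he).2) (fun e _ => htrue e) (hDex e₀ I)
        (fun a => ⟨c a, hc a⟩) φ (fun v => c (e₀ (idx v))) e₀ (fun _ _ => rfl) (fun v => hc _)
        ((hφ _).2 hP)

end Frame

open Transducer (inputTape)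

/-! ### Range of the variables in the Boolean formulas -/

namespace QBF

open QVar

section within

variable {V X : Type} {q : V → Prop}

theorem within_foldr (l : List X) {T : X → QBF V → QBF V} {φ : QBF V}
    (hT : ∀ x ∈ l, ∀ ψ, ψ.Within q → (T x ψ).Within q) (hφ : φ.Within q) :
    (l.foldr T φ).Within q := by
  induction l with
  | nil => exact hφ
  | cons x l ih =>
    exact hT x List.mem_cons_self _ (ih fun y hy => hT y (List.mem_cons_of_mem _ hy))

variable {ι : Type} {B : ℕ}

theorem within_halve (hB : 0 < B) {x : ℕ × ι} (hx : x.1 < B) {φ : QBF (QVar ι)}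
    (hφ : φ.Within (·.2 < B)) : (halve x φ).Within (·.2 < B) := by
  simp [halve, mux, choice, same, Within, bit, half, temp, hB, hx, hφ]

variable [Fintype ι]

theorem within_cellIs (a : Fin 3) (x : ι → Bool) {i : ℕ} (hi : i < B) :
    (cellIs a x i).Within (·.2 < B) :=
  within_foldr _ (fun _ _ _ h => ⟨hi, h⟩) trivial

/-- All literals concern cells below `B`; hence closing over the variables provided for `B` cells
yields a sentence. -/
theorem within_accepts (hB : 0 < B) (g : (ι → Bool) → (ι → Bool) → (ι → Bool) → ι → Bool)
    (acc : (ι → Bool) → Prop) (x₀ : ℕ → ι → Bool) :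
    (accepts B g acc x₀).Within (·.2 < B) := by
  have hm : ∀ i, i % B < B := fun i => Nat.mod_lt _ hB
  refine within_foldr _ (fun i hi ψ h => within_foldr _ (fun s _ ψ h =>
    ⟨List.mem_range.1 hi, h⟩) h) (within_foldr _ (fun _ _ _ h => h)
    (within_foldr _ (fun i hi ψ h => ⟨within_foldr _ (fun x _ ψ h =>
      ⟨within_cellIs _ _ (List.mem_range.1 hi), h⟩) trivial, h⟩)
      (within_foldr _ (fun _ _ ψ h => ?_) (within_foldr _ (fun i hi ψ h => ⟨?_, h⟩) trivial))))
  · exact within_foldr _ (fun _ _ _ h => h)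
      (within_foldr _ (fun p hp _ h => within_halve hB (mem_cells.1 hp) h) h)
  · exact within_foldr _ (fun x _ ψ h => ⟨⟨within_cellIs _ _ (List.mem_range.1 hi),
      within_cellIs _ _ (hm _), within_cellIs _ _ (hm _), within_cellIs _ _ (hm _)⟩, h⟩) trivial

end within

end QBF

/-! ### The text of the sentences -/

/-- The word `encode code (atom i j)` consists of fixed parts and of occurrences of `i` and `j`. -/
def IsTemplateFor {S : Signature} (code : S.Symbol → List Bool) (atom : ℕ → ℕ → Formula S) :
    Prop :=
  ∃ t : List (List Token ⊕ Bool), ∀ i j, encode code (atom i j) =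
    t.flatMap (Sum.elim id fun c => encodeVar (if c then i else j))

/-- The token of a conjunction or disjunction. -/
def connToken (p : Bool) : Token := if p then .conj else .disj

/-- The token of a quantifier. -/
def quantToken (p : Bool) : Token := if p then .ex else .all

section encode

variable {S : Signature} (code : S.Symbol → List Bool)

theorem encode_conn (p : Bool) (φ ψ : Formula S) : encode code (Formula.conn p φ ψ) =
    connToken p :: (encode code φ ++ encode code ψ) := by
  cases p <;> rfl

theorem encode_quant (p : Bool) (i : ℕ) (φ : Formula S) : encode code (Formula.quant p i φ) =
    quantToken p :: (encodeVar i ++ encode code φ) := by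
  cases p <;> rfl

/-- A text that is built from the end by putting something in front. -/
theorem text_foldr {Φ X : Type*} (text : Φ → List Token) (l : List X) {T : X → Φ → Φ}
    {pre : X → List Token} (hT : ∀ x ψ, text (T x ψ) = pre x ++ text ψ) (φ : Φ) :
    text (l.foldr T φ) = l.flatMap pre ++ text φ := by
  induction l with
  | nil => rfl
  | cons x l ih => simp [hT, ih]

end encode

namespace Frame

variable {S : Signature} (T : Frame S) {ι : Type} [Fintype ι]

/-- The number of variables that are provided for each cell. -/
noncomputable def width (ι : Type) [Fintype ι] : ℕ := T.r + 2 + T.N + Fintype.card (Kind ι)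

/-- The number of a kind of variables among those provided for a cell. -/
noncomputable def offset (κ : Kind ι) : ℕ := T.r + 2 + T.N + Fintype.equivFin (Kind ι) κ

/-- The variables of a quantified Boolean formula as variables of first-order logic. -/
noncomputable def index (v : QVar ι) : ℕ := v.2 * T.width ι + T.offset v.1

theorem offset_lt (κ : Kind ι) : T.offset κ < T.width ι := by
  have := (Fintype.equivFin (Kind ι) κ).isLt
  simp only [offset, width]; omega

/-- Each cell owns a block of `width` consecutive variables: the cell is the quotient and the kind
is determined by the remainder. -/
theorem index_injective : Function.Injective (T.index : QVar ι → ℕ) := by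
  rintro ⟨κ, i⟩ ⟨κ', i'⟩ h
  simp only [index] at h
  have h1 := T.offset_lt κ
  have h2 := T.offset_lt κ'
  have hpos : 0 < T.width ι := by omega
  have h3 : i = i' := by
    have := congrArg (· / T.width ι) h
    simpa [Nat.add_comm (_ * _), Nat.add_mul_div_right _ _ hpos, Nat.div_eq_of_lt h1,
      Nat.div_eq_of_lt h2] using this
  subst h3
  have h4 : T.offset κ = T.offset κ' := by omega
  simp only [offset, Nat.add_left_cancel_iff, Fin.val_inj, EmbeddingLike.apply_eq_iff_eq] at h4
  rw [h4]

theorem le_index (v : QVar ι) : T.r + 2 + T.N ≤ T.index v := by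
  simp only [index, offset]; omega

theorem index_lt {B : ℕ} {v : QVar ι} (h : v.2 < B) : T.index v < B * T.width ι := by
  have h1 := T.offset_lt v.1
  calc T.index v < v.2 * T.width ι + T.width ι := by simp only [index]; omega
    _ = (v.2 + 1) * T.width ι := by ring
    _ ≤ B * T.width ι := Nat.mul_le_mul_right _ h

/-- All variables that are provided for `B` cells. -/
noncomputable def allVars (ι : Type) [Fintype ι] (B : ℕ) : List ℕ :=
  (List.range B).flatMap fun i => (List.range (T.width ι)).map fun c => i * T.width ι + c

theorem mem_allVars {B n : ℕ} (h : n < B * T.width ι) : n ∈ T.allVars ι B := by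
  have hpos : 0 < T.width ι := Nat.pos_of_ne_zero fun h0 => by simp [h0] at h
  simp only [allVars, List.mem_flatMap, List.mem_range, List.mem_map]
  exact ⟨n / T.width ι, (Nat.div_lt_iff_lt_mul hpos).2 h, n % T.width ι, Nat.mod_lt _ hpos,
    Nat.div_add_mod' n _⟩

end Frame

/-! ### Writing the text with counters -/

section emission

variable {S : Signature} {code : S.Symbol → List Bool} {T : Frame S} {α ι : Type} [Fintype ι]
  {K b : ℕ} [NeZero b] {m : ℕ} {P : ℕ → Prop}

namespace Emits

/-- Variables are written in unary: `W` ticks for each unit of the counter and `c` more. Counter `m`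
is scratch space for the repetition. -/
theorem encodeVar (hm : m < K) {i : Fin K} (hi : i < m) (W c : ℕ) :
    Emits b m P (fun _ _ _ σ => PMC.encodeVar (σ i * W + c) : Emission α Token K) := by
  refine ((const [Token.var]).append ((repeat_counter hm i hi (List.replicate W Token.tick)).append
    (const (List.replicate c Token.tick)))).congr fun w L h σ _ _ _ => ?_
  rw [PMC.encodeVar, List.replicate_add, List.flatten_replicate_replicate]
  rfl

theorem index (hm : m < K) {i : Fin K} (hi : i < m) (κ : Kind ι) :
    Emits b m P (fun _ _ _ σ => PMC.encodeVar (T.index (κ, σ i)) : Emission α Token K) :=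
  encodeVar hm hi (T.width ι) (T.offset κ)

theorem atom (ha : IsTemplateFor code T.atom) (hm : m < K) {i : Fin K} (hi : i < m) (κ : Kind ι)
    (j : ℕ) :
    Emits b m P (fun _ _ _ σ => encode code (T.atom (T.index (κ, σ i)) j) :
      Emission α Token K) := by
  obtain ⟨t, ht⟩ := ha
  simp only [ht]
  refine flatMap (b := b) t (f := (fun c _ _ _ σ =>
    Sum.elim id (fun c => PMC.encodeVar (if c then T.index (κ, σ i) else j)) c :
      List Token ⊕ Bool → Emission α Token K)) fun c => ?_
  rcases c with l | c
  · exact const l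
  · cases c
    · exact const (b := b) (PMC.encodeVar j)
    · exact index (b := b) hm hi κ

variable (I : Fin T.N → Bool)

theorem literal (ha : IsTemplateFor code T.atom) (hm : m < K) {i : Fin K} (hi : i < m) (c : Bool)
    (κ : Kind ι) :
    Emits b m P (fun _ _ _ σ => encode code (T.literal I c (T.index (κ, σ i))) :
      Emission α Token K) := by
  refine ((flatMap ((List.finRange T.N).filter fun k => I k = c) fun k =>
    (const [connToken (!T.p)]).append (atom ha hm hi κ (T.name k))).append
      (atom ha hm hi κ (T.truth c))).congr fun w L h σ _ _ _ => ?_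
  exact text_foldr (encode code) _ (fun k ψ => by simp [encode_conn]) _

theorem cells (hm : m < K) {F : ℕ → ι → ℕ → List Token}
    (hF : ∀ s, Emits b (m + 1) P
      (fun _ L _ σ => F L s (σ ⟨m, hm⟩) : Emission α Token K)) :
    Emits b m P (fun _ L _ _ => (QBF.cells ι (b ^ L)).flatMap fun x => F L x.2 x.1 :
      Emission α Token K) := by
  refine (range hm (flatMap (Finset.univ : Finset ι).toList hF)).congr fun w L h σ _ _ _ => ?_
  simp [QBF.cells, List.flatMap_assoc, List.flatMap_map]

end Emits

/-- The text of the translation of a quantified Boolean formula. -/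
noncomputable def qbfText (code : S.Symbol → List Bool) (T : Frame S) (I : Fin T.N → Bool)
    (φ : QBF (QVar ι)) : List Token := encode code (T.translate T.index I φ)

open QBF QVar

variable {I : Fin T.N → Bool}

theorem qbfText_and (φ ψ : QBF (QVar ι)) : qbfText code T I (φ.and ψ) =
    [connToken T.p] ++ (qbfText code T I φ ++ qbfText code T I ψ) := encode_conn _ _ _ _

theorem qbfText_or (φ ψ : QBF (QVar ι)) : qbfText code T I (φ.or ψ) =
    [connToken (!T.p)] ++ (qbfText code T I φ ++ qbfText code T I ψ) := encode_conn _ _ _ _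

theorem qbfText_ex (v : QVar ι) (φ : QBF (QVar ι)) : qbfText code T I (ex v φ) =
    [quantToken T.p] ++ (encodeVar (T.index v) ++ qbfText code T I φ) := encode_quant _ _ _ _

theorem qbfText_all (v : QVar ι) (φ : QBF (QVar ι)) : qbfText code T I (all v φ) =
    [quantToken (!T.p)] ++ (encodeVar (T.index v) ++ qbfText code T I φ) := encode_quant _ _ _ _

/-- The formulas with parameters whose text is emitted. -/
def EmitsQBF (code : S.Symbol → List Bool) (I : Fin T.N → Bool) (α : Type) {K : ℕ} (b : ℕ)
    [NeZero b] (m : ℕ) (P : ℕ → Prop) (φ : ℕ → (Fin K → ℕ) → QBF (QVar ι)) : Prop :=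
  Emits b m P (fun _ L _ σ => qbfText code T I (φ L σ) : Emission α Token K)

/-- The operations on formulas that put something in front of the text. -/
def EmitsPrefix (code : S.Symbol → List Bool) (I : Fin T.N → Bool) (α : Type) {K : ℕ} (b : ℕ)
    [NeZero b] (m : ℕ) (P : ℕ → Prop)
    (F : ℕ → (Fin K → ℕ) → QBF (QVar ι) → QBF (QVar ι)) : Prop :=
  ∃ pre : ℕ → (Fin K → ℕ) → List Token,
    Emits b m P (fun _ L _ σ => pre L σ : Emission α Token K) ∧
    ∀ L σ φ, qbfText code T I (F L σ φ) = pre L σ ++ qbfText code T I φ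

variable {φ ψ : ℕ → (Fin K → ℕ) → QBF (QVar ι)}
  {F G : ℕ → (Fin K → ℕ) → QBF (QVar ι) → QBF (QVar ι)}

namespace EmitsQBF

theorem const (φ : QBF (QVar ι)) : EmitsQBF code I α b m P fun _ (_ : Fin K → ℕ) => φ :=
  Emits.const _

theorem and (hφ : EmitsQBF code I α b m P φ) (hψ : EmitsQBF code I α b m P ψ) :
    EmitsQBF code I α b m P fun L σ => (φ L σ).and (ψ L σ) := by
  simp only [EmitsQBF, qbfText_and]
  exact (Emits.const _).append (Emits.append hφ hψ)

theorem or (hφ : EmitsQBF code I α b m P φ) (hψ : EmitsQBF code I α b m P ψ) :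
    EmitsQBF code I α b m P fun L σ => (φ L σ).or (ψ L σ) := by
  simp only [EmitsQBF, qbfText_or]
  exact (Emits.const _).append (Emits.append hφ hψ)

theorem lit (ha : IsTemplateFor code T.atom) (hm : m < K) {i : Fin K} (hi : i < m) (c : Bool)
    (κ : Kind ι) : EmitsQBF code I α b m P fun _ (σ : Fin K → ℕ) => lit c (κ, σ i) :=
  Emits.literal I ha hm hi c κ

theorem foldr {X : Type} (l : List X)
    {F : X → ℕ → (Fin K → ℕ) → QBF (QVar ι) → QBF (QVar ι)}
    (hF : ∀ x, EmitsPrefix code I α b m P (F x)) (hφ : EmitsQBF code I α b m P φ) :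
    EmitsQBF code I α b m P fun L σ => l.foldr (fun x ψ => F x L σ ψ) (φ L σ) := by
  choose pre hpre hF using hF
  refine Emits.congr ((Emits.flatMap l hpre).append hφ) fun w L h σ _ _ _ => ?_
  exact text_foldr (qbfText code T I) l (fun x ψ => hF x L σ ψ) _

end EmitsQBF

namespace EmitsPrefix

theorem and (hφ : EmitsQBF code I α b m P φ) :
    EmitsPrefix code I α b m P fun L σ => (φ L σ).and :=
  ⟨fun L σ => [connToken T.p] ++ qbfText code T I (φ L σ), (Emits.const _).append hφ,
    fun L σ ψ => by rw [qbfText_and, List.append_assoc]⟩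

theorem or (hφ : EmitsQBF code I α b m P φ) :
    EmitsPrefix code I α b m P fun L σ => (φ L σ).or :=
  ⟨fun L σ => [connToken (!T.p)] ++ qbfText code T I (φ L σ), (Emits.const _).append hφ,
    fun L σ ψ => by rw [qbfText_or, List.append_assoc]⟩

theorem ex (hm : m < K) {i : Fin K} (hi : i < m) (κ : Kind ι) :
    EmitsPrefix code I α b m P fun _ (σ : Fin K → ℕ) => ex (κ, σ i) :=
  ⟨fun _ σ => [quantToken T.p] ++ encodeVar (T.index (κ, σ i)),
    (Emits.const _).append (Emits.index hm hi κ),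
    fun L σ ψ => by rw [qbfText_ex, List.append_assoc]⟩

theorem ex_const (v : QVar ι) : EmitsPrefix code I α b m P fun _ (_ : Fin K → ℕ) => QBF.ex v :=
  ⟨fun _ _ => [quantToken T.p] ++ encodeVar (T.index v), Emits.const _,
    fun L σ ψ => by rw [qbfText_ex, List.append_assoc]⟩

theorem all_const (v : QVar ι) : EmitsPrefix code I α b m P fun _ (_ : Fin K → ℕ) => all v :=
  ⟨fun _ _ => [quantToken (!T.p)] ++ encodeVar (T.index v), Emits.const _,
    fun L σ ψ => by rw [qbfText_all, List.append_assoc]⟩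

theorem comp {H : ℕ → (Fin K → ℕ) → QBF (QVar ι) → QBF (QVar ι)}
    (hF : EmitsPrefix code I α b m P F) (hG : EmitsPrefix code I α b m P G)
    (h : ∀ L σ ψ, H L σ ψ = F L σ (G L σ ψ)) : EmitsPrefix code I α b m P H := by
  obtain ⟨pre, hpre, hF⟩ := hF
  obtain ⟨pre', hpre', hG⟩ := hG
  exact ⟨fun L σ => pre L σ ++ pre' L σ, hpre.append hpre',
    fun L σ ψ => by rw [h, hF, hG, List.append_assoc]⟩

theorem cells (hm : m < K) {F : ℕ → ι → ℕ → QBF (QVar ι) → QBF (QVar ι)}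
    (hF : ∀ s, EmitsPrefix code I α b (m + 1) P
      fun L (σ : Fin K → ℕ) => F L s (σ ⟨m, hm⟩)) :
    EmitsPrefix code I α b m P fun L (_ : Fin K → ℕ) φ =>
      (QBF.cells ι (b ^ L)).foldr (fun x φ => F L x.2 x.1 φ) φ := by
  choose pre hpre hF using hF
  -- The prefix is determined by the text of `F L s i`, hence by the value of counter `m` alone, so
  -- all other counters may be replaced by zero.
  have hpre' : ∀ L s i φ, qbfText code T I (F L s i φ) =
      pre s L (Function.update (fun _ => 0) ⟨m, hm⟩ i) ++ qbfText code T I φ := fun L s i φ => by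
    have := hF s L (Function.update (fun _ => 0) ⟨m, hm⟩ i) φ
    simpa only [Function.update_self] using this
  refine ⟨fun L _ => (QBF.cells ι (b ^ L)).flatMap fun x =>
    pre x.2 L (Function.update (fun _ => 0) ⟨m, hm⟩ x.1), Emits.cells hm (F := fun L s i =>
      pre s L (Function.update (fun _ => 0) ⟨m, hm⟩ i)) fun s => ?_, fun L _ φ => ?_⟩
  · refine (hpre s).congr fun w L h σ _ _ _ => ?_
    have h1 := hF s L σ QBF.tt
    rw [hpre'] at h1
    exact List.append_cancel_right h1
  · exact text_foldr (qbfText code T I) _ (fun x ψ => hpre' L x.2 x.1 ψ) φ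

theorem range (hm : m < K) {F : ℕ → ℕ → QBF (QVar ι) → QBF (QVar ι)}
    (hF : EmitsPrefix code I α b (m + 1) P fun L (σ : Fin K → ℕ) => F L (σ ⟨m, hm⟩)) :
    EmitsPrefix code I α b m P fun L (_ : Fin K → ℕ) φ =>
      (List.range (b ^ L)).foldr (fun i φ => F L i φ) φ := by
  obtain ⟨pre, hpre, hF⟩ := hF
  refine ⟨fun L σ => (List.range (b ^ L)).flatMap fun i => pre L (Function.update σ ⟨m, hm⟩ i),
    Emits.range hm hpre, fun L σ φ => ?_⟩
  refine text_foldr (qbfText code T I) _ (fun i ψ => ?_) φ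
  have := hF L (Function.update σ ⟨m, hm⟩ i) ψ
  simpa only [Function.update_self] using this

end EmitsPrefix

theorem EmitsQBF.ofPrefix {χ : ℕ → (Fin K → ℕ) → QBF (QVar ι)} (hF : EmitsPrefix code I α b m P F)
    (hφ : EmitsQBF code I α b m P φ) (h : ∀ L σ, χ L σ = F L σ (φ L σ)) :
    EmitsQBF code I α b m P χ := by
  obtain ⟨pre, hpre, hF⟩ := hF
  refine (Emits.append hpre hφ).congr fun w L _ σ _ _ _ => ?_
  rw [h, hF]

theorem emitsPrefix_halve (ha : IsTemplateFor code T.atom) (hm : m < K) {i : Fin K} (hi : i < m)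
    (s : ι) : EmitsPrefix code I α b m P fun _ (σ : Fin K → ℕ) => halve (σ i, s) := by
  have hs : ∀ a, EmitsQBF code I α b m P fun _ (σ : Fin K → ℕ) => same temp (bit a s (σ i)) :=
    fun a => .or (.and (.const _) (.lit ha hm hi _ _)) (.and (.const _) (.lit ha hm hi _ _))
  have hs' : ∀ a, EmitsQBF code I α b m P fun _ (σ : Fin K → ℕ) => same (bit a s (σ i)) temp :=
    fun a => .or (.and (.lit ha hm hi _ _) (.const _)) (.and (.lit ha hm hi _ _) (.const _))
  have hc : ∀ a a', EmitsQBF code I α b m P fun _ (σ : Fin K → ℕ) =>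
      choice temp half (bit a s (σ i)) (bit a' s (σ i)) :=
    fun a a' => .or (.and (.const _) (hs a)) (.and (.const _) (hs a'))
  have hmux : ∀ a a' a'', EmitsPrefix code I α b m P fun _ (σ : Fin K → ℕ) =>
      mux temp (bit a s (σ i)) half (bit a' s (σ i)) (bit a'' s (σ i)) :=
    fun a a' a'' => .comp (.ex_const temp) (.comp (.and (hc a' a''))
      (.comp (.ex hm hi (.inr (a, s))) (.and (hs' a)) fun _ _ _ => rfl) fun _ _ _ => rfl)
      fun _ _ _ => rfl
  exact .comp (hmux 1 2 1) (hmux 0 0 2) fun _ _ _ => rfl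

theorem emitsPrefix_level (ha : IsTemplateFor code T.atom) (hm : m + 1 < K) :
    EmitsPrefix code I α b m P fun L (_ : Fin K → ℕ) => level (ι := ι) (b ^ L) := by
  have h : m < m + 1 := Nat.lt_succ_self m
  exact .comp (.cells (by omega) (F := fun _ s i => QBF.ex (bit 2 s i)) fun s =>
      .ex hm (i := ⟨m, _⟩) h (.inr (2, s)))
    (.comp (.all_const half) (.cells (by omega) (F := fun _ s i => halve (i, s)) fun s =>
      emitsPrefix_halve ha hm (i := ⟨m, _⟩) h s) fun _ _ _ => rfl) fun _ _ _ => rfl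

theorem emitsQBF_cellIs (ha : IsTemplateFor code T.atom) (hm : m < K) {i : Fin K} (hi : i < m)
    (a : Fin 3) (x : ι → Bool) :
    EmitsQBF code I α b m P fun _ (σ : Fin K → ℕ) => cellIs a x (σ i) :=
  .foldr _ (fun _ => .and (.lit ha hm hi _ _)) (.const _)

/-- Three counters hold a cell and its two cyclic successors; the fourth is scratch for writing
variables. -/
theorem emitsQBF_globalStep (ha : IsTemplateFor code T.atom) (hm : m + 3 < K)
    (g : (ι → Bool) → (ι → Bool) → (ι → Bool) → ι → Bool) :
    EmitsQBF code I α b m P fun L (_ : Fin K → ℕ) => globalStep (b ^ L) g := by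
  have hstep : EmitsQBF code I α b (m + 3) P fun _ (σ : Fin K → ℕ) =>
      localStep g (σ ⟨m, by omega⟩) (σ ⟨m + 1, by omega⟩) (σ ⟨m + 2, by omega⟩) := by
    have h0 : ((⟨m, by omega⟩ : Fin K) : ℕ) < m + 3 := by simp
    have h1 : ((⟨m + 1, by omega⟩ : Fin K) : ℕ) < m + 3 := by simp
    have h2 : ((⟨m + 2, by omega⟩ : Fin K) : ℕ) < m + 3 := by simp
    exact .foldr _ (fun x => .or (.and (emitsQBF_cellIs ha hm h0 _ _)
      (.and (emitsQBF_cellIs ha hm h1 _ _) (.and (emitsQBF_cellIs ha hm h2 _ _)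
        (emitsQBF_cellIs ha hm h1 _ _))))) (.const _)
  have hsucc : EmitsQBF code I α b (m + 1) P fun L (σ : Fin K → ℕ) =>
      localStep g (σ ⟨m, by omega⟩) ((σ ⟨m, by omega⟩ + 1) % b ^ L)
        (((σ ⟨m, by omega⟩ + 1) % b ^ L + 1) % b ^ L) := by
    have := Emits.cyclicSucc (by omega : m + 1 < K) ⟨m, by omega⟩ (by simp)
      (Emits.cyclicSucc (by omega : m + 2 < K) ⟨m + 1, by omega⟩ (by simp) hstep)
    refine this.congr fun w L h σ _ _ _ => ?_
    simp
  exact .ofPrefix (.range (by omega)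
    (F := fun L i φ => (localStep g i ((i + 1) % b ^ L) (((i + 1) % b ^ L + 1) % b ^ L)).and φ)
    (.and hsucc)) (.const tt) fun _ _ => rfl

theorem emitsQBF_reach (ha : IsTemplateFor code T.atom) (hm : m + 3 < K)
    (g : (ι → Bool) → (ι → Bool) → (ι → Bool) → ι → Bool) :
    EmitsQBF code I α b m P fun L (_ : Fin K → ℕ) => reach (b ^ L) g :=
  .ofPrefix (.cells (by omega) (F := fun L _ _ φ => level (b ^ L) φ) fun _ =>
    emitsPrefix_level ha (by omega)) (emitsQBF_globalStep ha hm g) fun _ _ => rfl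

/-- The text of `accepts`, with initial tape read off the input, is emitted. -/
theorem emits_accepts [Finite α] (ha : IsTemplateFor code T.atom) (hK : 3 < K)
    (g : (ι → Bool) → (ι → Bool) → (ι → Bool) → ι → Bool) (acc : (ι → Bool) → Prop)
    (init : InputCell α → Prop → ι → Bool) :
    Emits b 0 (fun h => h = 0) (fun w L _ _ => qbfText code T I (accepts (b ^ L) g acc
      fun i => init (inputTape w (min (i + 1) (w.length + 1))) (i = 0)) :
      Emission α Token K) := by
  have hrest : EmitsQBF code I α b 0 (fun h => h = 0) fun L (_ : Fin K → ℕ) =>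
      (cells ι (b ^ L)).foldr (fun x φ => ex (bit 1 x.2 x.1) φ)
      ((List.range (b ^ L)).foldr (fun i φ => (cellAccepts acc i).and φ) (reach (b ^ L) g)) := by
    have h : 0 < 0 + 1 := Nat.lt_succ_self 0
    exact .ofPrefix (.cells (by omega) (F := fun _ s i φ => ex (bit 1 s i) φ) fun s =>
      .ex (by omega) (i := ⟨0, _⟩) h (.inr (1, s)))
      (.ofPrefix (.range (by omega) (F := fun _ i => (cellAccepts acc i).and) (.and
        (.foldr _ (fun x => .or (emitsQBF_cellIs ha (by omega) (i := ⟨0, _⟩) h 1 x)) (.const ff))))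
        (emitsQBF_reach ha (by omega) g) fun _ _ => rfl) fun _ _ => rfl
  have hset : ∀ (s : ι) (c : Bool), EmitsPrefix code I α b 1 (fun _ => True)
      fun _ (σ : Fin K → ℕ) => set (bit 0 s (σ ⟨0, by omega⟩)) c := fun s c =>
    .comp (.ex (by omega) (i := ⟨0, _⟩) Nat.one_pos (.inr (0, s)))
      (.and (.lit ha (by omega) (i := ⟨0, _⟩) Nat.one_pos c (.inr (0, s)))) fun _ _ _ => rfl
  choose pre hpre hset using hset
  -- The initial bit depends only on the input cell under the head and on whether the counter is
  -- zero, so finitely many cases suffice.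
  have hcell : Emits b 1 (fun _ => True) (fun w L h σ =>
      (Finset.univ : Finset ι).toList.flatMap fun s =>
        pre s (init (inputTape w h) (σ ⟨0, by omega⟩ = 0) s) L σ : Emission α Token K) :=
    Emits.flatMap _ fun s => Emits.input
      (f := fun x w L h σ => pre s (init x (σ ⟨0, by omega⟩ = 0) s) L σ) fun x =>
        Emits.zero ⟨0, by omega⟩ (f := fun q w L h σ => pre s (init x q s) L σ) fun q => hpre s _
  refine ((Emits.rangeInput (by omega) hcell).append hrest).congr fun w L h σ _ _ _ => ?_
  refine text_foldr (qbfText code T I) _ (fun i ψ => ?_) _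
  refine text_foldr (qbfText code T I) _ (fun s ψ => ?_) _
  have := hset s (init (inputTape w (min (i + 1) (w.length + 1))) (i = 0) s) L
    (Function.update σ ⟨0, by omega⟩ i) ψ
  simpa only [Function.update_self] using this

/-- The sentences that are the values of the reduction. -/
noncomputable def Frame.sentence (T : Frame S) (B : ℕ) (φ : QBF (QVar ι)) : Formula S :=
  Formula.closure (T.allVars ι B) (T.matrix T.index φ)

theorem emits_sentence [Finite α] (ha : IsTemplateFor code T.atom) (hK : 3 < K)
    (g : (ι → Bool) → (ι → Bool) → (ι → Bool) → ι → Bool) (acc : (ι → Bool) → Prop)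
    (init : InputCell α → Prop → ι → Bool) :
    Emits b 0 (fun h => h = 0) (fun w L _ _ => encode code (T.sentence (b ^ L)
      (accepts (b ^ L) g acc fun i =>
        init (inputTape w (min (i + 1) (w.length + 1))) (i = 0))) : Emission α Token K) := by
  have hclose : Emits b 0 (fun h => h = 0) (fun _ L _ _ =>
      (T.allVars ι (b ^ L)).flatMap fun n => Token.all :: encodeVar n : Emission α Token K) := by
    refine (Emits.range (by omega) (Emits.flatMap (List.range (T.width ι)) fun c =>
      (Emits.const [Token.all]).append (Emits.encodeVar (m := 0 + 1) (by omega) (i := ⟨0, by omega⟩)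
        (Nat.lt_succ_self 0) (T.width ι) c))).congr fun w L h σ _ _ _ => ?_
    simp [Frame.allVars, List.flatMap_assoc, List.flatMap_map]
  have hvals := Emits.flatMap (b := b) (K := K) (Finset.univ : Finset (Fin T.N → Bool)).toList
    fun I => (Emits.const [connToken T.p]).append
      (emits_accepts (code := code) (T := T) (I := I) ha hK g acc init)
  refine (hclose.append ((Emits.const ([quantToken (!T.p)] ++ encodeVar (T.truth false) ++
      [quantToken (!T.p)] ++ encodeVar (T.truth true) ++ [connToken (!T.p)] ++
      encode code (T.atom (T.truth false) (T.truth true)) ++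
      (List.finRange T.N).flatMap fun k => quantToken T.p :: encodeVar (T.name k))).append
    (hvals.append (Emits.const (encode code (T.atom (T.truth false) (T.truth false))))))).congr
    fun w L h σ _ _ _ => ?_
  have h1 : ∀ (l : List ℕ) (φ : Formula S), encode code (Formula.closure l φ) =
      (l.flatMap fun n => Token.all :: encodeVar n) ++ encode code φ := fun l φ =>
    text_foldr (encode code) l (fun n ψ => by simp [encode]) φ
  have h2 : ∀ φ : Formula S, encode code ((List.finRange T.N).foldr
      (fun k ψ => Formula.quant T.p (T.name k) ψ) φ) =
      ((List.finRange T.N).flatMap fun k => quantToken T.p :: encodeVar (T.name k)) ++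
        encode code φ := fun φ =>
    text_foldr (encode code) _ (fun k ψ => by simp [encode_quant]) φ
  have h3 : ∀ (φ : QBF (QVar ι)) (χ : Formula S),
      encode code ((Finset.univ : Finset (Fin T.N → Bool)).toList.foldr
        (fun I ψ => Formula.conn T.p (T.translate T.index I φ) ψ) χ) =
      ((Finset.univ : Finset (Fin T.N → Bool)).toList.flatMap fun I =>
        [connToken T.p] ++ qbfText code T I φ) ++ encode code χ := fun φ χ =>
    text_foldr (encode code) _ (fun I ψ => by simp [encode_conn, qbfText]) χ
  rw [Frame.sentence, h1, Frame.matrix, encode_quant, encode_quant, encode_conn, h2, h3]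
  simp only [List.append_assoc, List.cons_append, List.nil_append]

end emission

/-! ### Hardness from a definable equivalence relation -/

/-- As `n + 2 ≥ 2`, sums and coefficients are absorbed by raising the exponent. -/
theorem exists_pow_bound (p : Polynomial ℕ) : ∃ d, ∀ n, p.eval n ≤ (n + 2) ^ d := by
  induction p using Polynomial.induction_on' with
  | add p q hp hq =>
    obtain ⟨d, hd⟩ := hp
    obtain ⟨d', hd'⟩ := hq
    refine ⟨max d d' + 1, fun n => ?_⟩
    have h1 : (n + 2) ^ d ≤ (n + 2) ^ max d d' := Nat.pow_le_pow_right (by omega) (le_max_left _ _)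
    have h2 : (n + 2) ^ d' ≤ (n + 2) ^ max d d' :=
      Nat.pow_le_pow_right (by omega) (le_max_right _ _)
    have h3 : 2 * (n + 2) ^ max d d' ≤ (n + 2) ^ (max d d' + 1) := by
      rw [pow_succ, mul_comm]; exact Nat.mul_le_mul_left _ (by omega)
    have := hd n
    have := hd' n
    rw [Polynomial.eval_add]
    omega
  | monomial k a =>
    refine ⟨a + k, fun n => ?_⟩
    rw [Polynomial.eval_monomial, pow_add]
    have h1 : a ≤ (n + 2) ^ a := (Nat.lt_two_pow_self (n := a)).le.trans
      (Nat.pow_le_pow_left (by omega) _)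
    exact Nat.mul_le_mul h1 (Nat.pow_le_pow_left (by omega) _)

/-- For `p = false` the sentence is true exactly when the Boolean formula is false, so the latter
has to express the negation of `P`. -/
theorem Frame.models_sentence {S : Signature} (T : Frame S) {ι : Type} [Fintype ι] {C : Model S}
    (hC : DefinesEquivalence C T.p T.r T.atom) (hN : Nat.card C.Carrier ≤ T.N)
    {φ : QBF (QVar ι)} {P : Prop} (hφ : ∀ β, φ.Sat β ↔ (P ↔ T.p = true)) (B : ℕ) :
    Models C (T.sentence B φ) ↔ P := by
  have : Nonempty C.Carrier := C.nontrivial.to_nonempty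
  have h : ∀ e, (T.matrix T.index φ).Sat C e ↔ P := by
    intro e
    have := T.holds_matrix hC hN T.index_injective T.le_index hφ e
    cases hp : T.p <;> simpa [Formula.Holds, hp, not_iff_not] using this
  simp only [Models, Frame.sentence, Formula.sat_closure h, forall_const]

theorem pspaceHard_of_definesEquivalence {S : Signature} (code : S.Symbol → List Bool)
    {A B : Model S} {L : Set Op} (hL : positiveOps ⊆ L) (p : Bool) (r : ℕ)
    {atom : ℕ → ℕ → Formula S} (hops : ∀ i j, (atom i j).ops ⊆ L)
    (hfree : ∀ i j, (atom i j).freeVars ⊆ {n | n = i ∨ n = j ∨ n < r})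
    (htemp : IsTemplateFor code atom) (hA : DefinesEquivalence A p r atom)
    (hB : DefinesEquivalence B p r atom) : PSPACEHard (promiseMC code L A B) := by
  intro α _ X ⟨M, q, hM⟩
  have := M.finite_Q
  have := M.finite_Γ
  let _ : Fintype M.Cell := Fintype.ofFinite _
  -- The polynomial is the number of cells required by `TM.accepts_iff`.
  obtain ⟨d, hd⟩ := exists_pow_bound (2 * q + Polynomial.X + 5)
  -- With `n < 2 ^ L` and `1 ≤ L` one has `n + 2 ≤ 2 ^ (2 * L)`, so `(n + 2) ^ d ≤ b ^ L`; the extra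
  -- `1` in the exponent ensures `2 ≤ b`.
  set b := 2 ^ (2 * d + 1) with hbdef
  have hb : 2 ≤ b := Nat.le_self_pow (by omega) 2
  have : NeZero b := ⟨by omega⟩
  -- The same sentence is evaluated in both structures, so there must be enough names for the larger
  -- one.
  let T : Frame S := ⟨p, r, max (Nat.card A.Carrier) (Nat.card B.Carrier), atom⟩
  let init : InputCell α → Prop → M.Cell → Bool := fun x c => M.bits (M.initCell x c)
  obtain ⟨len, hlen, hlog⟩ := (emits_sentence (code := code) (T := T) (α := α) (K := 4) (b := b)
    htemp (by norm_num) M.bitRule (M.cellAccepting p) init).logSpaceComputable (by norm_num) hb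
  let φ : List α → QBF (QVar M.Cell) := fun w => QBF.accepts (b ^ len w) M.bitRule
    (M.cellAccepting p) fun i => init (inputTape w (min (i + 1) (w.length + 1))) (i = 0)
  have hpos : ∀ w, 0 < b ^ len w := fun w => Nat.pow_pos (by omega)
  have hφ : ∀ w β, (φ w).Sat β ↔ (w ∈ X ↔ p = true) := by
    intro w β
    have : NeZero (b ^ len w) := ⟨(hpos w).ne'⟩
    rw [QBF.sat_accepts, ← M.accepts_iff hM p w (B := b ^ len w)]
    obtain ⟨h1, h2⟩ := hlen w
    have h3 := hd w.length
    simp only [Polynomial.eval_add, Polynomial.eval_mul, Polynomial.eval_X,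
      Polynomial.eval_ofNat] at h3
    refine h3.trans ?_
    have h4 : w.length + 2 ≤ 2 ^ (2 * len w) := by
      rw [two_mul, pow_add]
      have : 2 ^ 1 ≤ 2 ^ len w := Nat.pow_le_pow_right (by norm_num) h1
      nlinarith
    calc (w.length + 2) ^ d ≤ (2 ^ (2 * len w)) ^ d := Nat.pow_le_pow_left h4 d
      _ ≤ b ^ len w := by
        rw [hbdef, ← pow_mul, ← pow_mul]
        refine Nat.pow_le_pow_right (by norm_num) ?_
        nlinarith
  have hsent : ∀ w, (T.sentence (b ^ len w) (φ w)).IsSentence L := by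
    intro w
    constructor
    · rw [Frame.sentence, Formula.freeVars_closure, Set.sdiff_eq_empty]
      refine Set.Subset.trans (T.freeVars_matrix (s := {n | n < b ^ len w * T.width M.Cell})
        (q := fun v => v.2 < b ^ len w) (fun i hi j hj n hn => ?_) (fun i hi => ?_)
        (fun v hv => T.index_lt hv) (QBF.within_accepts (hpos w) _ _ _))
        fun n hn => T.mem_allVars hn
      · rcases hfree i j hn with rfl | rfl | hn
        · exact hi
        · exact hj
        · refine lt_of_lt_of_le (show n < T.width M.Cell from ?_)
            (Nat.le_mul_of_pos_left _ (hpos w))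
          simp only [Frame.width, T]; omega
      · refine lt_of_lt_of_le (show i < T.width M.Cell from ?_)
          (Nat.le_mul_of_pos_left _ (hpos w))
        simp only [Frame.width]; omega
    · exact Formula.ops_foldr _ (fun _ _ h => Set.insert_subset (hL (by simp [positiveOps])) h)
        (T.ops_matrix hL hops _ _)
  refine ⟨_, hlog, fun w hw => ⟨_, hsent w, ?_, rfl⟩, fun w hw => ⟨_, hsent w, ?_, rfl⟩⟩
  · exact (T.models_sentence hA (le_max_left _ _) (hφ w) _).2 hw
  · exact fun h => hw ((T.models_sentence hB (le_max_right _ _) (hφ w) _).1 h)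

/-! ### Definable equivalence relations -/

/-- This is the rule for blocks of existential quantifiers, read with negative polarity. -/
theorem Formula.sat_closure_iff {S : Signature} {A : Model S} (l : List ℕ) (φ : Formula S)
    (e : ℕ → A.Carrier) : (Formula.closure l φ).Sat A e ↔
      ∀ e' : ℕ → A.Carrier, (∀ i, i ∉ l → e' i = e i) → φ.Sat A e' := by
  have h : ¬ (Formula.closure l φ).Sat A e ↔ _ :=
    Formula.holds_foldr_ex (A := A) (p := false) (φ := φ) (e := e) l id
  rw [← not_iff_not, h]
  simp only [Formula.Holds, id]
  push Not
  refine exists_congr fun e' => and_congr_left fun _ => forall_congr' fun i => ?_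
  constructor
  · exact fun h hi => h fun j hj hji => hi (hji ▸ hj)
  · exact fun h hi => h fun hm => hi i hm rfl

section template

variable {S : Signature} {code : S.Symbol → List Bool} {F G : ℕ → ℕ → Formula S}

/-- Variables that are fixed or one of two parameters. -/
def instantiate (i j : ℕ) : ℕ ⊕ Bool → ℕ := Sum.elim id fun c => if c then i else j

theorem isTemplateFor_rel (R : S.Symbol) (c : Fin (S.arity R) → ℕ ⊕ Bool) :
    IsTemplateFor code fun i j => .rel R fun k => instantiate i j (c k) := by
  refine ⟨.inl (Token.rel :: (code R).map Token.bit) ::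
    List.ofFn fun k => Sum.map encodeVar id (c k), fun i j => ?_⟩
  rw [encode, List.flatMap_cons, List.flatMap_def, List.map_ofFn]
  simp only [Sum.elim_inl, id, List.cons_append]
  congr 5
  funext k
  rcases h : c k with n | n <;> simp [instantiate, h]

theorem IsTemplateFor.neg (hF : IsTemplateFor code F) :
    IsTemplateFor code fun i j => .neg (F i j) := by
  obtain ⟨t, ht⟩ := hF
  exact ⟨.inl [Token.neg] :: t, fun i j => by simp [encode, ht]⟩

theorem IsTemplateFor.conj (hF : IsTemplateFor code F) (hG : IsTemplateFor code G) :
    IsTemplateFor code fun i j => .conj (F i j) (G i j) := by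
  obtain ⟨t, ht⟩ := hF
  obtain ⟨u, hu⟩ := hG
  exact ⟨.inl [Token.conj] :: (t ++ u), fun i j => by simp [encode, ht, hu]⟩

theorem IsTemplateFor.disj (hF : IsTemplateFor code F) (hG : IsTemplateFor code G) :
    IsTemplateFor code fun i j => .disj (F i j) (G i j) := by
  obtain ⟨t, ht⟩ := hF
  obtain ⟨u, hu⟩ := hG
  exact ⟨.inl [Token.disj] :: (t ++ u), fun i j => by simp [encode, ht, hu]⟩

theorem IsTemplateFor.closure (hF : IsTemplateFor code F) (l : List ℕ) :
    IsTemplateFor code fun i j => Formula.closure l (F i j) := by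
  induction l with
  | nil => exact hF
  | cons n l ih =>
    obtain ⟨t, ht⟩ := ih
    exact ⟨.inl (Token.all :: encodeVar n) :: t, fun i j => by
      rw [List.flatMap_cons, ← ht i j]; simp [encode, Formula.closure]⟩

theorem IsTemplateFor.foldr_conj {X : Type*} {H : X → ℕ → ℕ → Formula S}
    (hH : ∀ x, IsTemplateFor code (H x)) (hF : IsTemplateFor code F) (l : List X) :
    IsTemplateFor code fun i j => l.foldr (fun x ψ => .conj (H x i j) ψ) (F i j) := by
  induction l with
  | nil => exact hF
  | cons x l ih => exact (hH x).conj ih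

end template

section indiscernible

variable {S : Signature}

/-- Indiscernibility of two elements in all positions of `R`. -/
def indiscernible (A : Model S) (R : S.Symbol) : Setoid A.Carrier where
  r x y := ∀ k t, Function.update t k x ∈ A.interp R ↔ Function.update t k y ∈ A.interp R
  iseqv := ⟨fun _ _ _ => Iff.rfl, fun h k t => (h k t).symm,
    by intro x y z h h' k t; exact (h k t).trans (h' k t)⟩

/-- If all elements were indiscernible, a tuple in `R` could be turned into any other tuple one
coordinate at a time without leaving `R`. -/
theorem exists_not_indiscernible (A : Model S) (R : S.Symbol) :
    ∃ x y, ¬ indiscernible A R x y := by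
  classical
  by_contra! h
  obtain ⟨t, ht⟩ := A.interp_nonempty R
  refine A.interp_proper R (Set.eq_univ_of_forall fun u => ?_)
  have : ∀ s : Finset (Fin (S.arity R)), (fun k => if k ∈ s then u k else t k) ∈ A.interp R := by
    intro s
    induction s using Finset.induction_on with
    | empty => simpa using ht
    | insert k s _ ih =>
      have h1 := (h (u k) (if k ∈ s then u k else t k) k
        fun k => if k ∈ s then u k else t k).2 (by rwa [Function.update_eq_self])
      convert h1 using 1
      funext l
      by_cases hl : l = k
      · subst hl; simp
      · simp [hl]
  simpa using this Finset.univ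

/-- The tuple of the variables `0, 1, …`, with the `k`-th one replaced. -/
def tuple {n : ℕ} (k : Fin n) (i : ℕ) : Fin n → ℕ := fun l => if l = k then i else l

/-- The formula that defines indiscernibility in position `k`, where `N` expresses the complement
of `R`. -/
def indiscernibleAt (R : S.Symbol) (N : (Fin (S.arity R) → ℕ) → Formula S)
    (k : Fin (S.arity R)) (i j : ℕ) : Formula S :=
  Formula.closure (List.range (S.arity R))
    (.disj (.conj (.rel R (tuple k i)) (.rel R (tuple k j)))
      (.conj (N (tuple k i)) (N (tuple k j))))

/-- The formula that defines indiscernibility. -/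
def indiscernibleFormula (R : S.Symbol) (N : (Fin (S.arity R) → ℕ) → Formula S)
    (i j : ℕ) : Formula S :=
  (List.finRange (S.arity R)).foldr (fun k ψ => .conj (indiscernibleAt R N k i j) ψ)
    -- The fragment has no constant for truth, so the fold ends with a repetition of position `0`,
    -- which exists since arities are positive.
    (indiscernibleAt R N ⟨0, S.arity_pos R⟩ i j)

variable {R : S.Symbol} {N : (Fin (S.arity R) → ℕ) → Formula S}

/-- The bound variables are those below the arity, and `hi` and `hj` keep the parameters clear of
them. Variable `k` is bound too but does not occur. -/
theorem sat_indiscernibleAt {A : Model S}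
    (hN : ∀ v e, (N v).Sat A e ↔ (fun k => e (v k)) ∉ A.interp R) (k : Fin (S.arity R)) {i j : ℕ}
    (hi : S.arity R ≤ i) (hj : S.arity R ≤ j) (e : ℕ → A.Carrier) :
    (indiscernibleAt R N k i j).Sat A e ↔ ∀ t,
      Function.update t k (e i) ∈ A.interp R ↔ Function.update t k (e j) ∈ A.interp R := by
  rw [indiscernibleAt, Formula.sat_closure_iff]
  have hval : ∀ (e' : ℕ → A.Carrier) (n : ℕ), (fun l => e' (tuple k n l)) =
      Function.update (fun l : Fin (S.arity R) => e' l) k (e' n) := by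
    intro e' n
    funext l
    by_cases hl : l = k
    · subst hl; simp [tuple]
    · simp [tuple, hl]
  simp only [Formula.Sat, hN, hval, List.mem_range, not_lt]
  constructor
  · intro h t
    have := h (fun n => if hn : n < S.arity R then t ⟨n, hn⟩ else e n)
      fun n hn => by simp [not_lt.2 hn]
    simp only [not_lt.2 hi, not_lt.2 hj, dif_neg, not_false_eq_true, Fin.is_lt, dif_pos,
      Fin.eta] at this
    tauto
  · intro h e' he'
    have := h fun l => e' l
    rw [he' i hi, he' j hj]
    tauto

theorem definesEquivalence_indiscernible {A : Model S}
    (hN : ∀ v e, (N v).Sat A e ↔ (fun k => e (v k)) ∉ A.interp R) :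
    DefinesEquivalence A true (S.arity R) (indiscernibleFormula R N) := by
  refine ⟨indiscernible A R, exists_not_indiscernible A R, fun i j e hi hj => ?_⟩
  have : Formula.Holds A true (indiscernibleFormula R N i j) e ↔ _ :=
    Formula.holds_foldr_and (A := A) (p := true) (e := e) (List.finRange (S.arity R))
      (fun k => indiscernibleAt R N k i j)
  rw [this]
  simp only [Formula.Holds, if_true, List.mem_finRange, true_imp_iff,
    sat_indiscernibleAt hN _ hi hj]
  exact ⟨fun h k => h.1 k, fun h => ⟨h, h _⟩⟩

theorem pspaceHard_of_complement {code : S.Symbol → List Bool} {A B : Model S} {L : Set Op}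
    (hL : positiveOps ⊆ L) (hops : ∀ v, (N v).ops ⊆ L) (hfree : ∀ v, (N v).freeVars ⊆ Set.range v)
    (htemp : ∀ c : Fin (S.arity R) → ℕ ⊕ Bool,
      IsTemplateFor code fun i j => N fun k => instantiate i j (c k))
    (hA : ∀ v e, (N v).Sat A e ↔ (fun k => e (v k)) ∉ A.interp R)
    (hB : ∀ v e, (N v).Sat B e ↔ (fun k => e (v k)) ∉ B.interp R) :
    PSPACEHard (promiseMC code L A B) := by
  refine pspaceHard_of_definesEquivalence code hL true (S.arity R)
    (atom := indiscernibleFormula R N) (fun i j => ?_) (fun i j => ?_) ?_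
    (definesEquivalence_indiscernible hA) (definesEquivalence_indiscernible hB)
  · have h : ∀ k, (indiscernibleAt R N k i j).ops ⊆ L := fun k =>
      Formula.ops_foldr _ (fun _ _ h => Set.insert_subset (hL (by simp [positiveOps])) h)
        (by simp [Formula.ops, Set.insert_subset_iff, hops,
          hL (show Op.conj ∈ positiveOps by simp [positiveOps]),
          hL (show Op.disj ∈ positiveOps by simp [positiveOps])])
    exact Formula.ops_foldr _ (fun k _ h' => Set.insert_subset (hL (by simp [positiveOps]))
      (Set.union_subset (h k) h')) (h _)
  · have ht : ∀ (k : Fin (S.arity R)) (n : ℕ), n = i ∨ n = j →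
        Set.range (tuple k n) ⊆ {n | n = i ∨ n = j ∨ n < S.arity R} := by
      rintro k n hn _ ⟨l, rfl⟩
      by_cases hl : l = k
      · simp only [tuple, hl, if_true, Set.mem_ofPred_eq]; tauto
      · simp [tuple, hl]
    have h : ∀ k, (indiscernibleAt R N k i j).freeVars ⊆ {n | n = i ∨ n = j ∨ n < S.arity R} := by
      intro k
      rw [indiscernibleAt, Formula.freeVars_closure]
      refine Set.sdiff_subset.trans (Set.union_subset (Set.union_subset ?_ ?_)
        (Set.union_subset ?_ ?_))
      · exact ht k i (.inl rfl)
      · exact ht k j (.inr rfl)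
      · exact (hfree _).trans (ht k i (.inl rfl))
      · exact (hfree _).trans (ht k j (.inr rfl))
    exact Formula.freeVars_foldr _ (fun k _ h' => Set.union_subset (h k) h') (h _)
  · have hc : ∀ (k : Fin (S.arity R)), (∃ c : Fin (S.arity R) → ℕ ⊕ Bool, ∀ i j,
        tuple k i = fun l => instantiate i j (c l)) ∧ ∃ c : Fin (S.arity R) → ℕ ⊕ Bool, ∀ i j,
        tuple k j = fun l => instantiate i j (c l) := by
      intro k
      refine ⟨⟨fun l => if l = k then .inr true else .inl l, fun i j => ?_⟩,
        ⟨fun l => if l = k then .inr false else .inl l, fun i j => ?_⟩⟩ <;>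
      · funext l
        by_cases hl : l = k <;> simp [tuple, instantiate, hl]
    have h : ∀ k, IsTemplateFor code (indiscernibleAt R N k) := by
      intro k
      obtain ⟨⟨c, hc⟩, c', hc'⟩ := hc k
      have := (((isTemplateFor_rel (code := code) R c).conj (isTemplateFor_rel R c')).disj
        ((htemp c).conj (htemp c'))).closure (List.range (S.arity R))
      simp only [← hc, ← hc'] at this
      exact this
    exact IsTemplateFor.foldr_conj h (h _) _

end indiscernible

/-! ### Complements, negation, equality and disequality -/

theorem pspaceHard_of_closedUnderComplementation {S : Signature} (code : S.Symbol → List Bool)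
    {A B : Model S} (h : ClosedUnderComplementation A B) :
    PSPACEHard (promiseMC code positiveOps A B) := by
  obtain ⟨R⟩ := S.nonempty
  obtain ⟨R', h, hA, hB⟩ := h R
  exact pspaceHard_of_complement (R := R) (N := fun v => .rel R' fun k => v (Fin.cast h k))
    subset_rfl (fun _ => Set.empty_subset _) (fun v => Set.range_comp_subset_range _ v)
    (fun c => isTemplateFor_rel R' fun k => c (Fin.cast h k))
    (fun v e => hA fun k => e (v k)) (fun v e => hB fun k => e (v k))

theorem pspaceHard_of_neg_mem {S : Signature} (code : S.Symbol → List Bool)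
    (A B : Model S) {L : Set Op} (hL : positiveOps ⊆ L) (h : Op.neg ∈ L) :
    PSPACEHard (promiseMC code L A B) := by
  obtain ⟨R⟩ := S.nonempty
  exact pspaceHard_of_complement (R := R) (N := fun v => .neg (.rel R v)) hL
    (fun _ => Set.insert_subset h (Set.empty_subset _)) (fun v => subset_rfl)
    (fun c => (isTemplateFor_rel R c).neg) (fun _ _ => Iff.rfl) (fun _ _ => Iff.rfl)

theorem definesEquivalence_equal {S : Signature} (A : Model S) :
    DefinesEquivalence A true 0 Formula.equal := by
  have := A.nontrivial
  exact ⟨⊥, exists_pair_ne A.Carrier, fun _ _ _ _ _ => Iff.rfl⟩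

/-- With negative polarity the atom counts as holding when it is false, that is, when the two
elements are equal. -/
theorem definesEquivalence_unequal {S : Signature} (A : Model S) :
    DefinesEquivalence A false 0 Formula.unequal := by
  have := A.nontrivial
  exact ⟨⊥, exists_pair_ne A.Carrier, fun _ _ _ _ _ => not_not⟩

theorem pspaceHard_of_equal_mem {S : Signature} (code : S.Symbol → List Bool)
    (A B : Model S) {L : Set Op} (hL : positiveOps ⊆ L) (h : Op.equal ∈ L) :
    PSPACEHard (promiseMC code L A B) :=
  pspaceHard_of_definesEquivalence code hL true 0 (atom := Formula.equal)
    (fun _ _ => Set.singleton_subset_iff.2 h) (fun _ _ _ hn => hn.imp id .inl)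
    ⟨[.inl [Token.equal], .inr true, .inr false], fun i j => by simp [encode]⟩
    (definesEquivalence_equal A) (definesEquivalence_equal B)

theorem pspaceHard_of_unequal_mem {S : Signature} (code : S.Symbol → List Bool)
    (A B : Model S) {L : Set Op} (hL : positiveOps ⊆ L) (h : Op.unequal ∈ L) :
    PSPACEHard (promiseMC code L A B) :=
  pspaceHard_of_definesEquivalence code hL false 0 (atom := Formula.unequal)
    (fun _ _ => Set.singleton_subset_iff.2 h) (fun _ _ _ hn => hn.imp id .inl)
    ⟨[.inl [Token.unequal], .inr true, .inr false], fun i j => by simp [encode]⟩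
    (definesEquivalence_unequal A) (definesEquivalence_unequal B)

end PMC

theorem mainTheorem7 (S : PMC.Signature) (code : S.Symbol → List Bool)
    (hcode : Function.Injective code) (A B : PMC.Model S) :
    (PMC.IsTemplate PMC.positiveOps A B → PMC.ClosedUnderComplementation A B →
      PMC.PSPACEHard (PMC.promiseMC code PMC.positiveOps A B)) ∧
    (∀ L : Set PMC.Op, PMC.positiveOps ⊂ L → PMC.IsTemplate L A B →
      PMC.PSPACEHard (PMC.promiseMC code L A B)) := by
  refine ⟨fun _ h => PMC.pspaceHard_of_closedUnderComplementation code h, fun L hL _ => ?_⟩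
  -- A symbol of `L` outside the positive fragment is one of `=`, `≠`, `¬`, and each of them
  -- suffices alone.
  obtain ⟨o, ho, hpos⟩ := Set.exists_of_ssubset hL
  cases o with
  | equal => exact PMC.pspaceHard_of_equal_mem code A B hL.subset ho
  | unequal => exact PMC.pspaceHard_of_unequal_mem code A B hL.subset ho
  | neg => exact PMC.pspaceHard_of_neg_mem code A B hL.subset ho
  | _ => exact absurd (by simp [PMC.positiveOps]) hpos
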